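/- Consider the classical compound Poisson risk model with initial reserve $u\ge 0$, $$U_t(u)=u+ct-\sum_{i=1}^{N_t}Z_i,\qquad t\ge 0,$$ where $c>0$, $(N_t)$ is a Poisson process of intensity $\lambda>0$, and the claim costs $Z_i$ are positive, i.i.d., independent of $(N_t)$, with distribution function $F$ of unbounded support. Put $m_i=\mathbb E[Z_1^i]$, $\theta=\frac{c}{\lambda m_1}-1$ (safety loading), $f_I(x)=\frac{1-F(x)}{m_1}$, $F_I(x)=\int_0^x f_I(y)\,dy$. Let $T(u)=\inf\{t\ge 0: U_t(u)<0\}$ be the time of ruin, $\psi(u)=\mathbb P(T(u)<\infty)$, and $$s_j(u)=\mathbb E\big[(U_{T-})^j\,\big|\,T<\infty\big],$$ the conditional $j$-th moment of the surplus just before ruin given that ruin occurs. For an integer $k\ge 2$ the model is called light-tailed if (A1) there is $R>0$ (the adjustment coefficient) with $\int_0^\infty e^{Rx}\frac{f_I(x)}{1+\theta}\,dx=1$; (A2) $m_k^{\exp}:=\int_0^\infty x^k e^{Rx}\frac{f_I(x)}{1+\theta}\,dx<\infty$; (A3) $h_I:=\sup_{x\ge 0}\frac{f_I(x)}{1-F_I(x)}<\infty$.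 A second model of the same kind, with quantities $U_t^{DV},m_i^{DV},s_j^{DV},\dots$, is a De Vylder type approximation of order $k$ of the first one if $\mathbb E[U_t(u)^i]=\mathbb E[U^{DV}_t(u)^i]$ for all $i=1,\dots,k$, $t\ge 0$ and $u\ge 0$. Theorem. Let $k\ge 2$, $1\le j\le k-1$ and $\theta_0\in\mathbb R$. Let real numbers $m_i,m_i^{DV}$ ($1\le i\le k$) and real bounds $K,K^{DV},H,H^{DV}$ be given. There is a constant $C\ge 0$, depending only on these data, such that the following holds. Take any light-tailed model with claim moments $m_1,\dots,m_k$, with $m_k^{\exp}\le K$, $h_I\le H$ and safety loading $\theta\in(0,\theta_0]$, and any De Vylder type approximation of it of order $k$ that is light-tailed, has claim moments $m_1^{DV},\dots,m_k^{DV}$, and satisfies $m_k^{\exp,DV}\le K^{DV}$ and $h_I^{DV}\le H^{DV}$. Then, for every $u\ge 0$, both ruin probabilities $\psi(u)$ and $\psi^{DV}(u)$ are positive, $s_j(u)$ and $s_j^{DV}(u)$ are finite, $s_j(u)>0$, and $$\big|s_j(u)-s_j^{DV}(u)\big|\le C,\qquad \left|\frac{s_j(u)-s_j^{DV}(u)}{s_j(u)}\right|\le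 C .$$ That is, uniformly in $u\ge 0$ and in $\theta$ in a bounded interval of positive numbers, both the error and the relative error are $O(1)$. -/

import Mathlib

open MeasureTheory ProbabilityTheory Set

noncomputable section

/-- A classical compound Poisson risk model on the probability space `(Ω, P)`: the premium rate
`c > 0`, the Poisson intensity `lam > 0`, the inter-arrival times `W 0, W 1, …` of the Poisson
process (i.i.d. exponential of rate `lam`) and the claim costs `Z 0, Z 1, …` (i.i.d., positive,
with a distribution of unbounded support), all of them independent. -/
structure RiskModel (Ω : Type*) [MeasurableSpace Ω] (P : Measure Ω) where
  c : ℝ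
  lam : ℝ
  W : ℕ → Ω → ℝ
  Z : ℕ → Ω → ℝ
  c_pos : 0 < c
  lam_pos : 0 < lam
  measurable_W : ∀ i, Measurable (W i)
  measurable_Z : ∀ i, Measurable (Z i)
  law_W : ∀ i, P.map (W i) = expMeasure lam
  identDistrib_Z : ∀ i, IdentDistrib (Z i) (Z 0) P P
  Z_pos : ∀ i, ∀ᵐ ω ∂P, 0 < Z i ω
  indep : iIndepFun (fun i : ℕ ⊕ ℕ => Sum.elim W Z i) P
  unbounded_support : ∀ x : ℝ, 0 < P.real {ω | x < Z 0 ω}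

namespace RiskModel

variable {Ω : Type*} [MeasurableSpace Ω] {P : Measure Ω} (X : RiskModel Ω P)

/-- The arrival time of the claim with cost `Z i`. -/
def arrival (i : ℕ) (ω : Ω) : ℝ := ∑ n ∈ Finset.range (i + 1), X.W n ω

/-- The Poisson process `N_t`: the number of claims until time `t`. -/
def claimCount (t : ℝ) (ω : Ω) : ℕ := {i : ℕ | X.arrival i ω ≤ t}.ncard

/-- The reserve `U_t(u)` at time `t`, with initial reserve `u`. -/
def reserve (u t : ℝ) (ω : Ω) : ℝ :=
  u + X.c * t - ∑ i ∈ Finset.range (X.claimCount t ω), X.Z i ω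

/-- The time of ruin `T(u) = inf {t ≥ 0 | U_t(u) < 0}`, equal to `∞` if there is no ruin. -/
def ruinTime (u : ℝ) (ω : Ω) : ENNReal :=
  sInf (ENNReal.ofReal '' {t : ℝ | 0 ≤ t ∧ X.reserve u t ω < 0})

/-- The event that ruin occurs. -/
def ruinEvent (u : ℝ) : Set Ω := {ω | X.ruinTime u ω < ⊤}

/-- The ruin probability `ψ(u)`. -/
def ruinProb (u : ℝ) : ℝ := P.real (X.ruinEvent u)

/-- The surplus just before ruin, `U_{T-}`: the left limit of the reserve at the time of ruin. -/
def surplusBeforeRuin (u : ℝ) (ω : Ω) : ℝ :=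
  Function.leftLim (fun t => X.reserve u t ω) (X.ruinTime u ω).toReal

/-- The law `P(· | T(u) < ∞)`. -/
def ruinLaw (u : ℝ) : Measure Ω := P[|X.ruinEvent u]

/-- `s_j(u) = E[(U_{T-})^j | T(u) < ∞]`. -/
def surplusMoment (j : ℕ) (u : ℝ) : ℝ := ∫ ω, X.surplusBeforeRuin u ω ^ j ∂(X.ruinLaw u)

/-- The `j`-th moment `m_j` of the claim cost. -/
def moment (j : ℕ) : ℝ := ∫ ω, X.Z 0 ω ^ j ∂P

/-- The safety loading coefficient `θ`. -/
def loading : ℝ := X.c / (X.lam * X.moment 1) - 1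

/-- The survival function `1 - F` of the claim cost. -/
def tail (x : ℝ) : ℝ := P.real {ω | x < X.Z 0 ω}

/-- The integrated tail density `f_I`. -/
def fI (x : ℝ) : ℝ := X.tail x / X.moment 1

/-- The integrated tail distribution function `F_I`. -/
def FI (x : ℝ) : ℝ := ∫ y in (0 : ℝ)..x, X.fI y

/-- The hazard rate of the integrated tail distribution. -/
def hazard (x : ℝ) : ℝ := X.fI x / (1 - X.FI x)

/-- `h_I`, the supremum of the hazard rate. -/
def hI : ℝ := sSup (X.hazard '' Ici 0)

/-- The exponential moment `∫₀^∞ x^k exp(R x) f_I(x) / (1 + θ) dx`. -/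
def expMoment (k : ℕ) (R : ℝ) : ℝ :=
  ∫ x in Ioi (0 : ℝ), x ^ k * Real.exp (R * x) * (X.fI x / (1 + X.loading))

/-- The assumptions of light tails: `R` is the adjustment coefficient, the exponential moment of
order `k` is finite, and the hazard rate is bounded. -/
structure LightTailed (k : ℕ) (R : ℝ) : Prop where
  R_pos : 0 < R
  lundberg : ∫ x in Ioi (0 : ℝ), Real.exp (R * x) * (X.fI x / (1 + X.loading)) = 1
  expMoment_finite :
    IntegrableOn (fun x => x ^ k * Real.exp (R * x) * (X.fI x / (1 + X.loading))) (Ioi 0)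
  hazard_bounded : BddAbove (X.hazard '' Ici 0)

/-- `Y` is a De Vylder type approximation of `X` of order `k`: the reserves of the two models have
the same first `k` moments, at all times and for all initial reserves. -/
def IsDeVylderApprox {Ω' : Type*} [MeasurableSpace Ω'] {P' : Measure Ω'} (k : ℕ)
    (X : RiskModel Ω P) (Y : RiskModel Ω' P') : Prop :=
  ∀ i : ℕ, 1 ≤ i → i ≤ k → ∀ t u : ℝ, 0 ≤ t → 0 ≤ u →
    ∫ ω, X.reserve u t ω ^ i ∂P = ∫ ω, Y.reserve u t ω ^ i ∂P'

end RiskModel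

end

/-! Both estimates follow from a two-sided bound. Each conditional moment s_j lies in an interval
[b, B], with b > 0 and B depending only on the data. The difference of the two moments is then at
most B + B', and the relative error at most (B + B') / b.

Write Φ_w(u) = E[w(U_{T-}); T < ∞], so that s_j is the quotient of Φ for w = y^j by Φ for w = 1
(`surplusMoment_eq`, resting on the pathwise `ruin_cases`). Conditioning on the first claim makes
Φ_w an exponential transform. Integrating this relation, and discarding the terms at infinity by
Lundberg's inequality, gives the defective renewal equation `expectedReward_renewal`. Multiplied by
exp(R u) it becomes a proper renewal equation driven by `tiltedLaw`, whose total mass is one by the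
Lundberg equation.

No limit theorem is used, so the constants stay explicit. Solutions are compared with barriers built
from `stopLoss` by means of the maximum principle `nonpos_of_le_renewal`. This yields Φ_w(u) ≤ C
exp(-R u), with C linear in the integrals of w and x w against the tilted law, and Φ_1(u) ≥ p exp(-R
u). The exponentials cancel in the quotient, and w = y^j needs tilted moments up to order j + 1 ≤ k.
For the lower bound on s_j, the tilted law has bounded density near 0 (`tiltedLaw_Iic_le`). Hence
ruin from a surplus of at most e carries at most half of the ruin probability when e is small, and
s_j ≥ e^j / 2.

The barrier constants need the mass of the tilted law beyond m₁ / 2 and its mean truncated there to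
be bounded below. Both bounds come from m₁, m₂ and a lower bound on λ / c, which amounts to an upper
bound on θ. Matching the first two moments of the reserves makes the two loadings proportional
(`IsDeVylderApprox.loading_eq`), so the same argument covers the approximating model. -/

set_option linter.unusedSectionVars false

/-! ### Renewal inequalities: maximum principle and explicit barriers. -/

/-- A maximum principle for defective renewal inequalities. -/
theorem nonpos_of_le_renewal {μ : Measure ℝ} [IsProbabilityMeasure μ] (hμ : ∀ᵐ t ∂μ, 0 < t)
    (hμL : ∀ L : ℝ, μ.real (Iic L) < 1) {D : ℝ → ℝ} {M x₀ : ℝ}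
    (hM : ∀ u, 0 ≤ u → D u ≤ M) (h0 : ∀ u, 0 ≤ u → u < x₀ → D u ≤ 0)
    (h : ∀ u, 0 ≤ u → x₀ ≤ u → D u ≤ ∫ t in Iic u, D (u - t) ∂μ) {u : ℝ} (hu : 0 ≤ u) : D u ≤ 0 := by
  -- At points of [0, u] the inequality involves only values of D on [0, u]. Each application there
  -- multiplies a nonnegative upper bound by p < 1.
  set p := μ.real (Iic u)
  have hp0 : 0 ≤ p := measureReal_nonneg
  have key : ∀ s : ℝ, 0 ≤ s → (∀ v, 0 ≤ v → v ≤ u → D v ≤ s) → ∀ v, 0 ≤ v → v ≤ u → D v ≤ s * p := by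
    intro s hs hv v hv0 hvu
    rcases lt_or_ge v x₀ with hx | hx
    · exact (h0 v hv0 hx).trans (mul_nonneg hs hp0)
    · refine (h v hv0 hx).trans ?_
      by_cases hint : IntegrableOn (fun t => D (v - t)) (Iic v) μ
      · calc ∫ t in Iic v, D (v - t) ∂μ ≤ ∫ t in Iic v, s ∂μ := by
              refine setIntegral_mono_on_ae hint (by simp) measurableSet_Iic ?_
              filter_upwards [hμ] with t ht htv
              exact hv _ (by simpa using htv) (by linarith)
          _ = s * μ.real (Iic v) := by simp [mul_comm]
          _ ≤ s * p := by
              gcongr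
              exact measureReal_mono (Iic_subset_Iic.2 hvu)
      -- A nonintegrable integrand has integral 0 by convention, and 0 ≤ s * p.
      · rw [integral_undef hint]; positivity
  have hM0 : 0 ≤ max M 0 := le_max_right _ _
  have iter : ∀ n : ℕ, ∀ v, 0 ≤ v → v ≤ u → D v ≤ max M 0 * p ^ n := by
    intro n
    induction n with
    | zero => intro v hv _; simpa using Or.inl (hM v hv)
    | succ n ih =>
      intro v hv hvu
      rw [pow_succ, ← mul_assoc]
      exact key _ (by positivity) ih v hv hvu
  have hlim : Filter.Tendsto (fun n : ℕ => max M 0 * p ^ n) Filter.atTop (nhds (max M 0 * 0)) :=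
    (tendsto_pow_atTop_nhds_zero_of_lt_one hp0 (hμL u)).const_mul _
  rw [mul_zero] at hlim
  exact ge_of_tendsto' hlim fun n => iter n u hu le_rfl

/-- The weighted stop-loss transform `∫ (x - u)⁺ w(x) μ(dx)`. -/
noncomputable def stopLoss (μ : Measure ℝ) (w : ℝ → ℝ) (u : ℝ) : ℝ := ∫ x, max (x - u) 0 * w x ∂μ

section stopLoss

variable {μ : Measure ℝ} {w : ℝ → ℝ}

theorem integrable_stopLoss (hμ : ∀ᵐ t ∂μ, 0 < t) (hw : ∀ x, 0 ≤ w x) (hwm : Measurable w)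
    (hi : Integrable (fun x => x * w x) μ) {u : ℝ} (hu : 0 ≤ u) :
    Integrable (fun x => max (x - u) 0 * w x) μ := by
  refine hi.mono' (by fun_prop) ?_
  filter_upwards [hμ] with x hx
  rw [Real.norm_of_nonneg (mul_nonneg (le_max_right _ _) (hw x))]
  exact mul_le_mul_of_nonneg_right (max_le (by linarith) hx.le) (hw x)

theorem stopLoss_nonneg (hw : ∀ x, 0 ≤ w x) (u : ℝ) : 0 ≤ stopLoss μ w u :=
  integral_nonneg fun x => mul_nonneg (le_max_right _ _) (hw x)

theorem stopLoss_zero (hμ : ∀ᵐ t ∂μ, 0 < t) : stopLoss μ w 0 = ∫ x, x * w x ∂μ := by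
  refine integral_congr_ae ?_
  filter_upwards [hμ] with x hx
  simp [hx.le]

theorem stopLoss_antitoneOn (hμ : ∀ᵐ t ∂μ, 0 < t) (hw : ∀ x, 0 ≤ w x) (hwm : Measurable w)
    (hi : Integrable (fun x => x * w x) μ) : AntitoneOn (stopLoss μ w) (Ici 0) := by
  intro u hu v hv huv
  refine integral_mono (integrable_stopLoss hμ hw hwm hi hv) (integrable_stopLoss hμ hw hwm hi hu) ?_
  intro x
  exact mul_le_mul_of_nonneg_right (max_le_max (by linarith) le_rfl) (hw x)

/-- Lowering the retention by t raises (x - ·)⁺ by exactly t at every x > u and lowers it nowhere.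
This increment is what lets `stopLoss` compensate the forcing term, or the missing mass beyond u, in
a renewal equation. -/
theorem mul_le_stopLoss_sub (hμ : ∀ᵐ t ∂μ, 0 < t) (hw : ∀ x, 0 ≤ w x) (hwm : Measurable w)
    (hi : Integrable (fun x => x * w x) μ) (hi' : Integrable w μ) {u t : ℝ} (ht : 0 ≤ t) (htu : t ≤ u) :
    t * ∫ x in Ioi u, w x ∂μ ≤ stopLoss μ w (u - t) - stopLoss μ w u := by
  have h1 := integrable_stopLoss hμ hw hwm hi (sub_nonneg.2 htu)
  have h2 := integrable_stopLoss hμ hw hwm hi (ht.trans htu)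
  rw [stopLoss, stopLoss, ← integral_sub h1 h2, ← integral_const_mul, ← integral_indicator measurableSet_Ioi]
  refine integral_mono ((hi'.const_mul t).indicator measurableSet_Ioi) (h1.sub h2) ?_
  intro x
  by_cases hx : u < x
  · simp only [indicator, mem_Ioi, hx, if_true]
    rw [max_eq_left (by linarith), max_eq_left (by linarith)]
    linarith
  · simp only [indicator, mem_Ioi, hx, if_false]
    rw [← sub_mul]
    refine mul_nonneg (sub_nonneg.2 (max_le_max (by linarith) le_rfl)) (hw x)

end stopLoss

theorem integrableOn_comp_sub {μ : Measure ℝ} [IsProbabilityMeasure μ] (hμ : ∀ᵐ t ∂μ, 0 < t)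
    {G : ℝ → ℝ} {M u : ℝ} (hG : Measurable G) (hM : ∀ v, 0 ≤ v → v ≤ u → |G v| ≤ M) :
    IntegrableOn (fun t => G (u - t)) (Iic u) μ := by
  refine IntegrableOn.of_bound (C := M) (measure_lt_top _ _)
    (hG.comp (measurable_const.sub measurable_id)).aestronglyMeasurable ?_
  filter_upwards [ae_restrict_mem measurableSet_Iic, ae_restrict_of_ae hμ] with t ht ht0
  exact hM _ (by simpa using ht) (by linarith)

/-- An explicit upper bound for the solution of a renewal equation. -/
theorem renewal_upper_bound {μ : Measure ℝ} [IsProbabilityMeasure μ] (hμ : ∀ᵐ t ∂μ, 0 < t)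
    (hμL : ∀ L : ℝ, μ.real (Iic L) < 1) {a ε η : ℝ} (hε : 0 < ε) (hη : 0 < η)
    (hμε : ε ≤ μ.real (Ioi a)) (hμη : η ≤ ∫ x in Iic a, x ∂μ)
    {w : ℝ → ℝ} (hw : ∀ x, 0 ≤ w x) (hwm : Measurable w) (hi' : Integrable w μ)
    (hi : Integrable (fun x => x * w x) μ) (hid : Integrable (fun x => x) μ)
    {G : ℝ → ℝ} (hGm : Measurable G) {M : ℝ} (hG : ∀ u, 0 ≤ u → |G u| ≤ M)
    (h : ∀ u, 0 ≤ u → G u ≤ ∫ x in Ioi u, w x ∂μ + ∫ t in Iic u, G (u - t) ∂μ) {u : ℝ} (hu : 0 ≤ u) :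
    G u ≤ ε⁻¹ * ∫ x, w x ∂μ + η⁻¹ * ∫ x, x * w x ∂μ := by
  set Z := ∫ x, w x ∂μ
  set τ := stopLoss μ w
  have hZ : 0 ≤ Z := integral_nonneg hw
  have hanti := stopLoss_antitoneOn hμ hw hwm hi
  have hτm : Measurable τ := by
    have : StronglyMeasurable τ := by
      refine StronglyMeasurable.integral_prod_right (f := fun u x => max (x - u) 0 * w x) ?_
      apply Measurable.stronglyMeasurable
      fun_prop
    exact this.measurable
  -- The supersolution: the constant ε⁻¹ * Z absorbs the forcing term for u ≤ a, and the increments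
  -- of -τ absorb it for u > a. It is increasing and bounded, with value ε⁻¹ * Z at 0.
  let H : ℝ → ℝ := fun u => ε⁻¹ * Z + η⁻¹ * (τ 0 - τ u)
  have hH0 : ∀ u, 0 ≤ u → ε⁻¹ * Z ≤ H u := fun u hu => by
    have : τ u ≤ τ 0 := hanti (mem_Ici.2 le_rfl) hu hu
    have : 0 ≤ η⁻¹ * (τ 0 - τ u) := mul_nonneg (by positivity) (by linarith)
    simp only [H]; linarith
  have hHm : Measurable H := by fun_prop
  have hHM : ∀ u, 0 ≤ u → H u ≤ ε⁻¹ * Z + η⁻¹ * τ 0 := fun u hu => by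
    have : 0 ≤ τ u := stopLoss_nonneg hw u
    simp only [H]
    gcongr
    linarith
  have hHabs : ∀ u, 0 ≤ u → |H u| ≤ ε⁻¹ * Z + η⁻¹ * τ 0 := fun u hu => by
    rw [abs_of_nonneg]
    · exact hHM u hu
    · exact le_trans (by positivity) (hH0 u hu)
  have hHmono : ∀ u v, 0 ≤ u → u ≤ v → H u ≤ H v := fun u v hu huv => by
    have : τ v ≤ τ u := hanti hu (hu.trans huv) huv
    simp only [H]
    gcongr
  have hsup : ∀ u, 0 ≤ u → ∫ x in Ioi u, w x ∂μ + ∫ t in Iic u, H (u - t) ∂μ ≤ H u := by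
    intro u hu
    have hHi := integrableOn_comp_sub hμ (u := u) hHm fun v hv _ => hHabs v hv
    -- For u ≤ a, mass at least ε is missing from `Iic u`, so the convolution loses ε * H u ≥ Z. For
    -- u > a, each step t lowers H by at least η⁻¹ * t times the forcing term, and the truncated
    -- mean of t is at least η.
    rcases le_or_gt u a with hua | hua
    · have e1 : ∫ t in Iic u, H (u - t) ∂μ ≤ H u * μ.real (Iic u) := by
        calc _ ≤ ∫ t in Iic u, H u ∂μ := by
              refine setIntegral_mono_on_ae hHi (by simp) measurableSet_Iic ?_
              filter_upwards [hμ] with t ht htu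
              exact hHmono _ _ (by simpa using htu) (by linarith)
          _ = _ := by simp [mul_comm]
      have e2 : μ.real (Iic u) ≤ 1 - ε := by
        have e3 : μ.real (Iic u) ≤ μ.real (Iic a) := measureReal_mono (Iic_subset_Iic.2 hua)
        have e4 : μ.real (Iic a) = 1 - μ.real (Ioi a) := by
          rw [← compl_Ioi, probReal_compl_eq_one_sub measurableSet_Ioi]
        linarith
      have e5 : ∫ x in Ioi u, w x ∂μ ≤ Z :=
        setIntegral_le_integral hi' (Filter.Eventually.of_forall hw)
      have e6 := hH0 u hu
      have e7 : 0 ≤ H u := le_trans (by positivity) e6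
      have e8 : H u * μ.real (Iic u) ≤ H u * (1 - ε) := by gcongr
      have e9 : Z ≤ H u * ε := by
        calc Z = ε⁻¹ * Z * ε := by field_simp
          _ ≤ _ := by gcongr
      linarith
    · set zb := ∫ x in Ioi u, w x ∂μ
      have hzb : 0 ≤ zb := integral_nonneg hw
      have e1 : ∫ t in Iic u, H (u - t) ∂μ ≤ ∫ t in Iic u, (H u - η⁻¹ * zb * t) ∂μ := by
        refine setIntegral_mono_on_ae hHi ?_ measurableSet_Iic ?_
        · exact (integrable_const _).sub (hid.integrableOn.const_mul _)
        filter_upwards [hμ] with t ht htu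
        have := mul_le_stopLoss_sub hμ hw hwm hi hi' ht.le htu
        have e : H u - H (u - t) = η⁻¹ * (τ (u - t) - τ u) := by simp only [H]; ring
        have e' : η⁻¹ * (t * zb) ≤ η⁻¹ * (τ (u - t) - τ u) := by gcongr
        nlinarith
      have e2 : ∫ t in Iic u, (H u - η⁻¹ * zb * t) ∂μ = H u * μ.real (Iic u) - η⁻¹ * zb * ∫ t in Iic u, t ∂μ := by
        rw [integral_sub (integrable_const _) (hid.integrableOn.const_mul _), integral_const_mul]
        simp [mul_comm]
      have e3 : η ≤ ∫ t in Iic u, t ∂μ := by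
        refine hμη.trans (setIntegral_mono_set hid.integrableOn ?_ ?_)
        · filter_upwards [ae_restrict_of_ae hμ] with t ht using ht.le
        · exact (Iic_subset_Iic.2 hua.le).eventuallyLE
      have e4 : zb ≤ η⁻¹ * zb * ∫ t in Iic u, t ∂μ := by
        calc zb = η⁻¹ * zb * η := by field_simp
          _ ≤ _ := by gcongr
      have e7 : 0 ≤ H u := le_trans (by positivity) (hH0 u hu)
      have e8 : H u * μ.real (Iic u) ≤ H u * 1 := by gcongr; exact measureReal_le_one
      linarith
  have hD := nonpos_of_le_renewal hμ hμL (D := fun u => G u - H u) (M := M) (x₀ := 0)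
    (fun v hv => by
      have := (abs_le.1 (hG v hv)).2
      have := le_trans (by positivity) (hH0 v hv)
      linarith) (fun v hv hv' => absurd hv (by simpa using hv'))
    (fun v hv _ => by
      have hHi := integrableOn_comp_sub hμ (u := v) hHm fun v hv _ => hHabs v hv
      have hGi := integrableOn_comp_sub hμ (u := v) hGm fun v hv _ => hG v hv
      rw [integral_sub hGi hHi]
      linarith [h v hv, hsup v hv]) hu
  calc G u ≤ H u := by linarith
    _ ≤ _ := by rw [← stopLoss_zero hμ]; exact hHM u hu

/-- An explicit positive lower bound for the solution of a renewal equation. -/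
theorem renewal_lower_bound {μ : Measure ℝ} [IsProbabilityMeasure μ] (hμ : ∀ᵐ t ∂μ, 0 < t)
    (hμL : ∀ L : ℝ, μ.real (Iic L) < 1) {a ε η M₁ M₂ : ℝ} (ha : 0 < a) (hε : 0 < ε) (hη : 0 < η)
    (hμη : η ≤ ∫ x in Iic a, x ∂μ)
    (hid : Integrable (fun x => x) μ) (hid2 : Integrable (fun x => x ^ 2) μ)
    (hM₁ : ∫ x, x ∂μ ≤ M₁) (hM₂ : ∫ x, x ^ 2 ∂μ ≤ M₂)
    {G : ℝ → ℝ} (hGm : Measurable G) {M : ℝ} (hG : ∀ u, 0 ≤ u → |G u| ≤ M) (hG0 : ∀ u, 0 ≤ u → 0 ≤ G u)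
    (ha' : ∀ u, 0 ≤ u → u ≤ a → ε ≤ G u)
    (h : ∀ u, 0 ≤ u → ∫ t in Iic u, G (u - t) ∂μ ≤ G u) {u : ℝ} (hu : 0 ≤ u) :
    ε * Real.exp (-(max a (2 * M₂ / η) / η)) / (η / 2 + M₁) * (η / 2) ≤ G u := by
  have hM₁0 : 0 ≤ M₁ := le_trans (integral_nonneg_of_ae (hμ.mono fun t ht => ht.le)) hM₁
  have hM₂0 : 0 ≤ M₂ := le_trans (integral_nonneg fun t => sq_nonneg t) hM₂
  have hμη' : ∀ u, a ≤ u → η ≤ ∫ t in Iic u, t ∂μ := fun u hua => by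
    refine hμη.trans (setIntegral_mono_set hid.integrableOn ?_ ?_)
    · filter_upwards [ae_restrict_of_ae hμ] with t ht using ht.le
    · exact (Iic_subset_Iic.2 hua).eventuallyLE
  -- Since exp (t / η) ≥ t / η and t has truncated mean at least η, the decaying exponential is a
  -- subsolution beyond a. It only serves on [0, x₀], where its decay costs a fixed factor.
  have step1 : ∀ u, 0 ≤ u → ε * Real.exp (-(u / η)) ≤ G u := by
    intro u hu
    let h1 : ℝ → ℝ := fun u => ε * Real.exp (-(u / η))
    have h1m : Measurable h1 := by fun_prop
    have h1le : ∀ u, 0 ≤ u → |h1 u| ≤ ε := fun u hu => by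
      rw [abs_of_nonneg (by positivity)]
      have : Real.exp (-(u / η)) ≤ 1 := Real.exp_le_one_iff.2 (by simp only [Left.neg_nonpos_iff]; positivity)
      calc h1 u = ε * Real.exp (-(u / η)) := rfl
        _ ≤ ε * 1 := by gcongr
        _ = ε := mul_one _
    have hD := nonpos_of_le_renewal hμ hμL (D := fun u => h1 u - G u) (M := ε) (x₀ := a)
      (fun v hv => by
        have := hG0 v hv
        have := (abs_le.1 (h1le v hv)).2
        linarith)
      (fun v hv hva => by
        have := (abs_le.1 (h1le v hv)).2
        have := ha' v hv hva.le
        linarith)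
      (fun v hv hav => by
        have hGi := integrableOn_comp_sub hμ (u := v) hGm fun v hv _ => hG v hv
        have h1i := integrableOn_comp_sub hμ (u := v) h1m fun v hv _ => h1le v hv
        rw [integral_sub h1i hGi]
        have hle : h1 v ≤ ∫ t in Iic v, h1 (v - t) ∂μ := by
          calc h1 v = h1 v * η⁻¹ * η := by field_simp
            _ ≤ h1 v * η⁻¹ * ∫ t in Iic v, t ∂μ := by
                have : 0 ≤ h1 v := by positivity
                gcongr
                exact hμη' v hav
            _ = ∫ t in Iic v, h1 v * η⁻¹ * t ∂μ := by rw [integral_const_mul]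
            _ ≤ _ := by
                refine setIntegral_mono_on (hid.integrableOn.const_mul _) h1i measurableSet_Iic ?_
                intro t _
                have e : h1 (v - t) = h1 v * Real.exp (t / η) := by
                  simp only [h1]
                  rw [mul_assoc, ← Real.exp_add]
                  congr 2; ring
                have e2 := Real.add_one_le_exp (t / η)
                have : 0 ≤ h1 v := by positivity
                rw [e, mul_assoc]
                gcongr
                rw [inv_mul_eq_div]; linarith
        linarith [h v hv]) hu
    simp only [h1] at hD
    linarith
  -- Chosen so that the stop-loss transform, at most M₂ / x₀ beyond x₀, has dropped to η / 2.
  set x₀ := max a (2 * M₂ / η)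
  have hx₀ : 0 < x₀ := lt_max_of_lt_left ha
  have hw1 : ∀ x : ℝ, 0 ≤ (fun _ : ℝ => (1 : ℝ)) x := fun _ => zero_le_one
  have hi1 : Integrable (fun x => x * (fun _ : ℝ => (1 : ℝ)) x) μ := by simpa using hid
  set τ := stopLoss μ fun _ => 1
  have hanti : AntitoneOn τ (Ici 0) := stopLoss_antitoneOn hμ hw1 measurable_const hi1
  have hτm : Measurable τ := by
    have : StronglyMeasurable τ := by
      refine StronglyMeasurable.integral_prod_right (f := fun u x => max (x - u) 0 * 1) ?_
      apply Measurable.stronglyMeasurable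
      fun_prop
    exact this.measurable
  have hτ0 : ∀ u, 0 ≤ τ u := stopLoss_nonneg hw1
  have hτM : ∀ u, 0 ≤ u → τ u ≤ M₁ := fun u hu => by
    calc τ u ≤ τ 0 := hanti (mem_Ici.2 le_rfl) hu hu
      _ = ∫ x, x * (fun _ : ℝ => (1 : ℝ)) x ∂μ := stopLoss_zero hμ
      _ ≤ M₁ := by simpa using hM₁
  have hτx : ∀ u, x₀ ≤ u → τ u ≤ η / 2 := fun u hu => by
    calc τ u ≤ ∫ x, x₀⁻¹ * x ^ 2 ∂μ := by
          refine integral_mono_ae (integrable_stopLoss hμ hw1 measurable_const hi1 (hx₀.le.trans hu))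
            (hid2.const_mul _) ?_
          filter_upwards [hμ] with x hx
          rw [mul_one]
          refine max_le ?_ (by positivity)
          rcases le_total x x₀ with hxx | hxx
          · have : 0 ≤ x₀⁻¹ * x ^ 2 := by positivity
            linarith
          · have : x ≤ x₀⁻¹ * x ^ 2 := by
              rw [inv_mul_eq_div, le_div_iff₀ hx₀]; nlinarith
            linarith
      _ = x₀⁻¹ * ∫ x, x ^ 2 ∂μ := integral_const_mul _ _
      _ ≤ x₀⁻¹ * M₂ := by gcongr
      _ ≤ η / 2 := by
          rw [inv_mul_eq_div, div_le_iff₀ hx₀]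
          have : 2 * M₂ / η ≤ x₀ := le_max_right _ _
          rw [div_le_iff₀ hη] at this
          linarith
  -- Normalized so that the maximum of the second barrier is the value of the first one at x₀.
  set κ := ε * Real.exp (-(x₀ / η)) / (η / 2 + M₁)
  have hκ : 0 < κ := by positivity
  let h2 : ℝ → ℝ := fun u => κ * (η / 2 + τ u)
  have h2m : Measurable h2 := by fun_prop
  have h20 : ∀ u, 0 ≤ h2 u := fun u => by have := hτ0 u; positivity
  have h2le : ∀ u, 0 ≤ u → h2 u ≤ κ * (η / 2 + M₁) := fun u hu => by
    have := hτM u hu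
    simp only [h2]; gcongr
  have h2abs : ∀ u, 0 ≤ u → |h2 u| ≤ κ * (η / 2 + M₁) := fun u hu => by
    rw [abs_of_nonneg (h20 u)]; exact h2le u hu
  have hκe : κ * (η / 2 + M₁) = ε * Real.exp (-(x₀ / η)) := by
    simp only [κ]; field_simp
  have hD := nonpos_of_le_renewal hμ hμL (D := fun u => h2 u - G u) (M := κ * (η / 2 + M₁)) (x₀ := x₀)
      (fun v hv => by
        have := hG0 v hv
        have := h2le v hv
        linarith)
      (fun v hv hva => by
        have e1 := h2le v hv
        have e2 := step1 v hv
        have : Real.exp (-(x₀ / η)) ≤ Real.exp (-(v / η)) := by gcongr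
        have : ε * Real.exp (-(x₀ / η)) ≤ ε * Real.exp (-(v / η)) := by gcongr
        linarith)
      (fun v hv hav => by
        have hGi := integrableOn_comp_sub hμ (u := v) hGm fun v hv _ => hG v hv
        have h2i := integrableOn_comp_sub hμ (u := v) h2m fun v hv _ => h2abs v hv
        rw [integral_sub h2i hGi]
        -- Truncating at v loses h2 v * ρ, while the increments of τ gain at least κ * ρ * η. The
        -- gain wins because η / 2 + τ v ≤ η beyond x₀.
        have hle : h2 v ≤ ∫ t in Iic v, h2 (v - t) ∂μ := by
          set ρ := μ.real (Ioi v)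
          have hρ0 : 0 ≤ ρ := measureReal_nonneg
          have hρ : μ.real (Iic v) = 1 - ρ := by
            rw [← compl_Ioi, probReal_compl_eq_one_sub measurableSet_Ioi]
          have e1 : ∫ t in Iic v, (h2 v + κ * ρ * t) ∂μ ≤ ∫ t in Iic v, h2 (v - t) ∂μ := by
            refine setIntegral_mono_on_ae ?_ h2i measurableSet_Iic ?_
            · exact (integrable_const _).add (hid.integrableOn.const_mul _)
            filter_upwards [hμ] with t ht htu
            have := mul_le_stopLoss_sub hμ hw1 measurable_const hi1 (integrable_const _) ht.le htu
            simp only [integral_const, smul_eq_mul, mul_one, measureReal_restrict_apply_univ] at this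
            have e : h2 (v - t) - h2 v = κ * (τ (v - t) - τ v) := by simp only [h2]; ring
            have e' : κ * (t * ρ) ≤ κ * (τ (v - t) - τ v) := by gcongr
            nlinarith
          have e2 : ∫ t in Iic v, (h2 v + κ * ρ * t) ∂μ = h2 v * (1 - ρ) + κ * ρ * ∫ t in Iic v, t ∂μ := by
            rw [integral_add (integrable_const _) (hid.integrableOn.const_mul _), setIntegral_const,
              smul_eq_mul, hρ, integral_const_mul (κ * ρ)]
            ring
          have e3 : κ * ρ * η ≤ κ * ρ * ∫ t in Iic v, t ∂μ := by
            gcongr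
            exact hμη' v ((le_max_left _ _).trans hav)
          have e4 : h2 v * ρ ≤ κ * ρ * η := by
            have := hτx v hav
            calc h2 v * ρ = κ * ρ * (η / 2 + τ v) := by simp only [h2]; ring
              _ ≤ κ * ρ * η := by gcongr; linarith
          linarith
        linarith [h v hv]) hu
  have := hτ0 u
  have e : κ * (η / 2) ≤ h2 u := by simp only [h2]; gcongr; linarith
  linarith

/-! ### Rewards at ruin as functionals of the claim sequence, and conditioning on the first claim.
-/

/-- The shift of a pair of sequences indexed by `ℕ ⊕ ℕ`. -/
def seqShift (ξ : ℕ ⊕ ℕ → ℝ) : ℕ ⊕ ℕ → ℝ := fun i => ξ (Sum.map Nat.succ Nat.succ i)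

theorem measurable_seqShift : Measurable seqShift := by unfold seqShift; fun_prop

/-- The reward `w (U_{T-})` collected at ruin, if ruin occurs at one of the first `N` claims, as a
function of the initial reserve and of the sequences of inter-arrival times and claim costs. -/
noncomputable def reward (c : ℝ) (w : ℝ → ENNReal) : ℕ → ℝ → (ℕ ⊕ ℕ → ℝ) → ENNReal
  | 0, _, _ => 0
  | N + 1, u, ξ =>
    if u + c * ξ (.inl 0) < ξ (.inr 0) then w (u + c * ξ (.inl 0))
    else reward c w N (u + c * ξ (.inl 0) - ξ (.inr 0)) (seqShift ξ)

/-- The reward `w (U_{T-})` collected at ruin. -/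
noncomputable def totalReward (c : ℝ) (w : ℝ → ENNReal) (u : ℝ) (ξ : ℕ ⊕ ℕ → ℝ) : ENNReal :=
  ⨆ N, reward c w N u ξ

section reward

variable {c : ℝ} {w w' : ℝ → ENNReal}

theorem measurable_reward (hw : Measurable w) (N : ℕ) :
    Measurable fun p : ℝ × (ℕ ⊕ ℕ → ℝ) => reward c w N p.1 p.2 := by
  induction N with
  | zero => exact measurable_const
  | succ N ih =>
    simp only [reward]
    refine Measurable.ite (measurableSet_lt (by fun_prop) (by fun_prop)) (hw.comp (by fun_prop)) ?_
    exact ih.comp (f := fun p : ℝ × (ℕ ⊕ ℕ → ℝ) =>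
      (p.1 + c * p.2 (.inl 0) - p.2 (.inr 0), seqShift p.2))
      (Measurable.prodMk (by fun_prop) (measurable_seqShift.comp measurable_snd))

theorem reward_le_succ (N : ℕ) (u : ℝ) (ξ : ℕ ⊕ ℕ → ℝ) :
    reward c w N u ξ ≤ reward c w (N + 1) u ξ := by
  induction N generalizing u ξ with
  | zero => simp [reward]
  | succ N ih =>
    rw [reward, reward]
    split_ifs
    · exact le_rfl
    · exact ih _ _

theorem monotone_reward (u : ℝ) (ξ : ℕ ⊕ ℕ → ℝ) : Monotone fun N => reward c w N u ξ :=
  monotone_nat_of_le_succ fun N => reward_le_succ N u ξ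

theorem reward_mono (h : w ≤ w') (N : ℕ) (u : ℝ) (ξ : ℕ ⊕ ℕ → ℝ) :
    reward c w N u ξ ≤ reward c w' N u ξ := by
  induction N generalizing u ξ with
  | zero => simp [reward]
  | succ N ih =>
    rw [reward, reward]
    split_ifs
    · exact h _
    · exact ih _ _

theorem reward_const_mul (r : ENNReal) (N : ℕ) (u : ℝ) (ξ : ℕ ⊕ ℕ → ℝ) :
    reward c (fun y => r * w y) N u ξ = r * reward c w N u ξ := by
  induction N generalizing u ξ with
  | zero => simp [reward]
  | succ N ih =>
    rw [reward, reward]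
    split_ifs
    · rfl
    · exact ih _ _

theorem reward_iSup {w : ℕ → ℝ → ENNReal} (N : ℕ) (u : ℝ) (ξ : ℕ ⊕ ℕ → ℝ) :
    reward c (fun y => ⨆ n, w n y) N u ξ = ⨆ n, reward c (w n) N u ξ := by
  induction N generalizing u ξ with
  | zero => simp [reward]
  | succ N ih =>
    simp only [reward]
    split_ifs
    · rfl
    · exact ih _ _

theorem reward_add (N : ℕ) (u : ℝ) (ξ : ℕ ⊕ ℕ → ℝ) :
    reward c (fun y => w y + w' y) N u ξ = reward c w N u ξ + reward c w' N u ξ := by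
  induction N generalizing u ξ with
  | zero => simp [reward]
  | succ N ih =>
    simp only [reward]
    split_ifs
    · rfl
    · exact ih _ _

theorem measurable_totalReward (hw : Measurable w) :
    Measurable fun p : ℝ × (ℕ ⊕ ℕ → ℝ) => totalReward c w p.1 p.2 :=
  Measurable.iSup fun N => measurable_reward hw N

theorem totalReward_eq (u : ℝ) (ξ : ℕ ⊕ ℕ → ℝ) :
    totalReward c w u ξ = if u + c * ξ (.inl 0) < ξ (.inr 0) then w (u + c * ξ (.inl 0))
      else totalReward c w (u + c * ξ (.inl 0) - ξ (.inr 0)) (seqShift ξ) := by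
  rw [totalReward, ← (monotone_reward u ξ).iSup_nat_add 1]
  simp only [reward]
  split_ifs
  · simp
  · rfl

end reward

namespace RiskModel

variable {Ω : Type*} [MeasurableSpace Ω] {P : Measure Ω} (X : RiskModel Ω P)

/-- The inter-arrival times and claim costs, as one random sequence. -/
def seq (ω : Ω) : ℕ ⊕ ℕ → ℝ := fun i => Sum.elim X.W X.Z i ω

theorem measurable_elim (i : ℕ ⊕ ℕ) : Measurable (Sum.elim X.W X.Z i) := by
  cases i
  · exact X.measurable_W _
  · exact X.measurable_Z _

theorem measurable_seq : Measurable X.seq := measurable_pi_lambda _ X.measurable_elim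

variable [IsProbabilityMeasure P]

/-- Both laws are products of the same marginals. Together with `indepFun_seqShift` this is the
renewal property at the first claim. -/
theorem map_seqShift : P.map (fun ω => seqShift (X.seq ω)) = P.map X.seq := by
  have hinj : Function.Injective (Sum.map Nat.succ Nat.succ) :=
    Sum.map_injective.2 ⟨Nat.succ_injective, Nat.succ_injective⟩
  have h1 := X.indep.map_fun_eq_infinitePi_map X.measurable_elim
  have h2 := (X.indep.precomp hinj).map_fun_eq_infinitePi_map fun i => X.measurable_elim _
  calc P.map (fun ω => seqShift (X.seq ω)) = _ := h2
    _ = _ := by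
      congr 1
      funext i
      cases i with
      | inl i => exact (X.law_W _).trans (X.law_W _).symm
      | inr i => exact (X.identDistrib_Z _).map_eq.trans (X.identDistrib_Z _).map_eq.symm
    _ = P.map X.seq := h1.symm

theorem indepFun_seqShift :
    IndepFun (fun ω => (X.W 0 ω, X.Z 0 ω)) (fun ω => seqShift (X.seq ω)) P := by
  refine IndepFun.indepFun_process ((X.measurable_W 0).prodMk (X.measurable_Z 0))
    (fun i => X.measurable_elim _) fun I => ?_
  have hdis : Disjoint ({.inl 0, .inr 0} : Finset (ℕ ⊕ ℕ)) (I.image (Sum.map Nat.succ Nat.succ)) := by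
    rw [Finset.disjoint_left]
    rintro i hi hi'
    simp only [Finset.mem_insert, Finset.mem_singleton] at hi
    rcases hi with rfl | rfl <;> simp at hi'
  have h := X.indep.indepFun_finset _ _ hdis X.measurable_elim
  refine h.comp (φ := fun x : (({.inl 0, .inr 0} : Finset (ℕ ⊕ ℕ)) → ℝ) => (x ⟨.inl 0, by simp⟩, x ⟨.inr 0, by simp⟩))
    (ψ := fun (x : (I.image (Sum.map Nat.succ Nat.succ) : Finset (ℕ ⊕ ℕ)) → ℝ) (i : I) => x ⟨Sum.map Nat.succ Nat.succ i, Finset.mem_image_of_mem _ i.2⟩)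
    (by fun_prop) (by fun_prop)

/-- The law of the claim costs. -/
noncomputable def claimLaw : Measure ℝ := P.map (X.Z 0)

instance : IsProbabilityMeasure X.claimLaw :=
  Measure.isProbabilityMeasure_map (X.measurable_Z 0).aemeasurable

/-- Conditioning on the first inter-arrival time and the first claim cost. -/
theorem lintegral_first_step {f : ℝ → ℝ → (ℕ ⊕ ℕ → ℝ) → ENNReal}
    (hf : Measurable fun p : (ℝ × ℝ) × (ℕ ⊕ ℕ → ℝ) => f p.1.1 p.1.2 p.2) :
    ∫⁻ ω, f (X.W 0 ω) (X.Z 0 ω) (seqShift (X.seq ω)) ∂P =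
      ∫⁻ s, ∫⁻ z, ∫⁻ ω, f s z (X.seq ω) ∂P ∂X.claimLaw ∂expMeasure X.lam := by
  have hWZ : Measurable fun ω => (X.W 0 ω, X.Z 0 ω) := (X.measurable_W 0).prodMk (X.measurable_Z 0)
  have hsh : Measurable fun ω => seqShift (X.seq ω) := measurable_seqShift.comp X.measurable_seq
  have h0 : IndepFun (X.W 0) (X.Z 0) P := X.indep.indepFun (i := .inl 0) (j := .inr 0) (by simp)
  have e0 : P.map (fun ω => (X.W 0 ω, X.Z 0 ω)) = (expMeasure X.lam).prod X.claimLaw := by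
    rw [(indepFun_iff_map_prod_eq_prod_map_map (X.measurable_W 0).aemeasurable
      (X.measurable_Z 0).aemeasurable).1 h0, X.law_W, claimLaw]
  have e1 := (indepFun_iff_map_prod_eq_prod_map_map hWZ.aemeasurable hsh.aemeasurable).1
    X.indepFun_seqShift
  rw [e0, X.map_seqShift] at e1
  have : IsProbabilityMeasure (P.map X.seq) :=
    Measure.isProbabilityMeasure_map X.measurable_seq.aemeasurable
  have := isProbabilityMeasure_expMeasure X.lam_pos
  calc _ = ∫⁻ p, f p.1.1 p.1.2 p.2 ∂(P.map fun ω => ((X.W 0 ω, X.Z 0 ω), seqShift (X.seq ω))) :=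
        (lintegral_map hf (hWZ.prodMk hsh)).symm
    _ = ∫⁻ p, ∫⁻ ξ, f p.1 p.2 ξ ∂(P.map X.seq) ∂((expMeasure X.lam).prod X.claimLaw) := by
        rw [e1, lintegral_prod _ hf.aemeasurable]
    _ = ∫⁻ s, ∫⁻ z, ∫⁻ ξ, f s z ξ ∂(P.map X.seq) ∂X.claimLaw ∂expMeasure X.lam := by
        rw [lintegral_prod _ (Measurable.lintegral_prod_right' hf).aemeasurable]
    _ = _ := by
        refine lintegral_congr fun s => lintegral_congr fun z => ?_
        exact lintegral_map (hf.comp (g := fun p : (ℝ × ℝ) × (ℕ ⊕ ℕ → ℝ) => f p.1.1 p.1.2 p.2)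
          (f := fun ξ => ((s, z), ξ)) (measurable_const.prodMk measurable_id)) X.measurable_seq

/-- The expected reward `E[w (U_{T-}); T < ∞]`, in terms of the sequence of claims. -/
noncomputable def expectedReward (w : ℝ → ENNReal) (u : ℝ) : ENNReal :=
  ∫⁻ ω, totalReward X.c w u (X.seq ω) ∂P

variable {w : ℝ → ENNReal}

theorem measurable_expectedReward (hw : Measurable w) : Measurable (X.expectedReward w) := by
  have : Measurable fun p : ℝ × Ω => totalReward X.c w p.1 (X.seq p.2) :=
    (measurable_totalReward hw).comp (measurable_fst.prodMk (X.measurable_seq.comp measurable_snd))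
  exact this.lintegral_prod_right'

theorem measurable_totalReward_seq (hw : Measurable w) (u : ℝ) :
    Measurable fun ω => totalReward X.c w u (X.seq ω) :=
  (measurable_totalReward hw).comp (measurable_const.prodMk X.measurable_seq)

theorem measurable_reward_seq (hw : Measurable w) (N : ℕ) (u : ℝ) :
    Measurable fun ω => reward X.c w N u (X.seq ω) :=
  (measurable_reward hw N).comp (measurable_const.prodMk X.measurable_seq)

theorem expectedReward_eq_iSup (hw : Measurable w) (u : ℝ) :
    X.expectedReward w u = ⨆ N, ∫⁻ ω, reward X.c w N u (X.seq ω) ∂P :=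
  lintegral_iSup (fun N => X.measurable_reward_seq hw N u) fun _ _ h _ => monotone_reward u _ h

theorem expectedReward_eq (hw : Measurable w) (u : ℝ) :
    X.expectedReward w u = ∫⁻ s, ∫⁻ z, (if u + X.c * s < z then w (u + X.c * s)
      else X.expectedReward w (u + X.c * s - z)) ∂X.claimLaw ∂expMeasure X.lam := by
  have h := X.lintegral_first_step (f := fun s z ξ => if u + X.c * s < z then w (u + X.c * s)
      else totalReward X.c w (u + X.c * s - z) ξ) (by
    refine Measurable.ite (measurableSet_lt (by fun_prop) (by fun_prop)) (hw.comp (by fun_prop)) ?_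
    exact (measurable_totalReward hw).comp (f := fun p : (ℝ × ℝ) × (ℕ ⊕ ℕ → ℝ) =>
      (u + X.c * p.1.1 - p.1.2, p.2)) (by fun_prop))
  calc X.expectedReward w u = _ := lintegral_congr fun ω => totalReward_eq u (X.seq ω)
    _ = _ := h
    _ = _ := by
      refine lintegral_congr fun s => lintegral_congr fun z => ?_
      split_ifs
      · simp
      · rfl

/-- Comparison with a supersolution of the one-step equation. -/
theorem expectedReward_le_of_supersolution (hw : Measurable w) {V : ℝ → ENNReal}
    (hV : ∀ u, 0 ≤ u → ∫⁻ s, ∫⁻ z, (if u + X.c * s < z then w (u + X.c * s)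
      else V (u + X.c * s - z)) ∂X.claimLaw ∂expMeasure X.lam ≤ V u) {u : ℝ} (hu : 0 ≤ u) :
    X.expectedReward w u ≤ V u := by
  -- The induction is on the number of claims allowed. A claim that does not ruin leaves a
  -- nonnegative reserve, so the inequality for V is needed only for u ≥ 0.
  rw [expectedReward_eq_iSup X hw]
  refine iSup_le fun N => ?_
  induction N generalizing u with
  | zero => simp [reward]
  | succ N ih =>
    have h := X.lintegral_first_step (f := fun s z ξ => if u + X.c * s < z then w (u + X.c * s)
      else reward X.c w N (u + X.c * s - z) ξ) (by
      refine Measurable.ite (measurableSet_lt (by fun_prop) (by fun_prop)) (hw.comp (by fun_prop)) ?_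
      exact (measurable_reward hw N).comp (f := fun p : (ℝ × ℝ) × (ℕ ⊕ ℕ → ℝ) =>
        (u + X.c * p.1.1 - p.1.2, p.2)) (by fun_prop))
    refine le_trans (le_of_eq h) (le_trans ?_ (hV u hu))
    refine lintegral_mono fun s => lintegral_mono fun z => ?_
    dsimp only
    split_ifs with hlt
    · simp
    · exact ih (by linarith [not_lt.1 hlt])

theorem expectedReward_mono {w w' : ℝ → ENNReal} (h : w ≤ w') (u : ℝ) :
    X.expectedReward w u ≤ X.expectedReward w' u :=
  lintegral_mono fun _ => iSup_mono fun N => reward_mono h N u _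

theorem expectedReward_const_mul (hw : Measurable w) (r : ENNReal) (u : ℝ) :
    X.expectedReward (fun y => r * w y) u = r * X.expectedReward w u := by
  rw [expectedReward, expectedReward, ← lintegral_const_mul _ (X.measurable_totalReward_seq hw u)]
  simp only [totalReward, reward_const_mul, ENNReal.mul_iSup]

theorem expectedReward_iSup {w : ℕ → ℝ → ENNReal} (hw : ∀ n, Measurable (w n)) (hmono : Monotone w)
    (u : ℝ) : X.expectedReward (fun y => ⨆ n, w n y) u = ⨆ n, X.expectedReward (w n) u := by
  simp only [expectedReward]
  rw [← lintegral_iSup (fun n => X.measurable_totalReward_seq (hw n) u)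
    fun _ _ h _ => iSup_mono fun N => reward_mono (hmono h) N u _]
  refine lintegral_congr fun ω => ?_
  simp only [totalReward, reward_iSup]
  exact iSup_comm

theorem expectedReward_add {w w' : ℝ → ENNReal} (hw : Measurable w) (u : ℝ) :
    X.expectedReward (fun y => w y + w' y) u = X.expectedReward w u + X.expectedReward w' u := by
  simp only [expectedReward]
  rw [← lintegral_add_left (X.measurable_totalReward_seq hw u)]
  refine lintegral_congr fun ω => ?_
  simp only [totalReward, reward_add]
  exact (ENNReal.iSup_add_iSup_of_monotone (monotone_reward u _) (monotone_reward u _)).symm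

end RiskModel

/-! ### Exponential transforms and convolutions. -/

theorem lintegral_exp_neg_mul_Ioi {b : ℝ} (hb : 0 < b) (u : ℝ) :
    ∫⁻ y in Ioi u, ENNReal.ofReal (Real.exp (-b * y)) = ENNReal.ofReal (Real.exp (-b * u) / b) := by
  rw [← ofReal_integral_eq_lintegral_ofReal (integrableOn_exp_mul_Ioi (by linarith) u)
    (Filter.Eventually.of_forall fun y => (Real.exp_pos _).le), integral_exp_mul_Ioi (by linarith)]
  congr 1
  field_simp

/-- Integration against the exponential law, after an affine substitution. -/
theorem lintegral_expMeasure_affine {l c : ℝ} (hl : 0 < l) (hc : 0 < c) {f : ℝ → ENNReal} (hf : Measurable f)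
    (u : ℝ) : ∫⁻ s, f (u + c * s) ∂expMeasure l =
      ENNReal.ofReal (l / c) * ∫⁻ y in Ioi u, ENNReal.ofReal (Real.exp (-(l / c) * (y - u))) * f y := by
  have himg : (fun s => u + c * s) '' Ioi 0 = Ioi u := by
    ext y
    simp only [mem_image, mem_Ioi]
    constructor
    · rintro ⟨s, hs, rfl⟩
      have := mul_pos hc hs
      linarith
    · intro hy
      exact ⟨(y - u) / c, div_pos (by linarith) hc, by field_simp; ring⟩
  have hpdf : Measurable fun s => exponentialPDF l s :=
    (measurable_exponentialPDFReal l).ennreal_ofReal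
  have e1 : ∫⁻ s, f (u + c * s) ∂expMeasure l = ∫⁻ s, exponentialPDF l s * f (u + c * s) := by
    exact lintegral_withDensity_eq_lintegral_mul volume hpdf (hf.comp (by fun_prop))
  have e2 : ∫⁻ s, exponentialPDF l s * f (u + c * s) =
      ∫⁻ s in Ioi 0, exponentialPDF l s * f (u + c * s) := by
    rw [← setLIntegral_univ, ← Iio_union_Ici (a := (0 : ℝ)),
      lintegral_union measurableSet_Ici (by
        exact Set.disjoint_left.2 fun x hx hx' => (not_lt.2 (mem_Ici.1 hx')) (mem_Iio.1 hx)),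
        setLIntegral_congr_fun (g := fun _ => 0) measurableSet_Iio]
    · rw [lintegral_zero, zero_add]
      exact setLIntegral_congr Ioi_ae_eq_Ici.symm
    · intro s hs
      simp [exponentialPDF_of_neg (mem_Iio.1 hs)]
  rw [e1, e2, ← himg, lintegral_image_eq_lintegral_abs_deriv_mul (f' := fun _ => c) measurableSet_Ioi
    (fun x _ => by simpa using ((hasDerivWithinAt_id x _).const_mul c).const_add u)
    (fun x _ y _ h => by simpa [hc.ne'] using h), ← lintegral_const_mul _ (by fun_prop)]
  refine setLIntegral_congr_fun measurableSet_Ioi fun s hs => ?_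
  rw [exponentialPDF_of_nonneg (le_of_lt hs), abs_of_pos hc, ← mul_assoc, ← mul_assoc,
    ← ENNReal.ofReal_mul (by positivity), ← ENNReal.ofReal_mul (by positivity)]
  congr 2
  rw [show -(l / c) * (u + c * s - u) = -(l * s) by field_simp; ring]
  field_simp

/-- The integrand is the u-derivative of exp (-β (y - u)), cut off at y. This is the inner integral
left by Tonelli in `lintegral_exp_transform`; the minimum treats y ≤ x and y > x together. -/
theorem lintegral_exp_kernel {β : ℝ} (hβ : 0 < β) {x y : ℝ} (hx : 0 ≤ x) (hy : 0 < y) :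
    ∫⁻ u in Ioc 0 x, (if u < y then ENNReal.ofReal (β * Real.exp (-β * (y - u))) else 0) =
      ENNReal.ofReal (Real.exp (-β * (y - min x y)) - Real.exp (-β * y)) := by
  have hm : 0 ≤ min x y := le_min hx hy.le
  have e1 : ∫⁻ u in Ioc 0 x, (if u < y then ENNReal.ofReal (β * Real.exp (-β * (y - u))) else 0) =
      ∫⁻ u in Ioc 0 (min x y), ENNReal.ofReal (β * Real.exp (-β * (y - u))) := by
    rw [← lintegral_indicator measurableSet_Ioc, ← lintegral_indicator measurableSet_Ioc]
    refine lintegral_congr_ae ?_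
    filter_upwards [compl_mem_ae_iff.2 (measure_singleton y)] with u hu
    have hu' : u ≠ y := hu
    simp only [indicator, mem_Ioc, le_min_iff]
    by_cases h1 : 0 < u <;> by_cases h2 : u ≤ x <;> by_cases h3 : u < y
    · simp [h1, h2, h3, h3.le]
    · have : ¬ u ≤ y := fun h => h3 (lt_of_le_of_ne h hu')
      simp [h3, this]
    all_goals simp [h1, h2]
  have hder : ∀ u ∈ uIcc 0 (min x y),
      HasDerivAt (fun u => Real.exp (-β * (y - u))) (β * Real.exp (-β * (y - u))) u := fun u _ => by
    have := (((hasDerivAt_id u).const_sub y).const_mul (-β)).exp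
    simpa [mul_comm] using this
  have hcont : Continuous fun u => β * Real.exp (-β * (y - u)) := by fun_prop
  rw [e1, ← ofReal_integral_eq_lintegral_ofReal
    (hcont.continuousOn.integrableOn_compact isCompact_Icc |>.mono_set Ioc_subset_Icc_self)
    (Filter.Eventually.of_forall fun u => by positivity), ← intervalIntegral.integral_of_le hm,
    intervalIntegral.integral_eq_sub_of_hasDerivAt hder (hcont.intervalIntegrable _ _)]
  simp

/-- The integrated form of the equation `J' = β J - A`, for the exponential transform `J` of `A`. -/
theorem lintegral_exp_transform {β : ℝ} (hβ : 0 < β) {A : ℝ → ENNReal} (hA : Measurable A) {x : ℝ}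
    (hx : 0 ≤ x) :
    (∫⁻ u in Ioc 0 x, ENNReal.ofReal β * ∫⁻ y in Ioi u, ENNReal.ofReal (Real.exp (-β * (y - u))) * A y)
      + ∫⁻ y in Ioi 0, ENNReal.ofReal (Real.exp (-β * (y - 0))) * A y =
    (∫⁻ y in Ioc 0 x, A y) + ∫⁻ y in Ioi x, ENNReal.ofReal (Real.exp (-β * (y - x))) * A y := by
  have e1 : ∫⁻ u in Ioc 0 x, ENNReal.ofReal β *
        ∫⁻ y in Ioi u, ENNReal.ofReal (Real.exp (-β * (y - u))) * A y =
      ∫⁻ u in Ioc 0 x, ∫⁻ y in Ioi 0,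
        (if u < y then ENNReal.ofReal (β * Real.exp (-β * (y - u))) else 0) * A y := by
    refine setLIntegral_congr_fun measurableSet_Ioc fun u hu => ?_
    rw [← lintegral_const_mul _ (by fun_prop), ← lintegral_indicator measurableSet_Ioi,
      ← lintegral_indicator measurableSet_Ioi]
    refine lintegral_congr fun y => ?_
    simp only [indicator, mem_Ioi]
    by_cases h : u < y
    · simp [h, hu.1.trans h, ENNReal.ofReal_mul hβ.le, mul_assoc]
    · simp [h]
  have hm : Measurable fun p : ℝ × ℝ =>
      (if p.1 < p.2 then ENNReal.ofReal (β * Real.exp (-β * (p.2 - p.1))) else 0) * A p.2 := by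
    refine Measurable.mul (Measurable.ite (measurableSet_lt (by fun_prop) (by fun_prop)) (by fun_prop)
      (by fun_prop)) (by fun_prop)
  have hm1 : Measurable fun y => ENNReal.ofReal (Real.exp (-β * (y - 0))) * A y := by fun_prop
  have e2 : ∫⁻ y in Ioc 0 x, A y = ∫⁻ y in Ioi 0, (Iic x).indicator A y := by
    rw [← lintegral_indicator measurableSet_Ioc, ← lintegral_indicator measurableSet_Ioi]
    congr 1
    funext y
    simp only [indicator, mem_Ioc, mem_Ioi, mem_Iic]
    by_cases h1 : 0 < y <;> by_cases h2 : y ≤ x <;> simp [h1, h2]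
  have e3 : ∫⁻ y in Ioi x, ENNReal.ofReal (Real.exp (-β * (y - x))) * A y =
      ∫⁻ y in Ioi 0, (Ioi x).indicator (fun y => ENNReal.ofReal (Real.exp (-β * (y - x))) * A y) y := by
    rw [← lintegral_indicator measurableSet_Ioi, ← lintegral_indicator measurableSet_Ioi]
    congr 1
    funext y
    simp only [indicator, mem_Ioi]
    by_cases h1 : x < y
    · simp [h1, hx.trans_lt h1]
    · simp [h1]
  rw [e1, lintegral_lintegral_swap hm.aemeasurable, e2, e3, ← lintegral_add_right _ hm1,
    ← lintegral_add_left (hA.indicator measurableSet_Iic)]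
  refine setLIntegral_congr_fun measurableSet_Ioi fun y hy => ?_
  have hy : 0 < y := hy
  -- For each y, the kernel integral plus exp (-β y) equals 1 if y ≤ x and exp (-β (y - x))
  -- otherwise. Stating the identity additively avoids subtraction in `ENNReal`.
  rw [lintegral_mul_const _ (Measurable.ite measurableSet_Iio (by fun_prop) (by fun_prop)),
    lintegral_exp_kernel hβ hx hy, ← add_mul, ← ENNReal.ofReal_add _ (Real.exp_pos _).le]
  · simp only [sub_zero, sub_add_cancel, indicator, mem_Iic, mem_Ioi]
    by_cases h : x < y
    · simp [h, h.le, not_le.2 h]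
    · simp [h, not_lt.1 h]
  · rw [sub_nonneg, Real.exp_le_exp]
    have : 0 ≤ min x y := le_min hx hy.le
    nlinarith

/-- Tonelli's theorem for the convolution with a probability law on the positive half-line. -/
theorem lintegral_convolution {F : Measure ℝ} [IsProbabilityMeasure F] (hF : ∀ᵐ z ∂F, 0 < z)
    {Φ : ℝ → ENNReal} (hΦ : Measurable Φ) (x : ℝ) :
    ∫⁻ y in Ioc 0 x, ∫⁻ z, (if y < z then 0 else Φ (y - z)) ∂F =
      ∫⁻ v in Icc 0 x, Φ v * F (Iic (x - v)) := by
  have hm : Measurable fun p : ℝ × ℝ => if p.1 < p.2 then 0 else Φ (p.1 - p.2) :=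
    Measurable.ite (measurableSet_lt (by fun_prop) (by fun_prop)) (by fun_prop) (by fun_prop)
  have hm2 : Measurable fun p : ℝ × ℝ => if 0 ≤ p.2 ∧ p.1 ≤ x - p.2 then Φ p.2 else 0 := by
    refine Measurable.ite (MeasurableSet.inter (measurableSet_le measurable_const measurable_snd)
      (measurableSet_le measurable_fst (measurable_const.sub measurable_snd))) (by fun_prop) (by fun_prop)
  rw [lintegral_lintegral_swap hm.aemeasurable]
  have e1 : ∀ᵐ z ∂F, ∫⁻ y in Ioc 0 x, (if y < z then 0 else Φ (y - z)) =
      ∫⁻ v, if 0 ≤ v ∧ z ≤ x - v then Φ v else 0 := by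
    -- After the substitution y = v + z, positivity of z turns 0 < y into a consequence of 0 ≤ v.
    filter_upwards [hF] with z hz
    rw [← lintegral_indicator measurableSet_Ioc, ← lintegral_add_right_eq_self _ z]
    refine lintegral_congr fun v => ?_
    simp only [indicator, mem_Ioc, add_sub_cancel_right]
    by_cases h1 : 0 ≤ v
    · have h2 : 0 < v + z := by linarith
      have h3 : ¬ v + z < z := by linarith
      simp only [h1, h2, h3, true_and, if_false, le_sub_iff_add_le, add_comm z v]
    · have h3 : v + z < z := by linarith
      simp [h1, h3]
  rw [lintegral_congr_ae e1, lintegral_lintegral_swap hm2.aemeasurable,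
    ← lintegral_indicator measurableSet_Icc]
  refine lintegral_congr fun v => ?_
  by_cases h1 : 0 ≤ v
  · have : ∫⁻ z, (if 0 ≤ v ∧ z ≤ x - v then Φ v else 0) ∂F = Φ v * F (Iic (x - v)) := by
      rw [← lintegral_indicator_const measurableSet_Iic]
      refine lintegral_congr fun z => ?_
      simp [indicator, h1]
    rw [this]
    by_cases h2 : v ≤ x
    · simp [indicator, h1, h2]
    · have : F (Iic (x - v)) = 0 := by
        refine measure_mono_null ?_ (ae_iff.1 hF)
        intro z hz
        have : z ≤ x - v := hz
        simp only [mem_ofPred_eq, not_lt]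
        linarith
      simp [indicator, h2, this]
  · simp [indicator, h1]

/-! ### Lundberg's inequality, the defective renewal equation and its exponential tilt. -/

namespace RiskModel

variable {Ω : Type*} [MeasurableSpace Ω] {P : Measure Ω} [IsProbabilityMeasure P] (X : RiskModel Ω P)

/-- The ratio of the Poisson intensity to the premium rate. -/
noncomputable def rate : ℝ := X.lam / X.c

theorem rate_pos : 0 < X.rate := div_pos X.lam_pos X.c_pos

theorem claimLaw_Ioi (x : ℝ) : X.claimLaw (Ioi x) = ENNReal.ofReal (X.tail x) := by
  rw [claimLaw, Measure.map_apply (X.measurable_Z 0) measurableSet_Ioi, tail, ofReal_measureReal]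
  rfl

theorem tail_nonneg (x : ℝ) : 0 ≤ X.tail x := measureReal_nonneg

theorem tail_le_one (x : ℝ) : X.tail x ≤ 1 := measureReal_le_one

theorem tail_pos (x : ℝ) : 0 < X.tail x := X.unbounded_support x

theorem tail_antitone : Antitone X.tail := fun x y hxy =>
  measureReal_mono fun ω (hω : y < X.Z 0 ω) => hxy.trans_lt hω

@[fun_prop]
theorem measurable_tail : Measurable X.tail := X.tail_antitone.measurable

theorem measurable_claimLaw_Ioi : Measurable fun x => X.claimLaw (Ioi x) := by
  simp only [claimLaw_Ioi]; fun_prop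

theorem claimLaw_pos : ∀ᵐ z ∂X.claimLaw, 0 < z :=
  (ae_map_iff (X.measurable_Z 0).aemeasurable measurableSet_Ioi).2 (X.Z_pos 0)

/-- The integrated tail distribution, tilted by `exp (R x)` and normalized by `1 + θ`. -/
noncomputable def tiltedLaw (R : ℝ) : Measure ℝ :=
  (volume.restrict (Ioi 0)).withDensity fun x => ENNReal.ofReal (X.rate * Real.exp (R * x) * X.tail x)

theorem measurable_tiltedDensity (R : ℝ) :
    Measurable fun x => ENNReal.ofReal (X.rate * Real.exp (R * x) * X.tail x) := by fun_prop

theorem tiltedDensity_nonneg (R x : ℝ) : 0 ≤ X.rate * Real.exp (R * x) * X.tail x := by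
  have := X.rate_pos
  have := X.tail_nonneg x
  positivity

theorem setLIntegral_tiltedLaw {R : ℝ} {f : ℝ → ENNReal} (hf : Measurable f) {s : Set ℝ}
    (hs : MeasurableSet s) : ∫⁻ x in s, f x ∂X.tiltedLaw R =
      ∫⁻ x in s ∩ Ioi 0, ENNReal.ofReal (X.rate * Real.exp (R * x) * X.tail x) * f x := by
  rw [tiltedLaw, restrict_withDensity hs, Measure.restrict_restrict hs,
    lintegral_withDensity_eq_lintegral_mul _ (X.measurable_tiltedDensity R) hf]
  rfl

theorem lintegral_tiltedLaw {R : ℝ} {f : ℝ → ENNReal} (hf : Measurable f) :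
    ∫⁻ x, f x ∂X.tiltedLaw R =
      ∫⁻ x in Ioi 0, ENNReal.ofReal (X.rate * Real.exp (R * x) * X.tail x) * f x := by
  have := X.setLIntegral_tiltedLaw (R := R) hf MeasurableSet.univ
  simpa using this

theorem tiltedLaw_pos (R : ℝ) : ∀ᵐ t ∂X.tiltedLaw R, 0 < t :=
  (withDensity_absolutelyContinuous _ _).ae_le (ae_restrict_mem measurableSet_Ioi)

theorem measurable_exp_mul_claimLaw_Ioi (R : ℝ) :
    Measurable fun x => ENNReal.ofReal (Real.exp (R * x)) * X.claimLaw (Ioi x) := by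
  simp only [claimLaw_Ioi]; fun_prop

/-- This is the Lundberg equation, which enters here as the total mass of `tiltedLaw`. -/
theorem lintegral_exp_mul_tail {R : ℝ} [hR : IsProbabilityMeasure (X.tiltedLaw R)] :
    ENNReal.ofReal X.rate * ∫⁻ x in Ioi 0, ENNReal.ofReal (Real.exp (R * x)) * X.claimLaw (Ioi x) = 1 := by
  rw [← hR.measure_univ, ← lintegral_one, X.lintegral_tiltedLaw measurable_const,
    ← lintegral_const_mul _ (X.measurable_exp_mul_claimLaw_Ioi R)]
  refine lintegral_congr fun x => ?_
  rw [claimLaw_Ioi, mul_one, mul_assoc X.rate, ENNReal.ofReal_mul X.rate_pos.le,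
    ENNReal.ofReal_mul (Real.exp_pos _).le]

/-- The exponential moment of the claim cost at the adjustment coefficient. -/
theorem lintegral_exp_claimLaw {R : ℝ} (hR0 : 0 < R) [IsProbabilityMeasure (X.tiltedLaw R)] :
    ∫⁻ z, ENNReal.ofReal (Real.exp (R * z)) ∂X.claimLaw = ENNReal.ofReal (1 + R / X.rate) := by
  have hr := X.rate_pos
  have hint : ∀ z : ℝ, ∫ t in (0 : ℝ)..z, R * Real.exp (R * t) = Real.exp (R * z) - 1 := fun z => by
    have hder : ∀ u ∈ uIcc 0 z, HasDerivAt (fun u => Real.exp (R * u)) (R * Real.exp (R * u)) u :=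
      fun u _ => by simpa [mul_comm] using ((hasDerivAt_id u).const_mul R).exp
    rw [intervalIntegral.integral_eq_sub_of_hasDerivAt hder
      ((by fun_prop : Continuous fun u => R * Real.exp (R * u)).intervalIntegrable _ _)]
    simp
  -- Layer cake: E[exp (R Z) - 1] is the integral of R exp (R t) P(Z > t), which the Lundberg
  -- equation evaluates as R / rate.
  have h := lintegral_comp_eq_lintegral_meas_lt_mul (f := fun z : ℝ => z) (g := fun t => R * Real.exp (R * t))
    X.claimLaw (X.claimLaw_pos.mono fun z hz => hz.le) aemeasurable_id
    (fun t _ => (by fun_prop : Continuous fun u => R * Real.exp (R * u)).intervalIntegrable _ _)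
    (Filter.Eventually.of_forall fun t => by positivity)
  simp only [hint] at h
  have e2 : ∫⁻ t in Ioi 0, X.claimLaw {a | t < a} * ENNReal.ofReal (R * Real.exp (R * t)) =
      ENNReal.ofReal (R / X.rate) := by
    have e3 : ∫⁻ t in Ioi 0, X.claimLaw {a | t < a} * ENNReal.ofReal (R * Real.exp (R * t)) =
        ENNReal.ofReal R * ∫⁻ x in Ioi 0, ENNReal.ofReal (Real.exp (R * x)) * X.claimLaw (Ioi x) := by
      rw [← lintegral_const_mul _ (X.measurable_exp_mul_claimLaw_Ioi R)]
      refine lintegral_congr fun x => ?_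
      rw [ENNReal.ofReal_mul hR0.le, mul_comm, mul_assoc]
      rfl
    have e4 : ENNReal.ofReal R = ENNReal.ofReal (R / X.rate) * ENNReal.ofReal X.rate := by
      rw [← ENNReal.ofReal_mul (by positivity)]; congr 1; field_simp
    rw [e3, e4, mul_assoc, X.lintegral_exp_mul_tail, mul_one]
  rw [e2] at h
  rw [ENNReal.ofReal_add zero_le_one (by positivity), ← h, ENNReal.ofReal_one,
    ← (by simp : ∫⁻ _, 1 ∂X.claimLaw = 1), ← lintegral_add_left measurable_const]
  refine lintegral_congr_ae ?_
  filter_upwards [X.claimLaw_pos] with z hz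
  rw [← ENNReal.ofReal_one, ← ENNReal.ofReal_add zero_le_one]
  · simp
  · rw [sub_nonneg]; exact Real.one_le_exp (by positivity)

theorem measurable_one_step {w V : ℝ → ENNReal} (hw : Measurable w) (hV : Measurable V) :
    Measurable fun y => ∫⁻ z, (if y < z then w y else V (y - z)) ∂X.claimLaw := by
  have : Measurable fun p : ℝ × ℝ => if p.1 < p.2 then w p.1 else V (p.1 - p.2) :=
    Measurable.ite (measurableSet_lt measurable_fst measurable_snd) (hw.comp measurable_fst)
      (hV.comp (measurable_fst.sub measurable_snd))
  exact this.lintegral_prod_right'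

/-- Lundberg's inequality. -/
theorem expectedReward_one_le {R : ℝ} (hR0 : 0 < R) [IsProbabilityMeasure (X.tiltedLaw R)] {u : ℝ}
    (hu : 0 ≤ u) : X.expectedReward (fun _ => 1) u ≤ ENNReal.ofReal (Real.exp (-R * u)) := by
  have hr := X.rate_pos
  -- On ruin the payoff 1 is at most exp (-R (y - z)), so a claim multiplies exp (-R y) by at most
  -- E[exp (R Z)] = 1 + R / rate. The exponential waiting time contributes rate / (rate + R), which
  -- cancels this factor.
  refine X.expectedReward_le_of_supersolution measurable_const
    (V := fun u => ENNReal.ofReal (Real.exp (-R * u))) (fun u hu => ?_) hu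
  have hA : ∀ y, ∫⁻ z, (if y < z then 1 else ENNReal.ofReal (Real.exp (-R * (y - z)))) ∂X.claimLaw ≤
      ENNReal.ofReal ((1 + R / X.rate) * Real.exp (-R * y)) := fun y => by
    calc _ ≤ ∫⁻ z, ENNReal.ofReal (Real.exp (-R * y)) * ENNReal.ofReal (Real.exp (R * z)) ∂X.claimLaw := by
          refine lintegral_mono fun z => ?_
          rw [← ENNReal.ofReal_mul (Real.exp_pos _).le, ← Real.exp_add]
          dsimp only
          split_ifs with h
          · rw [← ENNReal.ofReal_one]
            refine ENNReal.ofReal_le_ofReal (Real.one_le_exp ?_)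
            nlinarith
          · refine ENNReal.ofReal_le_ofReal (Real.exp_le_exp.2 ?_)
            linarith
      _ = _ := by
          rw [lintegral_const_mul _ (by fun_prop), X.lintegral_exp_claimLaw hR0,
            ← ENNReal.ofReal_mul (Real.exp_pos _).le, mul_comm]
  calc _ ≤ ∫⁻ s, ENNReal.ofReal ((1 + R / X.rate) * Real.exp (-R * (u + X.c * s))) ∂expMeasure X.lam :=
        lintegral_mono fun s => hA _
    _ = ENNReal.ofReal X.rate * ∫⁻ y in Ioi u, ENNReal.ofReal (Real.exp (-X.rate * (y - u))) *
          ENNReal.ofReal ((1 + R / X.rate) * Real.exp (-R * y)) :=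
        lintegral_expMeasure_affine X.lam_pos X.c_pos
          (f := fun y => ENNReal.ofReal ((1 + R / X.rate) * Real.exp (-R * y))) (by fun_prop) u
    _ = ENNReal.ofReal X.rate * ∫⁻ y in Ioi u, ENNReal.ofReal (Real.exp (X.rate * u) * (1 + R / X.rate)) *
          ENNReal.ofReal (Real.exp (-(X.rate + R) * y)) := by
        congr 1
        refine lintegral_congr fun y => ?_
        rw [← ENNReal.ofReal_mul (by positivity), ← ENNReal.ofReal_mul (by positivity)]
        congr 1
        rw [mul_left_comm, ← Real.exp_add, mul_right_comm, ← Real.exp_add, mul_comm]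
        congr 2
        ring
    _ = ENNReal.ofReal (Real.exp (-R * u)) := by
        rw [lintegral_const_mul _ (by fun_prop), lintegral_exp_neg_mul_Ioi (by positivity),
          ← ENNReal.ofReal_mul (by positivity), ← ENNReal.ofReal_mul (by positivity)]
        congr 1
        rw [show -R * u = X.rate * u + -(X.rate + R) * u by ring, Real.exp_add]
        field_simp
    _ ≤ _ := le_rfl

theorem expectedReward_le_of_le {R : ℝ} (hR0 : 0 < R) [IsProbabilityMeasure (X.tiltedLaw R)]
    {w : ℝ → ENNReal} {M : ENNReal} (hM : ∀ y, w y ≤ M) {u : ℝ} (hu : 0 ≤ u) :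
    X.expectedReward w u ≤ M * ENNReal.ofReal (Real.exp (-R * u)) := by
  calc X.expectedReward w u ≤ X.expectedReward (fun _ => M * 1) u :=
        X.expectedReward_mono (fun y => by simpa using hM y) u
    _ = M * X.expectedReward (fun _ => 1) u := X.expectedReward_const_mul measurable_const M u
    _ ≤ _ := by gcongr; exact X.expectedReward_one_le hR0 hu

/-- The reward as the exponential transform of the one-claim reward. -/
theorem expectedReward_eq_transform {w : ℝ → ENNReal} (hw : Measurable w) (u : ℝ) :
    X.expectedReward w u = ENNReal.ofReal X.rate * ∫⁻ y in Ioi u,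
      ENNReal.ofReal (Real.exp (-X.rate * (y - u))) *
        ∫⁻ z, (if y < z then w y else X.expectedReward w (y - z)) ∂X.claimLaw := by
  rw [X.expectedReward_eq hw]
  exact lintegral_expMeasure_affine X.lam_pos X.c_pos
    (f := fun y => ∫⁻ z, (if y < z then w y else X.expectedReward w (y - z)) ∂X.claimLaw)
    (X.measurable_one_step hw (X.measurable_expectedReward hw)) u

/-- The balance equation behind the defective renewal equation. -/
theorem transform_balance {R : ℝ} (hR0 : 0 < R) [IsProbabilityMeasure (X.tiltedLaw R)]
    {w : ℝ → ENNReal} (hw : Measurable w) {M : ENNReal} (hMt : M ≠ ⊤) (hM : ∀ y, w y ≤ M) {x : ℝ}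
    (hx : 0 ≤ x) {J : ℝ → ENNReal} (hJ : ∀ u, X.expectedReward w u = ENNReal.ofReal X.rate * J u)
    (hJ' : ∀ u, J u = ∫⁻ y in Ioi u, ENNReal.ofReal (Real.exp (-X.rate * (y - u))) *
        ∫⁻ z, (if y < z then w y else X.expectedReward w (y - z)) ∂X.claimLaw) :
    J 0 + ∫⁻ v in Icc 0 x, X.expectedReward w v * X.claimLaw (Ioi (x - v)) =
      (∫⁻ y in Ioc 0 x, w y * X.claimLaw (Ioi y)) + J x := by
  set Φ := X.expectedReward w
  have hΦ : Measurable Φ := X.measurable_expectedReward hw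
  have h := lintegral_exp_transform X.rate_pos (X.measurable_one_step hw hΦ) hx
  rw [← hJ' 0, ← hJ' x] at h
  simp only [← hJ', ← hJ] at h
  have hm0 : Measurable fun y => w y * X.claimLaw (Ioi y) := hw.mul X.measurable_claimLaw_Ioi
  have e1 : ∫⁻ y in Ioc 0 x, ∫⁻ z, (if y < z then w y else Φ (y - z)) ∂X.claimLaw =
      (∫⁻ y in Ioc 0 x, w y * X.claimLaw (Ioi y)) + ∫⁻ v in Icc 0 x, Φ v * X.claimLaw (Iic (x - v)) := by
    rw [← lintegral_convolution X.claimLaw_pos hΦ, ← lintegral_add_left hm0]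
    refine lintegral_congr fun y => ?_
    rw [← lintegral_indicator_const measurableSet_Ioi,
      ← lintegral_add_left (measurable_const.indicator measurableSet_Ioi)]
    refine lintegral_congr fun z => ?_
    by_cases hz : y < z <;> simp [hz]
  have hm1 : Measurable fun v => Φ v * X.claimLaw (Ioi (x - v)) :=
    hΦ.mul (X.measurable_claimLaw_Ioi.comp (measurable_const.sub measurable_id))
  have e2 : ∫⁻ v in Ioc 0 x, Φ v = (∫⁻ v in Icc 0 x, Φ v * X.claimLaw (Ioi (x - v))) +
      ∫⁻ v in Icc 0 x, Φ v * X.claimLaw (Iic (x - v)) := by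
    rw [← lintegral_add_left hm1, setLIntegral_congr Ioc_ae_eq_Icc]
    refine lintegral_congr fun v => ?_
    rw [← mul_add, ← compl_Iic, add_comm, measure_add_measure_compl measurableSet_Iic, measure_univ,
      mul_one]
  rw [e1, e2] at h
  -- Splitting the claim law at x - v puts this integral on both sides. Being finite, it can be
  -- cancelled.
  have hfin : ∫⁻ v in Icc 0 x, Φ v * X.claimLaw (Iic (x - v)) ≠ ⊤ := by
    refine ne_top_of_le_ne_top (b := ∫⁻ v in Icc 0 x, M) ?_ ?_
    · rw [setLIntegral_const]
      exact ENNReal.mul_ne_top hMt (by simp)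
    · refine setLIntegral_mono measurable_const fun v hv => ?_
      calc Φ v * X.claimLaw (Iic (x - v)) ≤ M * 1 := by
            gcongr
            · refine (X.expectedReward_le_of_le hR0 hM hv.1).trans ?_
              calc M * ENNReal.ofReal (Real.exp (-R * v)) ≤ M * 1 := by
                    gcongr
                    rw [← ENNReal.ofReal_one]
                    refine ENNReal.ofReal_le_ofReal (Real.exp_le_one_iff.2 ?_)
                    nlinarith [hv.1]
                _ = M := mul_one M
            · exact prob_le_one
        _ = M := mul_one M
  refine (ENNReal.add_left_inj hfin).1 ?_
  rw [add_assoc, add_comm (J 0), h, add_right_comm]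

/-- The defective renewal equation for the expected reward at ruin. -/
theorem expectedReward_renewal {R : ℝ} (hR0 : 0 < R) [IsProbabilityMeasure (X.tiltedLaw R)]
    {w : ℝ → ENNReal} (hw : Measurable w) {M : ENNReal} (hMt : M ≠ ⊤) (hM : ∀ y, w y ≤ M) {x : ℝ}
    (hx : 0 ≤ x) : X.expectedReward w x = ENNReal.ofReal X.rate *
      ((∫⁻ y in Ioi x, w y * X.claimLaw (Ioi y)) +
        ∫⁻ v in Icc 0 x, X.expectedReward w v * X.claimLaw (Ioi (x - v))) := by
  have hr := X.rate_pos
  have hr0 : ENNReal.ofReal X.rate ≠ 0 := by simpa using hr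
  set Φ := X.expectedReward w
  have hΦ : Measurable Φ := X.measurable_expectedReward hw
  obtain ⟨J, hJ, hJ'⟩ : ∃ J : ℝ → ENNReal, (∀ u, Φ u = ENNReal.ofReal X.rate * J u) ∧
      ∀ u, J u = ∫⁻ y in Ioi u, ENNReal.ofReal (Real.exp (-X.rate * (y - u))) *
        ∫⁻ z, (if y < z then w y else Φ (y - z)) ∂X.claimLaw :=
    ⟨fun u => ∫⁻ y in Ioi u, ENNReal.ofReal (Real.exp (-X.rate * (y - u))) *
        ∫⁻ z, (if y < z then w y else Φ (y - z)) ∂X.claimLaw,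
      fun u => X.expectedReward_eq_transform hw u, fun _ => rfl⟩
  have hbal : ∀ x : ℝ, 0 ≤ x → _ := fun x hx => X.transform_balance hR0 hw hMt hM hx hJ hJ'
  have hm0 : Measurable fun y => w y * X.claimLaw (Ioi y) := hw.mul X.measurable_claimLaw_Ioi
  have hdecay : Filter.Tendsto (fun n : ℕ => ENNReal.ofReal (Real.exp (-R * n))) Filter.atTop (nhds 0) := by
    rw [← ENNReal.ofReal_zero]
    refine ENNReal.tendsto_ofReal ?_
    have : Filter.Tendsto (fun n : ℕ => R * (n : ℝ)) Filter.atTop Filter.atTop :=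
      Filter.Tendsto.const_mul_atTop hR0 tendsto_natCast_atTop_atTop
    simp only [neg_mul]
    exact Real.tendsto_exp_neg_atTop_nhds_zero.comp this
  have hlim : ∀ r : ENNReal, r ≠ ⊤ → Filter.Tendsto (fun n : ℕ => r * ENNReal.ofReal (Real.exp (-R * n)))
      Filter.atTop (nhds 0) := fun r hr' => by
    simpa using ENNReal.Tendsto.const_mul hdecay (Or.inr hr')
  -- Letting x tend to infinity in the balance equation determines J 0. Lundberg's inequality
  -- removes both J x and the convolution.
  have hJlim : Filter.Tendsto (fun n : ℕ => J n) Filter.atTop (nhds 0) := by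
    refine tendsto_of_tendsto_of_tendsto_of_le_of_le tendsto_const_nhds
      (hlim ((ENNReal.ofReal X.rate)⁻¹ * M) (ENNReal.mul_ne_top (ENNReal.inv_ne_top.2 hr0) hMt))
      (fun _ => bot_le) fun n => ?_
    have := X.expectedReward_le_of_le hR0 hM (u := n) n.cast_nonneg
    calc J n = (ENNReal.ofReal X.rate)⁻¹ * Φ n := by
          rw [hJ, ← mul_assoc, ENNReal.inv_mul_cancel hr0 ENNReal.ofReal_ne_top, one_mul]
      _ ≤ _ := by rw [mul_assoc]; gcongr
  -- Here Φ v ≤ M exp (-R v) = M exp (-R n) exp (R (n - v)). The last factor against the tail has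
  -- integral at most I, which is finite by the Lundberg equation.
  have hClim : Filter.Tendsto (fun n : ℕ => ∫⁻ v in Icc (0 : ℝ) n, Φ v * X.claimLaw (Ioi (n - v)))
      Filter.atTop (nhds 0) := by
    set I := ∫⁻ x in Ioi 0, ENNReal.ofReal (Real.exp (R * x)) * X.claimLaw (Ioi x)
    have hI : I ≠ ⊤ := by
      intro hI
      have := X.lintegral_exp_mul_tail (R := R)
      change ENNReal.ofReal X.rate * I = 1 at this
      rw [hI, ENNReal.mul_top hr0] at this
      exact ENNReal.top_ne_one this
    refine tendsto_of_tendsto_of_tendsto_of_le_of_le tendsto_const_nhds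
      (hlim (M * I) (ENNReal.mul_ne_top hMt hI)) (fun _ => bot_le) fun n => ?_
    calc ∫⁻ v in Icc (0 : ℝ) n, Φ v * X.claimLaw (Ioi (n - v))
        ≤ ∫⁻ v in Icc (0 : ℝ) n, (M * ENNReal.ofReal (Real.exp (-R * n))) *
            (ENNReal.ofReal (Real.exp (R * (n - v))) * X.claimLaw (Ioi (n - v))) := by
          refine setLIntegral_mono (Measurable.const_mul (Measurable.mul (by fun_prop)
            (X.measurable_claimLaw_Ioi.comp (measurable_const.sub measurable_id))) _) fun v hv => ?_
          rw [← mul_assoc, mul_assoc M, ← ENNReal.ofReal_mul (Real.exp_pos _).le, ← Real.exp_add,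
            show -R * n + R * (n - v) = -R * v by ring]
          gcongr
          exact X.expectedReward_le_of_le hR0 hM hv.1
      _ = (M * ENNReal.ofReal (Real.exp (-R * n))) * ∫⁻ v in Icc (0 : ℝ) n,
            ENNReal.ofReal (Real.exp (R * (n - v))) * X.claimLaw (Ioi (n - v)) :=
          lintegral_const_mul _ (Measurable.mul (by fun_prop)
            (X.measurable_claimLaw_Ioi.comp (measurable_const.sub measurable_id)))
      _ ≤ (M * ENNReal.ofReal (Real.exp (-R * n))) * I := by
          gcongr
          rw [← lintegral_indicator measurableSet_Icc]
          simp only [I]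
          rw [setLIntegral_congr Ioi_ae_eq_Ici, ← lintegral_indicator measurableSet_Ici,
            ← lintegral_sub_left_eq_self _ (n : ℝ)]
          refine lintegral_mono fun v => ?_
          by_cases hv : 0 ≤ v <;> by_cases hv' : v ≤ n <;> simp [indicator, hv, hv']
      _ = _ := by ring
  have hWlim : Filter.Tendsto (fun n : ℕ => ∫⁻ y in Ioc (0 : ℝ) n, w y * X.claimLaw (Ioi y)) Filter.atTop
      (nhds (∫⁻ y in Ioi (0 : ℝ), w y * X.claimLaw (Ioi y))) := by
    have hmono : Monotone fun n : ℕ => Ioc (0 : ℝ) n := fun m n h =>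
      Ioc_subset_Ioc_right (Nat.cast_le.2 h)
    have hU : ⋃ n : ℕ, Ioc (0 : ℝ) n = Ioi 0 := by
      ext y
      simp only [mem_iUnion, mem_Ioc, mem_Ioi]
      exact ⟨fun ⟨_, h⟩ => h.1, fun h => (exists_nat_ge y).imp fun n hn => ⟨h, hn⟩⟩
    rw [← hU, setLIntegral_iUnion_of_directed _ hmono.directed_le]
    exact tendsto_atTop_iSup fun m n h => lintegral_mono_set (hmono h)
  have hJ0 : J 0 = ∫⁻ y in Ioi (0 : ℝ), w y * X.claimLaw (Ioi y) := by
    have h1 := hClim.const_add (J 0)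
    have h2 := hWlim.add hJlim
    rw [add_zero] at h1 h2
    exact tendsto_nhds_unique (h1.congr fun n : ℕ => hbal (n : ℝ) n.cast_nonneg) h2
  have hfin : ∫⁻ y in Ioc 0 x, w y * X.claimLaw (Ioi y) ≠ ⊤ := by
    refine ne_top_of_le_ne_top (b := ∫⁻ v in Ioc 0 x, M) ?_ ?_
    · rw [setLIntegral_const]
      exact ENNReal.mul_ne_top hMt (by simp)
    · refine setLIntegral_mono measurable_const fun v hv => ?_
      calc w v * X.claimLaw (Ioi v) ≤ M * 1 := by
            gcongr
            · exact hM v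
            · exact prob_le_one
        _ = M := mul_one M
  have hsplit : ∫⁻ y in Ioi (0 : ℝ), w y * X.claimLaw (Ioi y) =
      (∫⁻ y in Ioc 0 x, w y * X.claimLaw (Ioi y)) + ∫⁻ y in Ioi x, w y * X.claimLaw (Ioi y) := by
    rw [← Ioc_union_Ioi_eq_Ioi hx, lintegral_union measurableSet_Ioi
      (Set.disjoint_left.2 fun y hy hy' => (not_lt.2 hy.2) hy')]
  have h := hbal x hx
  rw [hJ0, hsplit, add_assoc] at h
  rw [hJ, (ENNReal.add_right_inj hfin).1 h]

/-- The renewal equation for the exponentially tilted expected reward. -/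
theorem expectedReward_tilted_renewal {R : ℝ} (hR0 : 0 < R) [IsProbabilityMeasure (X.tiltedLaw R)]
    {w : ℝ → ENNReal} (hw : Measurable w) {M : ENNReal} (hMt : M ≠ ⊤) (hM : ∀ y, w y ≤ M) {x : ℝ}
    (hx : 0 ≤ x) : ENNReal.ofReal (Real.exp (R * x)) * X.expectedReward w x =
      (∫⁻ y in Ioi x, ENNReal.ofReal (Real.exp (R * (x - y))) * w y ∂X.tiltedLaw R) +
        ∫⁻ t in Iic x, ENNReal.ofReal (Real.exp (R * (x - t))) * X.expectedReward w (x - t) ∂X.tiltedLaw R := by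
  have hr := X.rate_pos
  set Φ := X.expectedReward w
  have hΦ : Measurable Φ := X.measurable_expectedReward hw
  have hm0 : Measurable fun y => w y * X.claimLaw (Ioi y) := hw.mul X.measurable_claimLaw_Ioi
  have hm1 : Measurable fun t => Φ (x - t) * X.claimLaw (Ioi t) :=
    (hΦ.comp (measurable_const.sub measurable_id)).mul X.measurable_claimLaw_Ioi
  -- The factor exp (R t) of the tilted density and exp (R (x - t)) combine to exp (R x), which
  -- leaves the integral.
  have hk : ∀ t a, ENNReal.ofReal (X.rate * Real.exp (R * t) * X.tail t) *
      (ENNReal.ofReal (Real.exp (R * (x - t))) * a) =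
      ENNReal.ofReal (Real.exp (R * x)) * ENNReal.ofReal X.rate * (a * X.claimLaw (Ioi t)) := by
    intro t a
    have := X.tail_nonneg t
    rw [claimLaw_Ioi, ← mul_assoc, ← ENNReal.ofReal_mul (by positivity), mul_comm a, ← mul_assoc,
      ← ENNReal.ofReal_mul (by positivity), ← ENNReal.ofReal_mul (by positivity)]
    congr 2
    rw [show R * x = R * t + R * (x - t) by ring, Real.exp_add]
    ring
  have e1 : ∫⁻ y in Ioi x, ENNReal.ofReal (Real.exp (R * (x - y))) * w y ∂X.tiltedLaw R =
      ENNReal.ofReal (Real.exp (R * x)) * ENNReal.ofReal X.rate *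
        ∫⁻ y in Ioi x, w y * X.claimLaw (Ioi y) := by
    rw [X.setLIntegral_tiltedLaw (by fun_prop) measurableSet_Ioi,
      inter_eq_left.2 (Ioi_subset_Ioi hx), ← lintegral_const_mul _ hm0]
    exact lintegral_congr fun y => hk y _
  have e2 : ∫⁻ t in Iic x, ENNReal.ofReal (Real.exp (R * (x - t))) * Φ (x - t) ∂X.tiltedLaw R =
      ENNReal.ofReal (Real.exp (R * x)) * ENNReal.ofReal X.rate *
        ∫⁻ v in Icc 0 x, Φ v * X.claimLaw (Ioi (x - v)) := by
    have e3 : ∫⁻ v in Icc 0 x, Φ v * X.claimLaw (Ioi (x - v)) =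
        ∫⁻ t in Icc 0 x, Φ (x - t) * X.claimLaw (Ioi t) := by
      rw [← lintegral_indicator measurableSet_Icc, ← lintegral_indicator measurableSet_Icc,
        ← lintegral_sub_left_eq_self _ x]
      refine lintegral_congr fun t => ?_
      by_cases h1 : 0 ≤ t <;> by_cases h2 : t ≤ x <;> simp [indicator, h1, h2]
    rw [X.setLIntegral_tiltedLaw (by fun_prop) measurableSet_Iic, e3, inter_comm, Ioi_inter_Iic,
      setLIntegral_congr Ioc_ae_eq_Icc, ← lintegral_const_mul _ hm1]
    exact lintegral_congr fun y => hk y _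
  rw [e1, e2, ← mul_add, mul_assoc, ← X.expectedReward_renewal hR0 hw hMt hM hx]

end RiskModel

/-! ### The barriers applied to the tilted reward. -/

namespace RiskModel

variable {Ω : Type*} [MeasurableSpace Ω] {P : Measure Ω} [IsProbabilityMeasure P] (X : RiskModel Ω P)

/-- Unbounded support makes the tilted density positive on the whole positive half-line. This
supplies the strict contraction in `nonpos_of_le_renewal`. -/
theorem tiltedLaw_real_Iic_lt_one (R : ℝ) [IsProbabilityMeasure (X.tiltedLaw R)] (L : ℝ) :
    (X.tiltedLaw R).real (Iic L) < 1 := by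
  rw [← compl_Ioi, probReal_compl_eq_one_sub measurableSet_Ioi, sub_lt_self_iff, measureReal_def,
    ENNReal.toReal_pos_iff]
  refine ⟨?_, measure_lt_top _ _⟩
  rw [← setLIntegral_one, X.setLIntegral_tiltedLaw measurable_const measurableSet_Ioi,
    setLIntegral_pos_iff (by fun_prop)]
  have h : Ioi (max L 0) ⊆ (Function.support fun x =>
      ENNReal.ofReal (X.rate * Real.exp (R * x) * X.tail x) * 1) ∩ (Ioi L ∩ Ioi 0) := by
    intro x hx
    have hx' : max L 0 < x := hx
    refine ⟨?_, lt_of_le_of_lt (le_max_left _ _) hx', lt_of_le_of_lt (le_max_right _ _) hx'⟩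
    have := X.rate_pos
    have := X.tail_pos x
    simp only [Function.mem_support, mul_one, ne_eq, ENNReal.ofReal_eq_zero, not_le]
    positivity
  exact lt_of_lt_of_le (by simp) (measure_mono h)

/-- The exponentially tilted expected reward. -/
noncomputable def tiltedReward (R : ℝ) (w : ℝ → ℝ) (u : ℝ) : ℝ :=
  Real.exp (R * u) * (X.expectedReward (fun y => ENNReal.ofReal (w y)) u).toReal

theorem measurable_tiltedReward (R : ℝ) {w : ℝ → ℝ} (hw : Measurable w) :
    Measurable (X.tiltedReward R w) := by
  have := (X.measurable_expectedReward (w := fun y => ENNReal.ofReal (w y)) (by fun_prop)).ennreal_toReal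
  unfold tiltedReward
  fun_prop

theorem tiltedReward_nonneg (R : ℝ) (w : ℝ → ℝ) (u : ℝ) : 0 ≤ X.tiltedReward R w u := by
  unfold tiltedReward; positivity

section

variable {R : ℝ} (hR0 : 0 < R) [IsProbabilityMeasure (X.tiltedLaw R)] {w : ℝ → ℝ} (hw : Measurable w)
  {M : ℝ} (hM : ∀ y, w y ≤ M)

include hR0 hM in
theorem expectedReward_ne_top {u : ℝ} (hu : 0 ≤ u) :
    X.expectedReward (fun y => ENNReal.ofReal (w y)) u ≠ ⊤ :=
  ne_top_of_le_ne_top (ENNReal.mul_ne_top ENNReal.ofReal_ne_top ENNReal.ofReal_ne_top)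
    (X.expectedReward_le_of_le hR0 (fun y => ENNReal.ofReal_le_ofReal (hM y)) hu)

include hR0 hM in
theorem ofReal_tiltedReward {u : ℝ} (hu : 0 ≤ u) :
    ENNReal.ofReal (X.tiltedReward R w u) =
      ENNReal.ofReal (Real.exp (R * u)) * X.expectedReward (fun y => ENNReal.ofReal (w y)) u := by
  rw [tiltedReward, ENNReal.ofReal_mul (Real.exp_pos _).le,
    ENNReal.ofReal_toReal (X.expectedReward_ne_top hR0 hM hu)]

-- Lundberg's inequality gives this a priori bound. The maximum principle needs only its existence,
-- so M does not enter the final constants.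
include hR0 hM in
theorem tiltedReward_le (hM0 : 0 ≤ M) {u : ℝ} (hu : 0 ≤ u) : X.tiltedReward R w u ≤ M := by
  rw [← ENNReal.ofReal_le_ofReal_iff hM0, X.ofReal_tiltedReward hR0 hM hu]
  calc _ ≤ ENNReal.ofReal (Real.exp (R * u)) * (ENNReal.ofReal M * ENNReal.ofReal (Real.exp (-R * u))) := by
        gcongr
        exact X.expectedReward_le_of_le hR0 (fun y => ENNReal.ofReal_le_ofReal (hM y)) hu
    _ = ENNReal.ofReal M := by
        rw [← ENNReal.ofReal_mul hM0, ← ENNReal.ofReal_mul (Real.exp_pos _).le, mul_left_comm,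
          ← Real.exp_add]
        simp

include hR0 hw hM in
theorem tiltedReward_renewal (hw0 : ∀ y, 0 ≤ w y) {u : ℝ} (hu : 0 ≤ u) :
    X.tiltedReward R w u = ∫ y in Ioi u, Real.exp (R * (u - y)) * w y ∂X.tiltedLaw R +
      ∫ t in Iic u, X.tiltedReward R w (u - t) ∂X.tiltedLaw R := by
  have hM0 : 0 ≤ M := (hw0 0).trans (hM 0)
  have hGm := X.measurable_tiltedReward R hw
  have h := X.expectedReward_tilted_renewal hR0 (w := fun y => ENNReal.ofReal (w y)) (by fun_prop)
    ENNReal.ofReal_ne_top (fun y => ENNReal.ofReal_le_ofReal (hM y)) hu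
  rw [← X.ofReal_tiltedReward hR0 hM hu] at h
  have i1 : IntegrableOn (fun y => Real.exp (R * (u - y)) * w y) (Ioi u) (X.tiltedLaw R) := by
    refine IntegrableOn.of_bound (C := M) (measure_lt_top _ _)
      (by fun_prop : Measurable fun y => Real.exp (R * (u - y)) * w y).aestronglyMeasurable ?_
    filter_upwards [ae_restrict_mem measurableSet_Ioi] with y hy
    have hy' : u < y := hy
    rw [Real.norm_of_nonneg (mul_nonneg (Real.exp_pos _).le (hw0 y))]
    calc Real.exp (R * (u - y)) * w y ≤ 1 * M := by
          gcongr
          · exact hw0 y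
          · rw [Real.exp_le_one_iff]; nlinarith
          · exact hM y
      _ = M := one_mul M
  have i2 := integrableOn_comp_sub (X.tiltedLaw_pos R) (u := u) hGm (M := M) fun v hv _ => by
    rw [abs_of_nonneg (X.tiltedReward_nonneg R w v)]; exact X.tiltedReward_le hR0 hM hM0 hv
  have p1 : 0 ≤ ∫ y in Ioi u, Real.exp (R * (u - y)) * w y ∂X.tiltedLaw R :=
    integral_nonneg fun y => mul_nonneg (Real.exp_pos _).le (hw0 y)
  have p2 : 0 ≤ ∫ t in Iic u, X.tiltedReward R w (u - t) ∂X.tiltedLaw R :=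
    integral_nonneg fun y => X.tiltedReward_nonneg R w _
  have e1 : ∫⁻ y in Ioi u, ENNReal.ofReal (Real.exp (R * (u - y))) * ENNReal.ofReal (w y) ∂X.tiltedLaw R =
      ENNReal.ofReal (∫ y in Ioi u, Real.exp (R * (u - y)) * w y ∂X.tiltedLaw R) := by
    rw [ofReal_integral_eq_lintegral_ofReal i1
      (Filter.Eventually.of_forall fun y => mul_nonneg (Real.exp_pos _).le (hw0 y))]
    exact lintegral_congr fun y => (ENNReal.ofReal_mul (Real.exp_pos _).le).symm
  have e2 : ∫⁻ t in Iic u, ENNReal.ofReal (Real.exp (R * (u - t))) *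
        X.expectedReward (fun y => ENNReal.ofReal (w y)) (u - t) ∂X.tiltedLaw R =
      ENNReal.ofReal (∫ t in Iic u, X.tiltedReward R w (u - t) ∂X.tiltedLaw R) := by
    rw [ofReal_integral_eq_lintegral_ofReal i2
      (Filter.Eventually.of_forall fun y => X.tiltedReward_nonneg R w _)]
    refine setLIntegral_congr_fun measurableSet_Iic fun t ht => ?_
    exact (X.ofReal_tiltedReward hR0 hM (sub_nonneg.2 ht)).symm
  rw [e1, e2, ← ENNReal.ofReal_add p1 p2,
    ENNReal.ofReal_eq_ofReal_iff (X.tiltedReward_nonneg R w u) (add_nonneg p1 p2)] at h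
  exact h

-- As exp (R (u - y)) ≤ 1 for y > u, the forcing term fits `renewal_upper_bound`. The result depends
-- on w only through two integrals and not on M, so it survives the removal of a truncation.
include hR0 hw hM in
theorem tiltedReward_upper_bound_of_bounded (hw0 : ∀ y, 0 ≤ w y) {a ε η : ℝ} (hε : 0 < ε) (hη : 0 < η)
    (hμε : ε ≤ (X.tiltedLaw R).real (Ioi a)) (hμη : η ≤ ∫ x in Iic a, x ∂X.tiltedLaw R)
    (hid : Integrable (fun x => x) (X.tiltedLaw R)) {u : ℝ} (hu : 0 ≤ u) :
    X.tiltedReward R w u ≤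
      ε⁻¹ * ∫ x, w x ∂X.tiltedLaw R + η⁻¹ * ∫ x, x * w x ∂X.tiltedLaw R := by
  have hM0 : 0 ≤ M := (hw0 0).trans (hM 0)
  have hwi : Integrable w (X.tiltedLaw R) := Integrable.of_bound (C := M) hw.aestronglyMeasurable
    (Filter.Eventually.of_forall fun y => by rw [Real.norm_of_nonneg (hw0 y)]; exact hM y)
  refine renewal_upper_bound (X.tiltedLaw_pos R) (X.tiltedLaw_real_Iic_lt_one R) hε hη hμε hμη hw0 hw hwi
    ?_ hid (X.measurable_tiltedReward R hw) (M := M) (fun v hv => ?_) (fun v hv => ?_) hu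
  · exact hid.mul_bdd (c := M) hw.aestronglyMeasurable
      (Filter.Eventually.of_forall fun y => by rw [Real.norm_of_nonneg (hw0 y)]; exact hM y)
  · rw [abs_of_nonneg (X.tiltedReward_nonneg R w v)]; exact X.tiltedReward_le hR0 hM hM0 hv
  · rw [X.tiltedReward_renewal hR0 hw hM hw0 hv]
    refine add_le_add ?_ le_rfl
    refine setIntegral_mono_on ?_ hwi.integrableOn measurableSet_Ioi fun y hy => ?_
    · refine hwi.integrableOn.mono'
        (by fun_prop : Measurable fun y => Real.exp (R * (v - y)) * w y).aestronglyMeasurable ?_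
      filter_upwards [ae_restrict_mem measurableSet_Ioi] with y hy
      have hy' : v < y := hy
      rw [Real.norm_of_nonneg (mul_nonneg (Real.exp_pos _).le (hw0 y))]
      refine mul_le_of_le_one_left (hw0 y) ?_
      rw [Real.exp_le_one_iff]; nlinarith
    · have hy' : v < y := hy
      refine mul_le_of_le_one_left (hw0 y) ?_
      rw [Real.exp_le_one_iff]; nlinarith

include hR0 hw in
/-- The expected reward at ruin is at most a constant times `exp (-R u)`. -/
theorem expectedReward_upper_bound (hw0 : ∀ y, 0 ≤ w y) {a ε η : ℝ} (hε : 0 < ε) (hη : 0 < η)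
    (hμε : ε ≤ (X.tiltedLaw R).real (Ioi a)) (hμη : η ≤ ∫ x in Iic a, x ∂X.tiltedLaw R)
    (hid : Integrable (fun x => x) (X.tiltedLaw R)) (hwi : Integrable w (X.tiltedLaw R))
    (hwi' : Integrable (fun x => x * w x) (X.tiltedLaw R)) {u : ℝ} (hu : 0 ≤ u) :
    X.expectedReward (fun y => ENNReal.ofReal (w y)) u ≤ ENNReal.ofReal (Real.exp (-R * u) *
      (ε⁻¹ * ∫ x, w x ∂X.tiltedLaw R + η⁻¹ * ∫ x, x * w x ∂X.tiltedLaw R)) := by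
  have hpos := X.tiltedLaw_pos R
  -- Unbounded rewards are reached by monotone convergence from their truncations, whose bounds are
  -- uniform in n.
  have e : (fun y => ENNReal.ofReal (w y)) = fun y => ⨆ n : ℕ, ENNReal.ofReal (min (w y) n) := by
    funext y
    refine le_antisymm ?_ (iSup_le fun n => ENNReal.ofReal_le_ofReal (min_le_left _ _))
    obtain ⟨n, hn⟩ := exists_nat_ge (w y)
    exact le_iSup_of_le n (by rw [min_eq_left hn])
  have hmono : Monotone fun (n : ℕ) y => ENNReal.ofReal (min (w y) n) := fun m n h y =>
    ENNReal.ofReal_le_ofReal (min_le_min le_rfl (Nat.cast_le.2 h))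
  rw [e, X.expectedReward_iSup (fun n => by fun_prop) hmono]
  refine iSup_le fun n => ?_
  have hn0 : ∀ y, 0 ≤ min (w y) n := fun y => le_min (hw0 y) n.cast_nonneg
  have hnM : ∀ y, min (w y) n ≤ (n : ℝ) := fun y => min_le_right _ _
  have hnm : Measurable fun y => min (w y) n := by fun_prop
  have h := X.tiltedReward_upper_bound_of_bounded hR0 hnm hnM hn0 hε hη hμε hμη hid hu
  have hni : Integrable (fun y => min (w y) n) (X.tiltedLaw R) :=
    hwi.mono' hnm.aestronglyMeasurable
      (Filter.Eventually.of_forall fun y => by rw [Real.norm_of_nonneg (hn0 y)]; exact min_le_left _ _)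
  have hni' : Integrable (fun y => y * min (w y) n) (X.tiltedLaw R) := by
    refine hwi'.mono' (by fun_prop) ?_
    filter_upwards [hpos] with y hy
    rw [Real.norm_of_nonneg (mul_nonneg hy.le (hn0 y))]
    exact mul_le_mul_of_nonneg_left (min_le_left _ _) hy.le
  have i1 : ∫ y, min (w y) n ∂X.tiltedLaw R ≤ ∫ x, w x ∂X.tiltedLaw R :=
    integral_mono hni hwi fun y => min_le_left _ _
  have i2 : ∫ y, y * min (w y) n ∂X.tiltedLaw R ≤ ∫ x, x * w x ∂X.tiltedLaw R := by
    refine integral_mono_ae hni' hwi' ?_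
    filter_upwards [hpos] with y hy
    exact mul_le_mul_of_nonneg_left (min_le_left _ _) hy.le
  have h2 : X.tiltedReward R (fun y => min (w y) n) u ≤
      ε⁻¹ * ∫ x, w x ∂X.tiltedLaw R + η⁻¹ * ∫ x, x * w x ∂X.tiltedLaw R := by
    refine h.trans ?_
    gcongr
  rw [← ENNReal.ofReal_toReal (X.expectedReward_ne_top hR0 hnM hu)]
  refine ENNReal.ofReal_le_ofReal ?_
  rw [tiltedReward] at h2
  calc _ = Real.exp (-R * u) * (Real.exp (R * u) *
        (X.expectedReward (fun y => ENNReal.ofReal (min (w y) n)) u).toReal) := by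
        rw [← mul_assoc, ← Real.exp_add]; simp
    _ ≤ _ := by gcongr

include hR0 in
/-- The ruin probability is at least a constant times `exp (-R u)`. -/
theorem expectedReward_one_lower_bound {a ε η M₁ M₂ : ℝ} (ha : 0 < a) (hε : 0 < ε) (hη : 0 < η)
    (hμη : η ≤ ∫ x in Iic a, x ∂X.tiltedLaw R)
    (hid : Integrable (fun x => x) (X.tiltedLaw R)) (hid2 : Integrable (fun x => x ^ 2) (X.tiltedLaw R))
    (hM₁ : ∫ x, x ∂X.tiltedLaw R ≤ M₁) (hM₂ : ∫ x, x ^ 2 ∂X.tiltedLaw R ≤ M₂)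
    (htail : ENNReal.ofReal ε ≤ ENNReal.ofReal X.rate * ∫⁻ y in Ioi a, X.claimLaw (Ioi y)) {u : ℝ}
    (hu : 0 ≤ u) :
    ENNReal.ofReal (Real.exp (-R * u) *
      (ε * Real.exp (-(max a (2 * M₂ / η) / η)) / (η / 2 + M₁) * (η / 2))) ≤
      X.expectedReward (fun _ => 1) u := by
  have hM : ∀ y : ℝ, (fun _ : ℝ => (1 : ℝ)) y ≤ 1 := fun _ => le_rfl
  have h := renewal_lower_bound (X.tiltedLaw_pos R) (X.tiltedLaw_real_Iic_lt_one R) ha hε hη hμη hid hid2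
    hM₁ hM₂ (X.measurable_tiltedReward R (w := fun _ => 1) measurable_const) (M := 1) (fun v hv => ?_)
    (fun v _ => X.tiltedReward_nonneg R _ v) (fun v hv hva => ?_) (fun v hv => ?_) hu
  · have hfin := X.expectedReward_ne_top hR0 hM hu
    simp only [ENNReal.ofReal_one] at hfin
    rw [← ENNReal.ofReal_toReal hfin]
    refine ENNReal.ofReal_le_ofReal ?_
    simp only [tiltedReward, ENNReal.ofReal_one] at h
    calc _ ≤ Real.exp (-R * u) * (Real.exp (R * u) * (X.expectedReward (fun _ => 1) u).toReal) := by
          gcongr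
      _ = _ := by rw [← mul_assoc, ← Real.exp_add]; simp
  · rw [abs_of_nonneg (X.tiltedReward_nonneg R _ v)]
    exact X.tiltedReward_le hR0 hM zero_le_one hv
  · rw [← ENNReal.ofReal_le_ofReal_iff (X.tiltedReward_nonneg R _ v), X.ofReal_tiltedReward hR0 hM hv]
    simp only [ENNReal.ofReal_one]
    -- On [0, a] the forcing term of the untilted renewal equation alone is at least ε.
    have hren := X.expectedReward_renewal hR0 (w := fun _ => 1) measurable_const ENNReal.one_ne_top
      (fun _ => le_rfl) hv
    calc ENNReal.ofReal ε ≤ ENNReal.ofReal X.rate * ∫⁻ y in Ioi a, X.claimLaw (Ioi y) := htail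
      _ ≤ 1 * X.expectedReward (fun _ => 1) v := by
          rw [one_mul, hren]
          simp only [one_mul]
          gcongr
          exact le_add_right (lintegral_mono_set (Ioi_subset_Ioi hva))
      _ ≤ _ := by
          gcongr
          rw [← ENNReal.ofReal_one]
          exact ENNReal.ofReal_le_ofReal (Real.one_le_exp (by positivity))
  · rw [X.tiltedReward_renewal hR0 (w := fun _ => 1) measurable_const hM (fun _ => zero_le_one) hv]
    exact le_add_of_nonneg_left (integral_nonneg fun y => mul_nonneg (Real.exp_pos _).le zero_le_one)

end

end RiskModel

/-! ### Quantitative consequences of light tails for the tilted law. -/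

namespace RiskModel

variable {Ω : Type*} [MeasurableSpace Ω] {P : Measure Ω} [IsProbabilityMeasure P] (X : RiskModel Ω P)

theorem integrable_tiltedLaw_iff {R : ℝ} {f : ℝ → ℝ} :
    Integrable f (X.tiltedLaw R) ↔
      IntegrableOn (fun x => f x * (X.rate * Real.exp (R * x) * X.tail x)) (Ioi 0) := by
  rw [tiltedLaw, integrable_withDensity_iff (X.measurable_tiltedDensity R)
    (Filter.Eventually.of_forall fun x => ENNReal.ofReal_lt_top)]
  simp only [ENNReal.toReal_ofReal (X.tiltedDensity_nonneg R _)]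
  rfl

theorem integral_tiltedLaw {R : ℝ} (f : ℝ → ℝ) :
    ∫ x, f x ∂X.tiltedLaw R = ∫ x in Ioi 0, f x * (X.rate * Real.exp (R * x) * X.tail x) := by
  rw [tiltedLaw, integral_withDensity_eq_integral_toReal_smul (X.measurable_tiltedDensity R)
    (Filter.Eventually.of_forall fun x => ENNReal.ofReal_lt_top)]
  refine integral_congr_ae (Filter.Eventually.of_forall fun x => ?_)
  simp only [ENNReal.toReal_ofReal (X.tiltedDensity_nonneg R x), smul_eq_mul]
  exact mul_comm _ _

theorem moment_eq_integral_claimLaw (j : ℕ) : X.moment j = ∫ z, z ^ j ∂X.claimLaw := by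
  rw [claimLaw, integral_map (X.measurable_Z 0).aemeasurable (by fun_prop)]
  rfl

theorem moment_nonneg (j : ℕ) : 0 ≤ X.moment j :=
  integral_nonneg_of_ae ((X.Z_pos 0).mono fun _ hω => pow_nonneg hω.le j)

theorem moment_pos {j : ℕ} (h : Integrable (fun z => z ^ j) X.claimLaw) : 0 < X.moment j := by
  rw [moment_eq_integral_claimLaw, integral_pos_iff_support_of_nonneg_ae
    (X.claimLaw_pos.mono fun _ hω => pow_nonneg hω.le j) h]
  refine lt_of_lt_of_le ?_ (measure_mono (s := Ioi 0) fun z (hz : 0 < z) => (pow_pos hz j).ne')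
  rw [X.claimLaw_Ioi]
  exact ENNReal.ofReal_pos.2 (X.tail_pos 0)

namespace LightTailed

variable {X} {k : ℕ} {R : ℝ} (hX : X.LightTailed k R)
include hX

/-- A zero first moment would make f_I vanish, as division by zero gives zero, against the Lundberg
equation. This also excludes the default value 0 of the integral, whence `integrable_id_claimLaw`.
-/
theorem moment_one_ne_zero : X.moment 1 ≠ 0 := by
  intro h
  have := hX.lundberg
  simp [fI, h] at this

theorem moment_one_pos : 0 < X.moment 1 :=
  lt_of_le_of_ne (X.moment_nonneg 1) hX.moment_one_ne_zero.symm

theorem integrable_id_claimLaw : Integrable (fun z => z) X.claimLaw := by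
  by_contra h
  apply hX.moment_one_ne_zero
  rw [moment_eq_integral_claimLaw]
  simpa using integral_undef h

/-- Converts an upper bound on the safety loading into a lower bound on the rate. -/
theorem rate_mul_moment : X.rate * X.moment 1 = (1 + X.loading)⁻¹ := by
  have := hX.moment_one_ne_zero
  have := X.lam_pos
  have := X.c_pos
  rw [loading, rate, add_sub_cancel, inv_div]
  ring

theorem fI_div_eq (x : ℝ) : X.fI x / (1 + X.loading) = X.rate * X.tail x := by
  have h := hX.moment_one_ne_zero
  rw [div_eq_mul_inv, ← hX.rate_mul_moment, fI]
  field_simp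

/-- The Lundberg equation states the total mass; the density is integrable because otherwise that
integral would be 0. -/
theorem isProbabilityMeasure : IsProbabilityMeasure (X.tiltedLaw R) := by
  have h := hX.lundberg
  have hi : IntegrableOn (fun x => Real.exp (R * x) * (X.fI x / (1 + X.loading))) (Ioi 0) := by
    by_contra hc
    rw [integral_undef hc] at h
    exact zero_ne_one h
  have e : (fun x => Real.exp (R * x) * (X.fI x / (1 + X.loading))) =
      fun x => X.rate * Real.exp (R * x) * X.tail x := by
    funext x; rw [hX.fI_div_eq]; ring
  rw [e] at h hi
  constructor
  rw [tiltedLaw, withDensity_apply _ MeasurableSet.univ, setLIntegral_univ,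
    ← ofReal_integral_eq_lintegral_ofReal hi
      (Filter.Eventually.of_forall fun x => X.tiltedDensity_nonneg R x), h, ENNReal.ofReal_one]

theorem integrable_pow : Integrable (fun x => x ^ k) (X.tiltedLaw R) := by
  rw [integrable_tiltedLaw_iff]
  refine hX.expMoment_finite.congr (Filter.Eventually.of_forall fun x => ?_)
  dsimp only
  rw [hX.fI_div_eq]; ring

theorem integral_pow : ∫ x, x ^ k ∂X.tiltedLaw R = X.expMoment k R := by
  rw [integral_tiltedLaw, expMoment]
  refine integral_congr_ae (Filter.Eventually.of_forall fun x => ?_)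
  dsimp only
  rw [hX.fI_div_eq]; ring

theorem integrable_pow_of_le {i : ℕ} (hi : i ≤ k) : Integrable (fun x => x ^ i) (X.tiltedLaw R) := by
  have := hX.isProbabilityMeasure
  refine ((integrable_const 1).add hX.integrable_pow).mono' (by fun_prop) ?_
  filter_upwards [X.tiltedLaw_pos R] with x hx
  rw [Real.norm_of_nonneg (by positivity)]
  rcases le_total x 1 with h | h
  · have := pow_le_one₀ hx.le h (n := i)
    have : 0 ≤ x ^ k := by positivity
    simp only [Pi.add_apply]; linarith
  · have := pow_le_pow_right₀ h hi
    simp only [Pi.add_apply]; linarith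

theorem integral_pow_le {i : ℕ} (hi : i ≤ k) : ∫ x, x ^ i ∂X.tiltedLaw R ≤ 1 + X.expMoment k R := by
  have := hX.isProbabilityMeasure
  calc ∫ x, x ^ i ∂X.tiltedLaw R ≤ ∫ x, (1 + x ^ k) ∂X.tiltedLaw R := by
        refine integral_mono_ae (hX.integrable_pow_of_le hi) ((integrable_const 1).add hX.integrable_pow) ?_
        filter_upwards [X.tiltedLaw_pos R] with x hx
        rcases le_total x 1 with h | h
        · have := pow_le_one₀ hx.le h (n := i)
          have : 0 ≤ x ^ k := by positivity
          linarith
        · have := pow_le_pow_right₀ h hi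
          linarith
    _ = _ := by
        rw [integral_add (integrable_const 1) hX.integrable_pow, hX.integral_pow]
        simp

/-- The claims have a finite exponential moment at R > 0, which dominates the square. -/
theorem integrable_sq_claimLaw : Integrable (fun z => z ^ 2) X.claimLaw := by
  have := hX.isProbabilityMeasure
  have hR := hX.R_pos
  have hexp : Integrable (fun z => Real.exp (R * z)) X.claimLaw := by
    refine ⟨by fun_prop, ?_⟩
    rw [hasFiniteIntegral_iff_ofReal (Filter.Eventually.of_forall fun z => (Real.exp_pos _).le),
      X.lintegral_exp_claimLaw hR]
    exact ENNReal.ofReal_lt_top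
  refine (hexp.const_mul (2 / R ^ 2)).mono' (by fun_prop) ?_
  filter_upwards [X.claimLaw_pos] with z hz
  rw [Real.norm_of_nonneg (by positivity), div_mul_eq_mul_div, le_div_iff₀ (by positivity)]
  have := Real.quadratic_le_exp_of_nonneg (x := R * z) (by positivity)
  nlinarith [mul_pos hR hz]

theorem moment_two_pos : 0 < X.moment 2 := X.moment_pos hX.integrable_sq_claimLaw

/-- The claim costs exceed half their mean with probability bounded below. -/
theorem le_tail : X.moment 1 ^ 2 / (4 * X.moment 2) ≤ X.tail (X.moment 1 / 2) := by
  set m := X.moment 1 with hm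
  have hm1 : m = ∫ z, z ∂X.claimLaw := by rw [hm, moment_eq_integral_claimLaw]; simp
  have hp := hX.moment_one_pos
  have hp2 := hX.moment_two_pos
  -- The weight in z ≤ s z² / 2 + 1 / (2 s). With this choice the square contributes m / 4, and
  -- another m / 4 is left for the tail.
  set s := m / (2 * X.moment 2)
  have hs : 0 < s := by positivity
  have hi2 := hX.integrable_sq_claimLaw
  have i1 : Integrable (fun z => m / 2 + s / 2 * z ^ 2) X.claimLaw :=
    (integrable_const _).add (hi2.const_mul _)
  have i3 : Integrable ((Ioi (m / 2)).indicator fun _ => 1 / (2 * s)) X.claimLaw :=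
    (integrable_const _).indicator measurableSet_Ioi
  have htl : X.claimLaw.real (Ioi (m / 2)) = X.tail (m / 2) := by
    rw [measureReal_def, X.claimLaw_Ioi, ENNReal.toReal_ofReal (X.tail_nonneg _)]
  have h : m ≤ m / 2 + s / 2 * X.moment 2 + 1 / (2 * s) * X.tail (m / 2) := by
    calc m = ∫ z, z ∂X.claimLaw := hm1
      _ ≤ ∫ z, (m / 2 + s / 2 * z ^ 2 + (Ioi (m / 2)).indicator (fun _ => 1 / (2 * s)) z) ∂X.claimLaw := by
          refine integral_mono hX.integrable_id_claimLaw
            (i1.add i3) fun z => ?_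
          by_cases hz : m / 2 < z
          · simp only [indicator, mem_Ioi, hz, if_true]
            have : z ≤ s / 2 * z ^ 2 + 1 / (2 * s) := by
              rw [← sub_nonneg]
              have : s / 2 * z ^ 2 + 1 / (2 * s) - z = (s * z - 1) ^ 2 / (2 * s) := by
                field_simp; ring
              rw [this]; positivity
            linarith
          · simp only [indicator, mem_Ioi, hz, if_false]
            have : 0 ≤ s / 2 * z ^ 2 := by positivity
            linarith
      _ = _ := by
          rw [integral_add i1 i3,
            integral_add (integrable_const _) (hi2.const_mul _), integral_const_mul,
            integral_indicator_const _ measurableSet_Ioi, htl, ← X.moment_eq_integral_claimLaw]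
          simp [mul_comm]
  have e1 : s / 2 * X.moment 2 = m / 4 := by simp only [s]; field_simp; ring
  have e2 : 1 / (2 * s) = X.moment 2 / m := by simp only [s]; field_simp
  rw [e1, e2] at h
  rw [div_le_iff₀ (by positivity)]
  have h3 : m / 4 ≤ X.moment 2 / m * X.tail (m / 2) := by linarith
  rw [div_mul_eq_mul_div, le_div_iff₀ hp] at h3
  linarith

/-- The tail integrates to m₁ over the positive half-line and is at most 1, so (0, m₁ / 2] takes at
most half. -/
theorem le_lintegral_tail : ENNReal.ofReal (X.moment 1 / 2) ≤
    ∫⁻ y in Ioi (X.moment 1 / 2), X.claimLaw (Ioi y) := by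
  set m := X.moment 1 with hm
  have hp := hX.moment_one_pos
  have hm1 : m = ∫ z, z ∂X.claimLaw := by rw [hm, moment_eq_integral_claimLaw]; simp
  have h1 : ENNReal.ofReal m = ∫⁻ y in Ioi 0, X.claimLaw (Ioi y) := by
    rw [hm1, ofReal_integral_eq_lintegral_ofReal hX.integrable_id_claimLaw
      (X.claimLaw_pos.mono fun z hz => hz.le)]
    exact lintegral_eq_lintegral_meas_lt _ (X.claimLaw_pos.mono fun z hz => hz.le) aemeasurable_id
  have h2 : ∫⁻ y in Ioc 0 (m / 2), X.claimLaw (Ioi y) ≤ ENNReal.ofReal (m / 2) := by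
    calc _ ≤ ∫⁻ y in Ioc 0 (m / 2), 1 := lintegral_mono fun y => prob_le_one
      _ = _ := by simp
  rw [← Ioc_union_Ioi_eq_Ioi (by positivity : 0 ≤ m / 2), lintegral_union measurableSet_Ioi
      (Set.disjoint_left.2 fun y hy hy' => (not_lt.2 hy.2) hy')] at h1
  have h3 : ENNReal.ofReal (m / 2) + ENNReal.ofReal (m / 2) ≤
      ENNReal.ofReal (m / 2) + ∫⁻ y in Ioi (m / 2), X.claimLaw (Ioi y) := by
    rw [← ENNReal.ofReal_add (by positivity) (by positivity), add_halves, h1]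
    gcongr
  exact (ENNReal.add_le_add_iff_left ENNReal.ofReal_ne_top).1 h3

theorem le_rate_mul_lintegral_tail : ENNReal.ofReal (X.rate * X.moment 1 / 2) ≤
    ENNReal.ofReal X.rate * ∫⁻ y in Ioi (X.moment 1 / 2), X.claimLaw (Ioi y) := by
  rw [mul_div_assoc, ENNReal.ofReal_mul X.rate_pos.le]
  gcongr
  exact hX.le_lintegral_tail

/-- Tilting by exp (R y) ≥ 1 only adds to the untilted integral, so the bound is free of R. The same
holds in `le_integral_tiltedLaw_Iic`. -/
theorem le_tiltedLaw_Ioi : X.rate * X.moment 1 / 2 ≤ (X.tiltedLaw R).real (Ioi (X.moment 1 / 2)) := by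
  have := hX.isProbabilityMeasure
  have hp := hX.moment_one_pos
  rw [← ENNReal.ofReal_le_ofReal_iff measureReal_nonneg, ofReal_measureReal, ← setLIntegral_one,
    X.setLIntegral_tiltedLaw measurable_const measurableSet_Ioi,
    inter_eq_left.2 (Ioi_subset_Ioi (by positivity))]
  refine hX.le_rate_mul_lintegral_tail.trans ?_
  rw [← lintegral_const_mul _ X.measurable_claimLaw_Ioi]
  refine setLIntegral_mono (by fun_prop) fun y hy => ?_
  have hy' : X.moment 1 / 2 < y := hy
  have := X.rate_pos
  have := X.tail_nonneg y
  have h1 : 1 ≤ Real.exp (R * y) := Real.one_le_exp (mul_nonneg hX.R_pos.le (by linarith))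
  rw [claimLaw_Ioi, mul_one, ← ENNReal.ofReal_mul X.rate_pos.le]
  refine ENNReal.ofReal_le_ofReal ?_
  gcongr
  exact le_mul_of_one_le_right X.rate_pos.le h1

theorem le_integral_tiltedLaw_Iic (hk : 1 ≤ k) {a : ℝ} (ha : 0 ≤ a) :
    X.rate * X.tail a * (a ^ 2 / 2) ≤ ∫ x in Iic a, x ∂X.tiltedLaw R := by
  have := hX.isProbabilityMeasure
  have hr := X.rate_pos
  have ht := X.tail_nonneg a
  have hid : Integrable (fun x => x) (X.tiltedLaw R) := by simpa using hX.integrable_pow_of_le hk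
  have h0 : 0 ≤ᵐ[(X.tiltedLaw R).restrict (Iic a)] fun x => x :=
    ae_restrict_of_ae ((X.tiltedLaw_pos R).mono fun x hx => hx.le)
  rw [← ENNReal.ofReal_le_ofReal_iff (integral_nonneg_of_ae h0),
    ofReal_integral_eq_lintegral_ofReal hid.integrableOn h0,
    X.setLIntegral_tiltedLaw (by fun_prop) measurableSet_Iic, inter_comm, Ioi_inter_Iic]
  have e : X.rate * X.tail a * (a ^ 2 / 2) = ∫ x in Ioc 0 a, X.rate * X.tail a * x := by
    rw [← intervalIntegral.integral_of_le ha, intervalIntegral.integral_const_mul, integral_id]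
    ring
  rw [e, ofReal_integral_eq_lintegral_ofReal]
  · refine setLIntegral_mono (by fun_prop) fun x hx => ?_
    have hx0 : 0 < x := hx.1
    rw [← ENNReal.ofReal_mul (X.tiltedDensity_nonneg R x)]
    refine ENNReal.ofReal_le_ofReal ?_
    have h1 : 1 ≤ Real.exp (R * x) := Real.one_le_exp (mul_nonneg hX.R_pos.le hx0.le)
    gcongr
    · exact le_mul_of_one_le_right hr.le h1
    · exact X.tail_antitone hx.2
  · exact (by fun_prop : Continuous fun x => X.rate * X.tail a * x).continuousOn.integrableOn_compact
      isCompact_Icc |>.mono_set Ioc_subset_Icc_self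
  · filter_upwards [ae_restrict_mem measurableSet_Ioc] with x hx
    have := hx.1
    positivity

/-- With b = rate * exp (R a / 2), the tilted density is at most b on (0, a / 2] and at least b d on
(a / 2, a]. Total mass one forces b ≤ 2 / (a d), a bound on the density near 0 that needs no upper
bound on R or on the rate. -/
theorem tiltedLaw_Iic_le {a e d : ℝ} (ha : 0 < a) (hd : 0 < d) (hda : d ≤ X.tail a) (he : 0 ≤ e)
    (hea : e ≤ a / 2) : (X.tiltedLaw R).real (Iic e) ≤ e * (2 / (a * d)) := by
  have hp := hX.isProbabilityMeasure
  have hr := X.rate_pos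
  set b := X.rate * Real.exp (R * (a / 2))
  have hb : 0 < b := by positivity
  have h1 : ENNReal.ofReal (b * d * (a / 2)) ≤ 1 := by
    calc ENNReal.ofReal (b * d * (a / 2)) = ∫⁻ x in Ioc (a / 2) a, ENNReal.ofReal (b * d) := by
          rw [setLIntegral_const, Real.volume_Ioc, ← ENNReal.ofReal_mul (by positivity), sub_half]
      _ ≤ ∫⁻ x in Ioc (a / 2) a, ENNReal.ofReal (X.rate * Real.exp (R * x) * X.tail x) := by
          refine setLIntegral_mono (by fun_prop) fun x hx => ENNReal.ofReal_le_ofReal ?_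
          have := X.tail_antitone hx.2
          have := hX.R_pos
          have := hx.1.le
          simp only [b]
          gcongr
          linarith
      _ ≤ ∫⁻ x in Ioi 0, ENNReal.ofReal (X.rate * Real.exp (R * x) * X.tail x) := by
          refine lintegral_mono_set fun x hx => ?_
          exact lt_trans (by positivity) hx.1
      _ = 1 := by
          rw [← hp.measure_univ, ← lintegral_one, X.lintegral_tiltedLaw measurable_const]
          simp
  rw [ENNReal.ofReal_le_one] at h1
  rw [← ENNReal.ofReal_le_ofReal_iff (by positivity), ofReal_measureReal, ← setLIntegral_one,
    X.setLIntegral_tiltedLaw measurable_const measurableSet_Iic, inter_comm, Ioi_inter_Iic]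
  calc _ ≤ ∫⁻ x in Ioc 0 e, ENNReal.ofReal b := by
        refine setLIntegral_mono measurable_const fun x hx => ?_
        rw [mul_one]
        refine ENNReal.ofReal_le_ofReal ?_
        have := X.tail_le_one x
        have := X.tail_nonneg x
        have := hX.R_pos
        calc X.rate * Real.exp (R * x) * X.tail x ≤ X.rate * Real.exp (R * (a / 2)) * 1 := by
              gcongr
              exact hx.2.trans hea
          _ = b := mul_one _
    _ = ENNReal.ofReal (b * e) := by
        rw [setLIntegral_const, Real.volume_Ioc, ← ENNReal.ofReal_mul hb.le, sub_zero]
    _ ≤ _ := by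
        refine ENNReal.ofReal_le_ofReal ?_
        have : b ≤ 2 / (a * d) := by
          rw [le_div_iff₀ (by positivity)]; linarith
        rw [mul_comm]
        gcongr

end LightTailed

end RiskModel

/-! ### Uniform comparison of the rewards with the ruin probability. -/

namespace RiskModel

/-- Uniform bounds for the expected reward `E[(U_{T-})^j; T < ∞]` in terms of the ruin probability. -/
theorem exists_uniform_bounds {k j : ℕ} (hk : 2 ≤ k) (hjk : j + 1 ≤ k) {m₁ m₂ r : ℝ} (K : ℝ)
    (hm₁ : 0 < m₁) (hm₂ : 0 < m₂) (hr : 0 < r) :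
    ∃ b B : ℝ, 0 < b ∧ 0 ≤ B ∧ ∀ (Ω : Type*) [MeasurableSpace Ω] (P : Measure Ω) [IsProbabilityMeasure P]
      (X : RiskModel Ω P) (R : ℝ), X.LightTailed k R → X.moment 1 = m₁ → X.moment 2 = m₂ →
      X.expMoment k R ≤ K → r ≤ X.rate → ∀ u : ℝ, 0 ≤ u →
        0 < X.expectedReward (fun _ => 1) u ∧ X.expectedReward (fun _ => 1) u ≠ ⊤ ∧
        ENNReal.ofReal b * X.expectedReward (fun _ => 1) u ≤
          X.expectedReward (fun y => ENNReal.ofReal (max y 0 ^ j)) u ∧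
        X.expectedReward (fun y => ENNReal.ofReal (max y 0 ^ j)) u ≤
          ENNReal.ofReal B * X.expectedReward (fun _ => 1) u := by
  -- Below, d bounds the tail at a, ε the mass beyond a, and η the mean truncated at a, all from
  -- below. M dominates the tilted moments up to order k, with |K| ensuring M > 0; p is the constant
  -- of `expectedReward_one_lower_bound`.
  set a := m₁ / 2
  set d := m₁ ^ 2 / (4 * m₂)
  set ε := r * m₁ / 2
  set η := r * d * (a ^ 2 / 2)
  set M := 1 + |K|
  have ha : 0 < a := by positivity
  have hd : 0 < d := by positivity
  have hε : 0 < ε := by positivity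
  have hη : 0 < η := by positivity
  have hM : 0 < M := by positivity
  set p := ε * Real.exp (-(max a (2 * M / η) / η)) / (η / 2 + M) * (η / 2)
  have hp : 0 < p := by positivity
  -- The bound a / 2 gives access to `tiltedLaw_Iic_le`, and 1 gives x ≤ 1 on [0, e]. The last bound
  -- makes the reward for a surplus of at most e at most half of the lower bound for the ruin
  -- probability.
  set e := min (min (a / 2) 1) (p * (a * d) / (4 * (ε⁻¹ + η⁻¹)))
  have he : 0 < e := by positivity
  have hea : e ≤ a / 2 := (min_le_left _ _).trans (min_le_left _ _)
  have he1 : e ≤ 1 := (min_le_left _ _).trans (min_le_right _ _)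
  have hep : e * (2 / (a * d)) * (ε⁻¹ + η⁻¹) ≤ p / 2 := by
    have h : e ≤ p * (a * d) / (4 * (ε⁻¹ + η⁻¹)) := min_le_right _ _
    rw [le_div_iff₀ (by positivity)] at h
    have h2 : e * (2 / (a * d)) * (ε⁻¹ + η⁻¹) = (e * (4 * (ε⁻¹ + η⁻¹))) / (2 * (a * d)) := by
      field_simp; ring
    rw [h2, div_le_iff₀ (by positivity)]
    linarith
  refine ⟨e ^ j / 2, (ε⁻¹ * M + η⁻¹ * M) / p, by positivity, by positivity, ?_⟩
  intro Ω _ P _ X R hX h1 h2 hK hrX u hu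
  have hprob := hX.isProbabilityMeasure
  have hpos := X.tiltedLaw_pos R
  have hR := hX.R_pos
  have hid : Integrable (fun x => x) (X.tiltedLaw R) := by
    simpa using hX.integrable_pow_of_le (i := 1) (by omega)
  have hKM : 1 + X.expMoment k R ≤ M := by have := le_abs_self K; simp only [M]; linarith
  have hda : d ≤ X.tail a := by have := hX.le_tail; rw [h1, h2] at this; exact this
  have hεr : ε ≤ X.rate * m₁ / 2 := by simp only [ε]; gcongr
  have hμε : ε ≤ (X.tiltedLaw R).real (Ioi a) := by
    have := hX.le_tiltedLaw_Ioi
    rw [h1] at this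
    exact hεr.trans this
  have hμη : η ≤ ∫ x in Iic a, x ∂X.tiltedLaw R := by
    refine le_trans ?_ (hX.le_integral_tiltedLaw_Iic (by omega) ha.le)
    have := X.rate_pos
    simp only [η]
    gcongr
  have htail : ENNReal.ofReal ε ≤ ENNReal.ofReal X.rate * ∫⁻ y in Ioi a, X.claimLaw (Ioi y) := by
    have := hX.le_rate_mul_lintegral_tail
    rw [h1] at this
    exact (ENNReal.ofReal_le_ofReal hεr).trans this
  have hM₁ : ∫ x, x ∂X.tiltedLaw R ≤ M := by
    have := hX.integral_pow_le (i := 1) (by omega)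
    simp only [pow_one] at this
    linarith
  have hM₂ : ∫ x, x ^ 2 ∂X.tiltedLaw R ≤ M := (hX.integral_pow_le hk).trans hKM
  set q := Real.exp (-R * u)
  have hq : 0 < q := Real.exp_pos _
  set Φ := X.expectedReward (fun _ => 1) u
  have hlow : ENNReal.ofReal (q * p) ≤ Φ := X.expectedReward_one_lower_bound hR ha hε hη hμη hid
    (hX.integrable_pow_of_le hk) hM₁ hM₂ htail hu
  have hΦtop : Φ ≠ ⊤ := ne_top_of_le_ne_top ENNReal.ofReal_ne_top (X.expectedReward_one_le hR hu)
  refine ⟨lt_of_lt_of_le (ENNReal.ofReal_pos.2 (by positivity)) hlow, hΦtop, ?_, ?_⟩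
  -- Pointwise, e^j is at most (y⁺)^j + e^j w(y). As w earns at most half of the ruin probability,
  -- the other half is left for the j-th power.
  · set w : ℝ → ℝ := (Iic e).indicator fun _ => 1
    have hwm : Measurable w := measurable_const.indicator measurableSet_Iic
    have hw0 : ∀ y, 0 ≤ w y := fun y => indicator_nonneg (fun _ _ => zero_le_one) y
    have hwi : Integrable w (X.tiltedLaw R) := (integrable_const _).indicator measurableSet_Iic
    have hwle : ∀ y, w y ≤ 1 := fun y => indicator_le_self' (fun _ _ => zero_le_one) y
    have hwi' : Integrable (fun x => x * w x) (X.tiltedLaw R) := by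
      refine hid.mono' (by fun_prop) ?_
      filter_upwards [hpos] with x hx
      rw [Real.norm_of_nonneg (mul_nonneg hx.le (hw0 x))]
      exact mul_le_of_le_one_right hx.le (hwle x)
    have iw : ∫ x, w x ∂X.tiltedLaw R ≤ e * (2 / (a * d)) := by
      rw [integral_indicator_const _ measurableSet_Iic, smul_eq_mul, mul_one]
      exact hX.tiltedLaw_Iic_le ha hd hda he.le hea
    have iw' : ∫ x, x * w x ∂X.tiltedLaw R ≤ e * (2 / (a * d)) := by
      refine (integral_mono_ae hwi' hwi ?_).trans iw
      filter_upwards [hpos] with x hx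
      by_cases hxe : x ≤ e
      · simp only [w, indicator, mem_Iic, hxe, if_true]; linarith
      · simp [w, mem_Iic, hxe]
    have hup := X.expectedReward_upper_bound hR hwm hw0 hε hη hμε hμη hid hwi hwi' hu
    have hup2 : X.expectedReward (fun y => ENNReal.ofReal (w y)) u ≤ ENNReal.ofReal (1 / 2) * Φ := by
      refine hup.trans (le_trans ?_ (mul_le_mul_right hlow _))
      rw [← ENNReal.ofReal_mul (by norm_num)]
      refine ENNReal.ofReal_le_ofReal ?_
      calc _ ≤ q * (ε⁻¹ * (e * (2 / (a * d))) + η⁻¹ * (e * (2 / (a * d)))) := by gcongr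
        _ = q * (e * (2 / (a * d)) * (ε⁻¹ + η⁻¹)) := by ring
        _ ≤ q * (p / 2) := by gcongr
        _ = _ := by ring
    set Φj := X.expectedReward (fun y => ENNReal.ofReal (max y 0 ^ j)) u
    have hsum : ENNReal.ofReal (e ^ j) * Φ ≤ Φj + ENNReal.ofReal (e ^ j) *
        X.expectedReward (fun y => ENNReal.ofReal (w y)) u := by
      rw [← X.expectedReward_const_mul (by fun_prop),
        ← X.expectedReward_const_mul (w := fun y => ENNReal.ofReal (w y)) hwm.ennreal_ofReal,
        ← X.expectedReward_add (by fun_prop)]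
      refine X.expectedReward_mono (fun y => ?_) u
      dsimp only
      by_cases hy : y ≤ e
      · simp [w, hy]
      · refine le_add_right ?_
        rw [mul_one]
        refine ENNReal.ofReal_le_ofReal ?_
        exact pow_le_pow_left₀ he.le ((not_le.1 hy).le.trans (le_max_left _ _)) j
    have hfin : ENNReal.ofReal (e ^ j / 2) * Φ ≠ ⊤ := ENNReal.mul_ne_top ENNReal.ofReal_ne_top hΦtop
    refine (ENNReal.add_le_add_iff_right hfin).1 ?_
    calc _ = ENNReal.ofReal (e ^ j) * Φ := by
          rw [← add_mul, ← ENNReal.ofReal_add (by positivity) (by positivity), add_halves]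
      _ ≤ _ := hsum
      _ ≤ Φj + ENNReal.ofReal (e ^ j) * (ENNReal.ofReal (1 / 2) * Φ) := by gcongr
      _ = _ := by
          rw [← mul_assoc, ← ENNReal.ofReal_mul (by positivity)]
          congr 3
          ring
  -- The positive part makes the reward nonnegative on the whole line, at no cost under the tilted
  -- law. The factor x in the upper bound raises the order to j + 1.
  · have hmaxpow : ∀ᵐ x ∂X.tiltedLaw R, max x 0 ^ j = x ^ j := by
      filter_upwards [hpos] with x hx
      rw [max_eq_left hx.le]
    have hmaxpow' : ∀ᵐ x ∂X.tiltedLaw R, x * max x 0 ^ j = x ^ (j + 1) := by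
      filter_upwards [hmaxpow] with x hx
      rw [hx, pow_succ']
    have hwi : Integrable (fun x => max x 0 ^ j) (X.tiltedLaw R) :=
      (hX.integrable_pow_of_le (i := j) (by omega)).congr (hmaxpow.mono fun x hx => hx.symm)
    have hwi' : Integrable (fun x => x * max x 0 ^ j) (X.tiltedLaw R) :=
      (hX.integrable_pow_of_le hjk).congr (hmaxpow'.mono fun x hx => hx.symm)
    have hup := X.expectedReward_upper_bound hR (w := fun x => max x 0 ^ j) (by fun_prop)
      (fun y => by positivity) hε hη hμε hμη hid hwi hwi' hu
    refine hup.trans (le_trans ?_ (mul_le_mul_right hlow _))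
    rw [← ENNReal.ofReal_mul (by positivity)]
    refine ENNReal.ofReal_le_ofReal ?_
    rw [integral_congr_ae hmaxpow, integral_congr_ae hmaxpow']
    have i1 := (hX.integral_pow_le (i := j) (by omega)).trans hKM
    have i2 := (hX.integral_pow_le hjk).trans hKM
    calc _ ≤ q * (ε⁻¹ * M + η⁻¹ * M) := by gcongr
      _ = _ := by field_simp

end RiskModel

/-! ### Erlang arrival times and moments of the number of claims. -/

namespace RiskModel

variable {Ω : Type*} [MeasurableSpace Ω] {P : Measure Ω} [IsProbabilityMeasure P] (X : RiskModel Ω P)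

@[fun_prop]
theorem measurable_arrival (n : ℕ) : Measurable (X.arrival n) :=
  Finset.measurable_sum _ fun i _ => X.measurable_W i

/-- The density of the arrival time of a claim. -/
noncomputable def arrivalDensity (n : ℕ) (x : ℝ) : ℝ :=
  X.lam ^ (n + 1) * x ^ n / n.factorial * Real.exp (-X.lam * x)

@[fun_prop]
theorem measurable_arrivalDensity (n : ℕ) : Measurable (X.arrivalDensity n) := by
  unfold arrivalDensity; fun_prop

theorem arrivalDensity_nonneg (n : ℕ) {x : ℝ} (hx : 0 ≤ x) : 0 ≤ X.arrivalDensity n x := by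
  have := X.lam_pos
  unfold arrivalDensity; positivity

/-- The two exponentials combine to exp (-λ y), independent of x, so only the integral of x^n over
(0, y) remains. -/
theorem lintegral_arrivalDensity_convolution (n : ℕ) {y : ℝ} (hy : 0 < y) :
    ∫⁻ x in Ioi 0, (if x < y then ENNReal.ofReal (X.arrivalDensity n x) *
      ENNReal.ofReal (X.lam * Real.exp (-X.lam * (y - x))) else 0) =
      ENNReal.ofReal (X.arrivalDensity (n + 1) y) := by
  have hl := X.lam_pos
  set κ := X.lam ^ (n + 2) / n.factorial * Real.exp (-X.lam * y)
  have e1 : ∫⁻ x in Ioi 0, (if x < y then ENNReal.ofReal (X.arrivalDensity n x) *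
      ENNReal.ofReal (X.lam * Real.exp (-X.lam * (y - x))) else 0) =
      ∫⁻ x in Ioc 0 y, ENNReal.ofReal (κ * x ^ n) := by
    rw [← setLIntegral_congr Ioo_ae_eq_Ioc, ← lintegral_indicator measurableSet_Ioi,
      ← lintegral_indicator measurableSet_Ioo]
    refine lintegral_congr fun x => ?_
    simp only [indicator, mem_Ioi, mem_Ioo]
    by_cases h1 : 0 < x <;> by_cases h2 : x < y <;> simp only [h1, h2, and_self, and_false, false_and, if_true,
      if_false]
    rw [← ENNReal.ofReal_mul (X.arrivalDensity_nonneg n h1.le)]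
    congr 1
    simp only [arrivalDensity, κ]
    rw [show -X.lam * y = -X.lam * x + -X.lam * (y - x) by ring, Real.exp_add]
    ring
  have hcont : Continuous fun x : ℝ => κ * x ^ n := by fun_prop
  rw [e1, ← ofReal_integral_eq_lintegral_ofReal
    (hcont.continuousOn.integrableOn_compact isCompact_Icc |>.mono_set Ioc_subset_Icc_self),
    ← intervalIntegral.integral_of_le hy.le, intervalIntegral.integral_const_mul, integral_pow]
  · congr 1
    simp only [arrivalDensity, κ, Nat.factorial_succ]
    push_cast
    field_simp
    simp
  · filter_upwards [ae_restrict_mem measurableSet_Ioc] with x hx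
    have := hx.1
    positivity

/-- The arrival times have Erlang laws. -/
theorem lintegral_arrival (n : ℕ) {f : ℝ → ENNReal} (hf : Measurable f) :
    ∫⁻ ω, f (X.arrival n ω) ∂P = ∫⁻ x in Ioi 0, ENNReal.ofReal (X.arrivalDensity n x) * f x := by
  have hl := X.lam_pos
  induction n generalizing f with
  | zero =>
    have e : X.arrival 0 = X.W 0 := by funext ω; simp [arrival]
    have h := lintegral_expMeasure_affine hl one_pos hf 0
    simp only [zero_add, one_mul, div_one, sub_zero] at h
    rw [e, ← lintegral_map hf (X.measurable_W 0), X.law_W, h, ← lintegral_const_mul _ (by fun_prop)]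
    refine lintegral_congr fun x => ?_
    rw [← mul_assoc, ← ENNReal.ofReal_mul hl.le]
    simp [arrivalDensity]
  | succ n ih =>
    have hW : iIndepFun X.W P := X.indep.precomp (g := Sum.inl) Sum.inl_injective
    have hind : IndepFun (X.arrival n) (X.W (n + 1)) P := by
      have := hW.indepFun_sum_range_succ X.measurable_W (n + 1)
      convert this using 1
      funext ω
      simp [arrival]
    have := isProbabilityMeasure_expMeasure hl
    have hmap := (indepFun_iff_map_prod_eq_prod_map_map (X.measurable_arrival n).aemeasurable
      (X.measurable_W (n + 1)).aemeasurable).1 hind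
    rw [X.law_W] at hmap
    have : IsProbabilityMeasure (P.map (X.arrival n)) :=
      Measure.isProbabilityMeasure_map (X.measurable_arrival n).aemeasurable
    have hfm : Measurable fun p : ℝ × ℝ => f (p.1 + p.2) := by fun_prop
    let G : ℝ → ENNReal := fun x => ∫⁻ s, f (x + s) ∂expMeasure X.lam
    have hG : Measurable G := hfm.lintegral_prod_right'
    have hG' : ∀ x, G x = ∫⁻ y in Ioi x, ENNReal.ofReal (X.lam * Real.exp (-X.lam * (y - x))) * f y :=
      fun x => by
        have h := lintegral_expMeasure_affine hl one_pos hf x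
        simp only [one_mul, div_one] at h
        simp only [G]
        rw [h, ← lintegral_const_mul _ (by fun_prop)]
        refine lintegral_congr fun y => ?_
        rw [← mul_assoc, ← ENNReal.ofReal_mul hl.le]
    have e1 : ∫⁻ ω, f (X.arrival (n + 1) ω) ∂P = ∫⁻ ω, G (X.arrival n ω) ∂P := by
      calc _ = ∫⁻ ω, f (X.arrival n ω + X.W (n + 1) ω) ∂P := by
            simp only [arrival, Finset.sum_range_succ _ (n + 1)]
        _ = ∫⁻ p, f (p.1 + p.2) ∂P.map (fun ω => (X.arrival n ω, X.W (n + 1) ω)) :=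
            (lintegral_map hfm ((X.measurable_arrival n).prodMk (X.measurable_W _))).symm
        _ = ∫⁻ x, G x ∂P.map (X.arrival n) := by rw [hmap, lintegral_prod _ hfm.aemeasurable]
        _ = _ := lintegral_map hG (X.measurable_arrival n)
    have hm : Measurable fun p : ℝ × ℝ => if p.1 < p.2 then
        ENNReal.ofReal (X.arrivalDensity n p.1) *
          ENNReal.ofReal (X.lam * Real.exp (-X.lam * (p.2 - p.1))) * f p.2 else 0 :=
      Measurable.ite (measurableSet_lt measurable_fst measurable_snd) (by fun_prop) (by fun_prop)
    have e2 : ∫⁻ x in Ioi 0, ENNReal.ofReal (X.arrivalDensity n x) * G x =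
        ∫⁻ x in Ioi 0, ∫⁻ y in Ioi 0, if x < y then ENNReal.ofReal (X.arrivalDensity n x) *
          ENNReal.ofReal (X.lam * Real.exp (-X.lam * (y - x))) * f y else 0 := by
      refine setLIntegral_congr_fun measurableSet_Ioi fun x hx => ?_
      have hx' : 0 < x := hx
      rw [hG', ← lintegral_const_mul _ (by fun_prop), ← lintegral_indicator measurableSet_Ioi,
        ← lintegral_indicator measurableSet_Ioi]
      refine lintegral_congr fun y => ?_
      by_cases h : x < y
      · simp [indicator, h, hx'.trans h, mul_assoc]
      · simp [indicator, h]
    rw [e1, ih hG, e2, lintegral_lintegral_swap hm.aemeasurable]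
    refine setLIntegral_congr_fun measurableSet_Ioi fun y hy => ?_
    rw [← X.lintegral_arrivalDensity_convolution n hy, ← lintegral_mul_const _
      (Measurable.ite measurableSet_Iio (by fun_prop) (by fun_prop))]
    refine lintegral_congr fun x => ?_
    split_ifs <;> simp

theorem measure_arrival_le (n : ℕ) (t : ℝ) :
    P {ω | X.arrival n ω ≤ t} = ∫⁻ x in Ioc 0 t, ENNReal.ofReal (X.arrivalDensity n x) := by
  have h := X.lintegral_arrival n (f := (Iic t).indicator 1) (measurable_one.indicator measurableSet_Iic)
  have e1 : ∫⁻ ω, (Iic t).indicator (1 : ℝ → ENNReal) (X.arrival n ω) ∂P = P {ω | X.arrival n ω ≤ t} := by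
    rw [← lintegral_indicator_one (measurableSet_le (X.measurable_arrival n) measurable_const)]
    rfl
  rw [← e1, h, ← lintegral_indicator measurableSet_Ioi, ← lintegral_indicator measurableSet_Ioc]
  refine lintegral_congr fun x => ?_
  by_cases h1 : 0 < x <;> by_cases h2 : x ≤ t <;> simp [indicator, h1, h2]

/-- The densities are λ times Poisson weights; their sum is the constant renewal density of the
claim arrivals. -/
theorem hasSum_arrivalDensity (x : ℝ) : HasSum (fun n => X.arrivalDensity n x) X.lam := by
  have h := (NormedSpace.expSeries_div_hasSum_exp (X.lam * x)).mul_left (X.lam * Real.exp (-X.lam * x))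
  rw [← Real.exp_eq_exp_ℝ, mul_assoc, ← Real.exp_add] at h
  simp only [neg_mul, neg_add_cancel, Real.exp_zero, mul_one] at h
  refine Eq.subst (motive := fun f => HasSum f X.lam) (funext fun n => ?_) h
  simp only [arrivalDensity, mul_pow, neg_mul]
  ring

theorem hasSum_mul_arrivalDensity (x : ℝ) :
    HasSum (fun n : ℕ => n * X.arrivalDensity n x) (X.lam * x * X.lam) := by
  have h := (X.hasSum_arrivalDensity x).mul_left (X.lam * x)
  rw [← hasSum_nat_add_iff' 1]
  simp only [Finset.range_one, Finset.sum_singleton, Nat.cast_zero, zero_mul, sub_zero]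
  refine Eq.subst (motive := fun f => HasSum f (X.lam * x * X.lam)) (funext fun n => ?_) h
  simp only [arrivalDensity, Nat.factorial_succ]
  push_cast
  field_simp
  ring

/-- The expected number of claims. -/
theorem tsum_measure_arrival_le (t : ℝ) :
    ∑' n, P {ω | X.arrival n ω ≤ t} = ENNReal.ofReal (X.lam * t) := by
  simp only [measure_arrival_le]
  rw [← lintegral_tsum fun n => by fun_prop]
  calc _ = ∫⁻ x in Ioc 0 t, ENNReal.ofReal X.lam := by
        refine setLIntegral_congr_fun measurableSet_Ioc fun x hx => ?_
        have h := X.hasSum_arrivalDensity x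
        rw [← ENNReal.ofReal_tsum_of_nonneg (fun n => X.arrivalDensity_nonneg n hx.1.le) h.summable,
          h.tsum_eq]
    _ = _ := by
        rw [setLIntegral_const, Real.volume_Ioc, sub_zero, ← ENNReal.ofReal_mul X.lam_pos.le]

/-- The second factorial moment of the number of claims. -/
theorem tsum_mul_measure_arrival_le {t : ℝ} (ht : 0 ≤ t) :
    ∑' n : ℕ, (n : ENNReal) * P {ω | X.arrival n ω ≤ t} = ENNReal.ofReal ((X.lam * t) ^ 2 / 2) := by
  have hl := X.lam_pos
  simp only [measure_arrival_le]
  have e : ∀ n : ℕ, (n : ENNReal) * ∫⁻ x in Ioc 0 t, ENNReal.ofReal (X.arrivalDensity n x) =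
      ∫⁻ x in Ioc 0 t, ENNReal.ofReal (n * X.arrivalDensity n x) := fun n => by
    rw [← lintegral_const_mul _ (by fun_prop)]
    refine lintegral_congr fun x => ?_
    rw [ENNReal.ofReal_mul n.cast_nonneg, ENNReal.ofReal_natCast]
  simp only [e]
  rw [← lintegral_tsum fun n => by fun_prop]
  have hcont : Continuous fun x => X.lam * x * X.lam := by fun_prop
  calc _ = ∫⁻ x in Ioc 0 t, ENNReal.ofReal (X.lam * x * X.lam) := by
        refine setLIntegral_congr_fun measurableSet_Ioc fun x hx => ?_
        have h := X.hasSum_mul_arrivalDensity x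
        rw [← ENNReal.ofReal_tsum_of_nonneg
          (fun n => mul_nonneg n.cast_nonneg (X.arrivalDensity_nonneg n hx.1.le)) h.summable, h.tsum_eq]
    _ = _ := by
        rw [← ofReal_integral_eq_lintegral_ofReal
          (hcont.continuousOn.integrableOn_compact isCompact_Icc |>.mono_set Ioc_subset_Icc_self),
          ← intervalIntegral.integral_of_le ht, intervalIntegral.integral_mul_const,
          intervalIntegral.integral_const_mul, integral_id]
        · congr 1
          ring
        · filter_upwards [ae_restrict_mem measurableSet_Ioc] with x hx
          have := hx.1
          positivity

/-- The paths with positive inter-arrival times and claim costs, and with finitely many claims in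
bounded time. -/
structure IsRegularPath (ω : Ω) : Prop where
  W_pos : ∀ i, 0 < X.W i ω
  Z_pos : ∀ i, 0 < X.Z i ω
  arrival_unbounded : ∀ t, ∃ n, t < X.arrival n ω

/-- The expected number of claims up to any integer time is finite, so Borel–Cantelli excludes
infinitely many claims there. -/
theorem ae_isRegularPath : ∀ᵐ ω ∂P, X.IsRegularPath ω := by
  have hl := X.lam_pos
  have hW : ∀ᵐ ω ∂P, ∀ i, 0 < X.W i ω := by
    rw [ae_all_iff]
    intro i
    refine (ae_map_iff (X.measurable_W i).aemeasurable measurableSet_Ioi).1 ?_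
    have h := lintegral_expMeasure_affine hl one_pos (f := (Iic 0).indicator 1)
      (measurable_one.indicator measurableSet_Iic) 0
    simp only [zero_add, one_mul, div_one, sub_zero] at h
    rw [X.law_W, ae_iff]
    change expMeasure X.lam (Ioi 0)ᶜ = 0
    rw [compl_Ioi, ← lintegral_indicator_one measurableSet_Iic, h,
      setLIntegral_congr_fun (g := fun _ => 0) measurableSet_Ioi fun y hy => ?_]
    · simp
    · have : ¬ y ≤ 0 := not_le.2 hy
      simp [this]
  have hA : ∀ᵐ ω ∂P, ∀ T : ℕ, ∀ᶠ n in Filter.atTop, ω ∉ {ω | X.arrival n ω ≤ T} := by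
    rw [ae_all_iff]
    intro T
    refine ae_eventually_notMem ?_
    rw [X.tsum_measure_arrival_le]
    exact ENNReal.ofReal_ne_top
  filter_upwards [hW, ae_all_iff.2 X.Z_pos, hA] with ω h1 h2 h3
  refine ⟨h1, h2, fun t => ?_⟩
  obtain ⟨T, hT⟩ := exists_nat_ge t
  obtain ⟨n, hn⟩ := (h3 T).exists
  exact ⟨n, hT.trans_lt (not_le.1 hn)⟩

end RiskModel

/-! ### Moments of the compound Poisson sum, and the loading of the approximation. -/

namespace RiskModel

variable {Ω : Type*} [MeasurableSpace Ω] {P : Measure Ω} [IsProbabilityMeasure P] (X : RiskModel Ω P)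

section path

variable {X} {ω : Ω} (hω : X.IsRegularPath ω)
include hω

theorem IsRegularPath.arrival_strictMono : StrictMono fun n => X.arrival n ω :=
  strictMono_nat_of_lt_succ fun n => by
    simp only [arrival, Finset.sum_range_succ _ (n + 1)]
    linarith [hω.W_pos (n + 1)]

theorem IsRegularPath.arrival_pos (n : ℕ) : 0 < X.arrival n ω :=
  Finset.sum_pos (fun i _ => hω.W_pos i) (by simp)

/-- On a regular path the arrivals up to t form a finite initial segment of ℕ. Finiteness matters,
since `ncard` of an infinite set is 0. -/
theorem IsRegularPath.arrival_le_iff (t : ℝ) (i : ℕ) : X.arrival i ω ≤ t ↔ i < X.claimCount t ω := by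
  classical
  have hex := hω.arrival_unbounded t
  have h : {i : ℕ | X.arrival i ω ≤ t} = Iio (Nat.find hex) := by
    ext i
    simp only [mem_ofPred_eq, mem_Iio]
    constructor
    · intro hi
      by_contra hc
      exact absurd (lt_of_lt_of_le (Nat.find_spec hex)
        (hω.arrival_strictMono.monotone (not_lt.1 hc))) (not_lt.2 hi)
    · intro hi
      exact not_lt.1 (Nat.find_min hex hi)
  have hc : X.claimCount t ω = Nat.find hex := by
    rw [claimCount, h, ← Finset.coe_Iio, ncard_coe_finset, Nat.card_Iio]
  rw [hc]
  exact Set.ext_iff.1 h i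

/-- Trades the random number of summands for indicators of arrivals, to which Tonelli and the
independence of arrivals and claims apply. -/
theorem IsRegularPath.sum_range_claimCount (t : ℝ) (y : ℕ → Ω → ENNReal) :
    ∑ i ∈ Finset.range (X.claimCount t ω), y i ω =
      ∑' n, {ω | X.arrival n ω ≤ t}.indicator (y n) ω := by
  rw [tsum_eq_sum (s := Finset.range (X.claimCount t ω))]
  · refine Finset.sum_congr rfl fun i hi => ?_
    have : X.arrival i ω ≤ t := (hω.arrival_le_iff t i).2 (Finset.mem_range.1 hi)
    simp [this]
  · intro i hi
    have : ¬ X.arrival i ω ≤ t := fun h => hi (Finset.mem_range.2 ((hω.arrival_le_iff t i).1 h))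
    simp [this]

end path

theorem indepFun_arrival_claims (n : ℕ) : IndepFun (X.arrival n) (fun ω i => X.Z i ω) P := by
  have h : IndepFun (fun ω i => X.W i ω) (fun ω i => X.Z i ω) P := by
    refine IndepFun.process_indepFun_process X.measurable_W X.measurable_Z fun I J => ?_
    have hdis : Disjoint (I.image Sum.inl : Finset (ℕ ⊕ ℕ)) (J.image Sum.inr) := by
      simp [Finset.disjoint_left]
    have h := X.indep.indepFun_finset _ _ hdis X.measurable_elim
    exact h.comp
      (φ := fun (x : ↥(I.image Sum.inl : Finset (ℕ ⊕ ℕ)) → ℝ) (i : I) =>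
         x ⟨.inl i, Finset.mem_image_of_mem _ i.2⟩)
      (ψ := fun (x : ↥(J.image Sum.inr : Finset (ℕ ⊕ ℕ)) → ℝ) (i : J) =>
         x ⟨.inr i, Finset.mem_image_of_mem _ i.2⟩)
      (by fun_prop) (by fun_prop)
  exact h.comp (φ := fun x : ℕ → ℝ => ∑ i ∈ Finset.range (n + 1), x i) (ψ := id) (by fun_prop)
    measurable_id

/-- The expectation of a sum over the claims until time `t`. -/
theorem lintegral_sum_range_claimCount (t : ℝ) {y : ℕ → (ℕ → ℝ) → ENNReal} (hy : ∀ n, Measurable (y n)) :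
    ∫⁻ ω, ∑ i ∈ Finset.range (X.claimCount t ω), y i (fun i => X.Z i ω) ∂P =
      ∑' n, P {ω | X.arrival n ω ≤ t} * ∫⁻ ω, y n (fun i => X.Z i ω) ∂P := by
  have hZ : Measurable fun ω i => X.Z i ω := measurable_pi_lambda _ X.measurable_Z
  have hms : ∀ n, MeasurableSet {ω | X.arrival n ω ≤ t} := fun n =>
    measurableSet_le (X.measurable_arrival n) measurable_const
  rw [lintegral_congr_ae (X.ae_isRegularPath.mono fun ω hω => hω.sum_range_claimCount t
      fun n ω => y n fun i => X.Z i ω),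
    lintegral_tsum (f := fun n => {ω | X.arrival n ω ≤ t}.indicator fun ω => y n fun i => X.Z i ω)
      fun n => (((hy n).comp hZ).indicator (hms n)).aemeasurable]
  refine tsum_congr fun n => ?_
  have hind : IndepFun (fun ω => (Iic t).indicator (1 : ℝ → ENNReal) (X.arrival n ω))
      (fun ω => y n fun i => X.Z i ω) P :=
    (X.indepFun_arrival_claims n).comp (measurable_one.indicator measurableSet_Iic) (hy n)
  have h := lintegral_mul_eq_lintegral_mul_lintegral_of_indepFun
    ((measurable_one.indicator measurableSet_Iic).comp (X.measurable_arrival n)) ((hy n).comp hZ) hind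
  have e1 : ∫⁻ ω, (Iic t).indicator (1 : ℝ → ENNReal) (X.arrival n ω) ∂P = P {ω | X.arrival n ω ≤ t} := by
    rw [← lintegral_indicator_one (hms n)]
    rfl
  rw [← e1]
  refine Eq.trans (lintegral_congr fun ω => ?_) h
  by_cases hle : X.arrival n ω ≤ t <;> simp [indicator, hle]

/-- The aggregate claim cost until time `t`. -/
noncomputable def aggregate (t : ℝ) (ω : Ω) : ℝ := ∑ i ∈ Finset.range (X.claimCount t ω), X.Z i ω

/-- Ordering each pair by its later claim gives a sum of the form handled by
`lintegral_sum_range_claimCount`. -/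
theorem sq_sum_range (z : ℕ → ENNReal) (N : ℕ) : (∑ i ∈ Finset.range N, z i) ^ 2 =
    ∑ i ∈ Finset.range N, (z i ^ 2 + 2 * ∑ j ∈ Finset.range i, z i * z j) := by
  induction N with
  | zero => simp
  | succ N ih =>
    rw [Finset.sum_range_succ, Finset.sum_range_succ, ← ih, ← Finset.mul_sum]
    ring

theorem lintegral_Z (i : ℕ) : ∫⁻ ω, ENNReal.ofReal (X.Z i ω) ∂P = ∫⁻ z, ENNReal.ofReal z ∂X.claimLaw := by
  rw [claimLaw, ← (X.identDistrib_Z i).map_eq, lintegral_map ENNReal.measurable_ofReal (X.measurable_Z i)]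

theorem lintegral_Z_sq (i : ℕ) :
    ∫⁻ ω, ENNReal.ofReal (X.Z i ω) ^ 2 ∂P = ∫⁻ z, ENNReal.ofReal z ^ 2 ∂X.claimLaw := by
  rw [claimLaw, ← (X.identDistrib_Z i).map_eq, lintegral_map (by fun_prop) (X.measurable_Z i)]

theorem ofReal_aggregate {ω : Ω} (hω : X.IsRegularPath ω) (t : ℝ) :
    ENNReal.ofReal (X.aggregate t ω) = ∑ i ∈ Finset.range (X.claimCount t ω), ENNReal.ofReal (X.Z i ω) :=
  ENNReal.ofReal_sum_of_nonneg fun i _ => (hω.Z_pos i).le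

theorem aggregate_nonneg {ω : Ω} (hω : X.IsRegularPath ω) (t : ℝ) : 0 ≤ X.aggregate t ω :=
  Finset.sum_nonneg fun i _ => (hω.Z_pos i).le

theorem aemeasurable_aggregate (t : ℝ) : AEMeasurable (X.aggregate t) P := by
  have hm : Measurable fun ω => (∑' n, {ω | X.arrival n ω ≤ t}.indicator
      (fun ω => ENNReal.ofReal (X.Z n ω)) ω).toReal := by
    refine (Measurable.tsum fun n => ?_).ennreal_toReal
    exact (X.measurable_Z n).ennreal_ofReal.indicator (measurableSet_le (X.measurable_arrival n) measurable_const)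
  refine ⟨_, hm, ?_⟩
  filter_upwards [X.ae_isRegularPath] with ω hω
  rw [← ENNReal.toReal_ofReal (X.aggregate_nonneg hω t), X.ofReal_aggregate hω,
    hω.sum_range_claimCount t fun n ω => ENNReal.ofReal (X.Z n ω)]

theorem lintegral_aggregate (t : ℝ) : ∫⁻ ω, ENNReal.ofReal (X.aggregate t ω) ∂P =
    ENNReal.ofReal (X.lam * t) * ∫⁻ z, ENNReal.ofReal z ∂X.claimLaw := by
  rw [lintegral_congr_ae (X.ae_isRegularPath.mono fun ω hω => X.ofReal_aggregate hω t),
    X.lintegral_sum_range_claimCount t (y := fun n z => ENNReal.ofReal (z n)) (fun n => by fun_prop)]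
  simp only [lintegral_Z]
  rw [ENNReal.tsum_mul_right, tsum_measure_arrival_le]

theorem lintegral_aggregate_sq {t : ℝ} (ht : 0 ≤ t) : ∫⁻ ω, ENNReal.ofReal (X.aggregate t ω) ^ 2 ∂P =
    ENNReal.ofReal (X.lam * t) * (∫⁻ z, ENNReal.ofReal z ^ 2 ∂X.claimLaw) +
      ENNReal.ofReal ((X.lam * t) ^ 2) * (∫⁻ z, ENNReal.ofReal z ∂X.claimLaw) ^ 2 := by
  set e₁ := ∫⁻ z, ENNReal.ofReal z ∂X.claimLaw
  set e₂ := ∫⁻ z, ENNReal.ofReal z ^ 2 ∂X.claimLaw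
  have hmZ : ∀ i, Measurable fun ω => ENNReal.ofReal (X.Z i ω) := fun i => (X.measurable_Z i).ennreal_ofReal
  have hmm : ∀ n j, Measurable fun ω => ENNReal.ofReal (X.Z n ω) * ENNReal.ofReal (X.Z j ω) :=
    fun n j => (hmZ n).mul (hmZ j)
  have hpair : ∀ n : ℕ, ∀ j ∈ Finset.range n,
      ∫⁻ ω, ENNReal.ofReal (X.Z n ω) * ENNReal.ofReal (X.Z j ω) ∂P = e₁ ^ 2 := fun n j hj => by
    have hne : (Sum.inr n : ℕ ⊕ ℕ) ≠ .inr j := by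
      have := Finset.mem_range.1 hj
      simp only [ne_eq, Sum.inr.injEq]
      omega
    have h : IndepFun (X.Z n) (X.Z j) P := X.indep.indepFun hne
    have h2 : IndepFun (fun ω => ENNReal.ofReal (X.Z n ω)) (fun ω => ENNReal.ofReal (X.Z j ω)) P :=
      h.comp ENNReal.measurable_ofReal ENNReal.measurable_ofReal
    have h3 := lintegral_mul_eq_lintegral_mul_lintegral_of_indepFun (hmZ n) (hmZ j) h2
    rw [X.lintegral_Z, X.lintegral_Z, ← sq] at h3
    exact h3
  have hterm : ∀ n : ℕ, ∫⁻ ω, (ENNReal.ofReal (X.Z n ω) ^ 2 +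
      2 * ∑ j ∈ Finset.range n, ENNReal.ofReal (X.Z n ω) * ENNReal.ofReal (X.Z j ω)) ∂P =
      e₂ + 2 * (n * e₁ ^ 2) := fun n => by
    rw [lintegral_add_left ((hmZ n).pow_const 2), X.lintegral_Z_sq, lintegral_const_mul _
      (Finset.measurable_sum _ fun j _ => hmm n j),
      lintegral_finsetSum _ fun j _ => hmm n j, Finset.sum_congr rfl (hpair n)]
    simp [e₂]
  have h1 : ∫⁻ ω, ENNReal.ofReal (X.aggregate t ω) ^ 2 ∂P =
      ∫⁻ ω, ∑ i ∈ Finset.range (X.claimCount t ω), (fun n (z : ℕ → ℝ) => ENNReal.ofReal (z n) ^ 2 +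
        2 * ∑ j ∈ Finset.range n, ENNReal.ofReal (z n) * ENNReal.ofReal (z j)) i (fun i => X.Z i ω) ∂P := by
    refine lintegral_congr_ae (X.ae_isRegularPath.mono fun ω hω => ?_)
    dsimp only
    rw [X.ofReal_aggregate hω, sq_sum_range]
  rw [h1, X.lintegral_sum_range_claimCount t (y := fun n (z : ℕ → ℝ) => ENNReal.ofReal (z n) ^ 2 +
        2 * ∑ j ∈ Finset.range n, ENNReal.ofReal (z n) * ENNReal.ofReal (z j)) (fun n => by fun_prop)]
  simp only [hterm, mul_add]
  rw [ENNReal.tsum_add, ENNReal.tsum_mul_right, tsum_measure_arrival_le]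
  congr 1
  -- The factor n counts the claims before claim n, so the weighted series is the expected number of
  -- pairs, (λ t)² / 2.
  have : ∀ n : ℕ, P {ω | X.arrival n ω ≤ t} * (2 * (n * e₁ ^ 2)) =
      (n * P {ω | X.arrival n ω ≤ t}) * (2 * e₁ ^ 2) := fun n => by ring
  simp only [this]
  rw [ENNReal.tsum_mul_right, X.tsum_mul_measure_arrival_le ht, ← mul_assoc]
  congr 1
  rw [← ENNReal.ofReal_ofNat, ← ENNReal.ofReal_mul (by positivity)]
  congr 1
  ring

variable {k : ℕ} {R : ℝ}

/-- The first two moments of the reserve at time `1`, without initial reserve. -/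
theorem LightTailed.integral_reserve {X : RiskModel Ω P} (hX : X.LightTailed k R) :
    ∫ ω, X.reserve 0 1 ω ∂P = X.c - X.lam * X.moment 1 ∧
    ∫ ω, X.reserve 0 1 ω ^ 2 ∂P = (X.c - X.lam * X.moment 1) ^ 2 + X.lam * X.moment 2 := by
  have hl := X.lam_pos
  have h1 : ∫⁻ z, ENNReal.ofReal z ∂X.claimLaw = ENNReal.ofReal (X.moment 1) := by
    rw [moment_eq_integral_claimLaw]
    simp only [pow_one]
    rw [ofReal_integral_eq_lintegral_ofReal hX.integrable_id_claimLaw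
      (X.claimLaw_pos.mono fun z hz => hz.le)]
  have h2 : ∫⁻ z, ENNReal.ofReal z ^ 2 ∂X.claimLaw = ENNReal.ofReal (X.moment 2) := by
    rw [moment_eq_integral_claimLaw, ofReal_integral_eq_lintegral_ofReal hX.integrable_sq_claimLaw
      (X.claimLaw_pos.mono fun z hz => sq_nonneg z)]
    refine lintegral_congr_ae (X.claimLaw_pos.mono fun z hz => ?_)
    exact (ENNReal.ofReal_pow hz.le 2).symm
  have hm1 := X.moment_nonneg 1
  have hm2 := X.moment_nonneg 2
  set S := X.aggregate 1
  have hSm : AEStronglyMeasurable S P := (X.aemeasurable_aggregate 1).aestronglyMeasurable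
  have hS0 : 0 ≤ᵐ[P] S := X.ae_isRegularPath.mono fun ω hω => X.aggregate_nonneg hω 1
  have hS2m : AEStronglyMeasurable (fun ω => S ω ^ 2) P := hSm.pow 2
  have hS20 : 0 ≤ᵐ[P] fun ω => S ω ^ 2 := Filter.Eventually.of_forall fun ω => sq_nonneg _
  have l1 : ∫⁻ ω, ENNReal.ofReal (S ω) ∂P = ENNReal.ofReal (X.lam * X.moment 1) := by
    rw [X.lintegral_aggregate, h1, ← ENNReal.ofReal_mul (by positivity), mul_one]
  have l2 : ∫⁻ ω, ENNReal.ofReal (S ω ^ 2) ∂P =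
      ENNReal.ofReal (X.lam * X.moment 2 + (X.lam * X.moment 1) ^ 2) := by
    rw [lintegral_congr_ae (hS0.mono fun ω hω => ENNReal.ofReal_pow hω 2),
      X.lintegral_aggregate_sq zero_le_one, h1, h2, ← ENNReal.ofReal_pow hm1,
      ← ENNReal.ofReal_mul (by positivity), ← ENNReal.ofReal_mul (by positivity),
      ← ENNReal.ofReal_add (by positivity) (by positivity)]
    congr 1
    ring
  have i1 : Integrable S P := ⟨hSm, by
    rw [hasFiniteIntegral_iff_ofReal hS0, l1]; exact ENNReal.ofReal_lt_top⟩
  have i2 : Integrable (fun ω => S ω ^ 2) P := ⟨hS2m, by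
    rw [hasFiniteIntegral_iff_ofReal hS20, l2]; exact ENNReal.ofReal_lt_top⟩
  have I1 : ∫ ω, S ω ∂P = X.lam * X.moment 1 := by
    rw [integral_eq_lintegral_of_nonneg_ae hS0 hSm, l1, ENNReal.toReal_ofReal (by positivity)]
  have I2 : ∫ ω, S ω ^ 2 ∂P = X.lam * X.moment 2 + (X.lam * X.moment 1) ^ 2 := by
    rw [integral_eq_lintegral_of_nonneg_ae hS20 hS2m, l2, ENNReal.toReal_ofReal (by positivity)]
  have hres : X.reserve 0 1 = fun ω => X.c - S ω := by
    funext ω; simp [reserve, S, aggregate]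
  constructor
  · rw [hres, integral_sub (integrable_const _) i1, I1]
    simp
  · have e : ∀ ω, X.reserve 0 1 ω ^ 2 = X.c ^ 2 - 2 * X.c * S ω + S ω ^ 2 := fun ω => by
      rw [hres]; ring
    have i3 : Integrable (fun ω => 2 * X.c * S ω) P := i1.const_mul _
    have i4 : Integrable (fun ω => X.c ^ 2 - 2 * X.c * S ω) P := (integrable_const _).sub i3
    simp only [e]
    rw [integral_add i4 i2, integral_sub (integrable_const _) i3, integral_const_mul, I1, I2]
    simp
    ring

/-- The safety loading of a De Vylder type approximation. -/
theorem IsDeVylderApprox.loading_eq {Ω' : Type*} [MeasurableSpace Ω'] {P' : Measure Ω'}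
    [IsProbabilityMeasure P'] {X : RiskModel Ω P} {Y : RiskModel Ω' P'} {R' : ℝ} (hk : 2 ≤ k)
    (h : IsDeVylderApprox k X Y) (hX : X.LightTailed k R) (hY : Y.LightTailed k R') :
    Y.loading = X.loading * (X.moment 1 * Y.moment 2 / (X.moment 2 * Y.moment 1)) := by
  -- Time 1 and reserve 0 suffice: equal means give equal c - λ m₁, and then equal second moments
  -- give equal λ m₂. The loading is (c - λ m₁) / (λ m₁).
  have h1 := h 1 le_rfl (by omega) 1 0 zero_le_one le_rfl
  have h2 := h 2 one_le_two hk 1 0 zero_le_one le_rfl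
  simp only [pow_one] at h1
  rw [hX.integral_reserve.1, hY.integral_reserve.1] at h1
  rw [hX.integral_reserve.2, hY.integral_reserve.2, h1] at h2
  have h3 : X.lam * X.moment 2 = Y.lam * Y.moment 2 := by linarith
  have := X.lam_pos
  have := Y.lam_pos
  have := hX.moment_one_pos
  have := hX.moment_two_pos
  have := hY.moment_one_pos
  have := hY.moment_two_pos
  have e1 : X.loading = (X.c - X.lam * X.moment 1) / (X.lam * X.moment 1) := by
    rw [loading]; field_simp
  have e2 : Y.loading = (Y.c - Y.lam * Y.moment 1) / (Y.lam * Y.moment 1) := by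
    rw [loading]; field_simp
  have e3 : Y.moment 2 = X.lam * X.moment 2 / Y.lam := by rw [h3]; field_simp
  rw [e1, e2, h1, e3]
  field_simp

end RiskModel

/-! ### Paths of the reserve: the time of ruin and the surplus before it. -/

/-- The reserve just after a claim. -/
def postClaim (c u : ℝ) (ξ : ℕ ⊕ ℕ → ℝ) (n : ℕ) : ℝ :=
  u + c * ∑ i ∈ Finset.range (n + 1), ξ (.inl i) - ∑ i ∈ Finset.range (n + 1), ξ (.inr i)

/-- The reserve just before a claim. -/
def preClaim (c u : ℝ) (ξ : ℕ ⊕ ℕ → ℝ) (n : ℕ) : ℝ :=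
  u + c * ∑ i ∈ Finset.range (n + 1), ξ (.inl i) - ∑ i ∈ Finset.range n, ξ (.inr i)

section reward

variable {c : ℝ} {w : ℝ → ENNReal}

theorem postClaim_succ (u : ℝ) (ξ : ℕ ⊕ ℕ → ℝ) (n : ℕ) : postClaim c u ξ (n + 1) =
    postClaim c (u + c * ξ (.inl 0) - ξ (.inr 0)) (seqShift ξ) n := by
  simp only [postClaim, seqShift, Sum.map_inl, Sum.map_inr, Finset.sum_range_succ' _ (n + 1), Nat.succ_eq_add_one]
  ring

theorem preClaim_succ (u : ℝ) (ξ : ℕ ⊕ ℕ → ℝ) (n : ℕ) : preClaim c u ξ (n + 1) =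
    preClaim c (u + c * ξ (.inl 0) - ξ (.inr 0)) (seqShift ξ) n := by
  simp only [preClaim, seqShift, Sum.map_inl, Sum.map_inr, Finset.sum_range_succ' _ (n + 1),
    Finset.sum_range_succ' _ n, Nat.succ_eq_add_one]
  ring

theorem postClaim_zero (u : ℝ) (ξ : ℕ ⊕ ℕ → ℝ) : postClaim c u ξ 0 = u + c * ξ (.inl 0) - ξ (.inr 0) := by
  simp [postClaim]

theorem preClaim_zero (u : ℝ) (ξ : ℕ ⊕ ℕ → ℝ) : preClaim c u ξ 0 = u + c * ξ (.inl 0) := by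
  simp [preClaim]

theorem totalReward_of_forall_nonneg {u : ℝ} {ξ : ℕ ⊕ ℕ → ℝ} (h : ∀ n, 0 ≤ postClaim c u ξ n) :
    totalReward c w u ξ = 0 := by
  have key : ∀ N u ξ, (∀ n, 0 ≤ postClaim c u ξ n) → reward c w N u ξ = 0 := by
    intro N
    induction N with
    | zero => intros; rfl
    | succ N ih =>
      intro u ξ h
      have h0 := h 0
      rw [postClaim_zero] at h0
      rw [reward, if_neg (by linarith), ih]
      intro n
      rw [← postClaim_succ]
      exact h _
  simp [totalReward, key _ u ξ h]

theorem totalReward_of_first_neg {u : ℝ} {ξ : ℕ ⊕ ℕ → ℝ} {n : ℕ} (hn : postClaim c u ξ n < 0)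
    (h : ∀ m < n, 0 ≤ postClaim c u ξ m) : totalReward c w u ξ = w (preClaim c u ξ n) := by
  induction n generalizing u ξ with
  | zero =>
    rw [postClaim_zero] at hn
    rw [totalReward_eq, if_pos (by linarith), preClaim_zero]
  | succ n ih =>
    have h0 := h 0 n.succ_pos
    rw [postClaim_zero] at h0
    rw [totalReward_eq, if_neg (by linarith), preClaim_succ, ih]
    · rwa [← postClaim_succ]
    · intro m hm
      rw [← postClaim_succ]
      exact h _ (by omega)

end reward

namespace RiskModel

variable {Ω : Type*} [MeasurableSpace Ω] {P : Measure Ω} [IsProbabilityMeasure P] (X : RiskModel Ω P)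

theorem postClaim_seq (u : ℝ) (ω : Ω) (n : ℕ) : postClaim X.c u (X.seq ω) n =
    u + X.c * X.arrival n ω - ∑ i ∈ Finset.range (n + 1), X.Z i ω := rfl

theorem preClaim_seq (u : ℝ) (ω : Ω) (n : ℕ) : preClaim X.c u (X.seq ω) n =
    u + X.c * X.arrival n ω - ∑ i ∈ Finset.range n, X.Z i ω := rfl

section path

variable {X} {ω : Ω} (hω : X.IsRegularPath ω) {u : ℝ}
include hω

theorem IsRegularPath.claimCount_eq {t : ℝ} {n : ℕ} (h : ∀ i, X.arrival i ω ≤ t ↔ i < n) :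
    X.claimCount t ω = n := by
  have h' : ∀ i, i < X.claimCount t ω ↔ i < n := fun i => (hω.arrival_le_iff t i).symm.trans (h i)
  have h1 := h' n
  have h2 := h' (X.claimCount t ω)
  omega

theorem IsRegularPath.reserve_arrival (n : ℕ) :
    X.reserve u (X.arrival n ω) ω = postClaim X.c u (X.seq ω) n := by
  have : X.claimCount (X.arrival n ω) ω = n + 1 := hω.claimCount_eq fun i => by
    rw [hω.arrival_strictMono.le_iff_le, Nat.lt_succ_iff]
  rw [reserve, this, postClaim_seq]

/-- Between claims the reserve increases, so a negative value at t was already negative just after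
the last claim; before any claim the reserve is at least u. -/
theorem IsRegularPath.exists_of_reserve_neg (hu : 0 ≤ u) {t : ℝ} (ht : 0 ≤ t)
    (h : X.reserve u t ω < 0) : ∃ n, X.arrival n ω ≤ t ∧ postClaim X.c u (X.seq ω) n < 0 := by
  have hc := X.c_pos
  rcases Nat.eq_zero_or_pos (X.claimCount t ω) with h0 | h0
  · rw [reserve, h0] at h
    simp only [Finset.range_zero, Finset.sum_empty, sub_zero] at h
    have : 0 ≤ X.c * t := by positivity
    linarith
  · obtain ⟨n, hn⟩ : ∃ n, X.claimCount t ω = n + 1 := ⟨X.claimCount t ω - 1, by omega⟩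
    have hle : X.arrival n ω ≤ t := (hω.arrival_le_iff t n).2 (by omega)
    refine ⟨n, hle, lt_of_le_of_lt ?_ h⟩
    rw [reserve, hn, postClaim_seq]
    gcongr

theorem IsRegularPath.ruinTime_eq_top (hu : 0 ≤ u) (h : ∀ n, 0 ≤ postClaim X.c u (X.seq ω) n) :
    X.ruinTime u ω = ⊤ := by
  have : {t : ℝ | 0 ≤ t ∧ X.reserve u t ω < 0} = ∅ := by
    rw [eq_empty_iff_forall_notMem]
    rintro t ⟨ht, htr⟩
    obtain ⟨n, _, hn⟩ := hω.exists_of_reserve_neg hu ht htr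
    exact absurd (h n) (not_le.2 hn)
  rw [ruinTime, this, image_empty, sInf_empty]

theorem IsRegularPath.ruinTime_eq_arrival (hu : 0 ≤ u) {n : ℕ} (hn : postClaim X.c u (X.seq ω) n < 0)
    (h : ∀ m < n, 0 ≤ postClaim X.c u (X.seq ω) m) :
    X.ruinTime u ω = ENNReal.ofReal (X.arrival n ω) := by
  refine le_antisymm (sInf_le ⟨_, ⟨(hω.arrival_pos n).le, ?_⟩, rfl⟩) (le_sInf ?_)
  · rwa [hω.reserve_arrival]
  · rintro _ ⟨t, ⟨ht, htr⟩, rfl⟩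
    obtain ⟨m, hmt, hm⟩ := hω.exists_of_reserve_neg hu ht htr
    have hnm : n ≤ m := by
      by_contra hc
      exact absurd (h m (not_le.1 hc)) (not_le.2 hm)
    exact ENNReal.ofReal_le_ofReal ((hω.arrival_strictMono.monotone hnm).trans hmt)

theorem IsRegularPath.surplusBeforeRuin_eq (hu : 0 ≤ u) {n : ℕ} (hn : postClaim X.c u (X.seq ω) n < 0)
    (h : ∀ m < n, 0 ≤ postClaim X.c u (X.seq ω) m) :
    X.surplusBeforeRuin u ω = preClaim X.c u (X.seq ω) n := by
  rw [surplusBeforeRuin, hω.ruinTime_eq_arrival hu hn h, ENNReal.toReal_ofReal (hω.arrival_pos n).le]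
  refine leftLim_eq_of_tendsto ?_
  -- Here s is the previous arrival, or 0 for the first claim. Between s and the ruinous claim the
  -- reserve is affine, so its left limit is immediate.
  obtain ⟨s, hs, hs'⟩ : ∃ s < X.arrival n ω, ∀ m < n, X.arrival m ω ≤ s := by
    rcases n with _ | n
    · exact ⟨0, hω.arrival_pos 0, fun m hm => absurd hm (Nat.not_lt_zero m)⟩
    · exact ⟨X.arrival n ω, hω.arrival_strictMono n.lt_succ_self, fun m hm =>
        hω.arrival_strictMono.monotone (Nat.lt_succ_iff.1 hm)⟩
  have hev : (fun t => u + X.c * t - ∑ i ∈ Finset.range n, X.Z i ω) =ᶠ[nhdsWithin (X.arrival n ω) (Iio (X.arrival n ω))]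
      fun t => X.reserve u t ω := by
    filter_upwards [Ioo_mem_nhdsLT hs] with t ht
    have : X.claimCount t ω = n := hω.claimCount_eq fun i => by
      constructor
      · intro hi
        exact hω.arrival_strictMono.lt_iff_lt.1 (lt_of_le_of_lt hi ht.2)
      · intro hi
        exact (hs' i hi).trans ht.1.le
    rw [reserve, this]
  refine Filter.Tendsto.congr' hev ?_
  rw [preClaim_seq]
  exact ((by fun_prop : Continuous fun t => u + X.c * t - ∑ i ∈ Finset.range n, X.Z i ω).tendsto _).mono_left
    nhdsWithin_le_nhds

/-- Premiums earned over a positive waiting time make this strict even from reserve 0. -/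
theorem IsRegularPath.preClaim_pos (hu : 0 ≤ u) {n : ℕ}
    (h : ∀ m < n, 0 ≤ postClaim X.c u (X.seq ω) m) : 0 < preClaim X.c u (X.seq ω) n := by
  have hc := X.c_pos
  rcases n with _ | n
  · rw [preClaim_zero]
    have : 0 < X.c * X.seq ω (.inl 0) := mul_pos hc (hω.W_pos 0)
    linarith
  · have h1 := h n n.lt_succ_self
    rw [postClaim_seq] at h1
    rw [preClaim_seq]
    have h2 : X.c * X.arrival n ω < X.c * X.arrival (n + 1) ω :=
      mul_lt_mul_of_pos_left (hω.arrival_strictMono n.lt_succ_self) hc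
    linarith

/-- Pathwise description of ruin. -/
theorem IsRegularPath.ruin_cases (hu : 0 ≤ u) :
    (ω ∉ X.ruinEvent u ∧ ∀ w : ℝ → ENNReal, totalReward X.c w u (X.seq ω) = 0) ∨
    (ω ∈ X.ruinEvent u ∧ 0 < X.surplusBeforeRuin u ω ∧ ∀ w : ℝ → ENNReal,
      totalReward X.c w u (X.seq ω) = w (X.surplusBeforeRuin u ω)) := by
  classical
  by_cases hex : ∃ n, postClaim X.c u (X.seq ω) n < 0
  · have hn := Nat.find_spec hex
    have hm : ∀ m < Nat.find hex, 0 ≤ postClaim X.c u (X.seq ω) m := fun m hm =>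
      not_lt.1 (Nat.find_min hex hm)
    have hs := hω.surplusBeforeRuin_eq hu hn hm
    refine Or.inr ⟨?_, ?_, fun w => ?_⟩
    · rw [ruinEvent, mem_ofPred_eq, hω.ruinTime_eq_arrival hu hn hm]
      exact ENNReal.ofReal_lt_top
    · rw [hs]; exact hω.preClaim_pos hu hm
    · rw [hs]; exact totalReward_of_first_neg hn hm
  · have h : ∀ n, 0 ≤ postClaim X.c u (X.seq ω) n := fun n => not_lt.1 fun hn => hex ⟨n, hn⟩
    refine Or.inl ⟨?_, fun w => totalReward_of_forall_nonneg h⟩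
    rw [ruinEvent, mem_ofPred_eq, hω.ruinTime_eq_top hu h]
    exact lt_irrefl _

end path

variable {u : ℝ} (hu : 0 ≤ u)
include hu

/-- Up to a null set, ruin means that the unit reward is nonzero, a measurable condition on the
claim sequence. -/
theorem nullMeasurableSet_ruinEvent : NullMeasurableSet (X.ruinEvent u) P := by
  have hm : MeasurableSet {ω | totalReward X.c (fun _ => 1) u (X.seq ω) ≠ 0} :=
    (X.measurable_totalReward_seq measurable_const u) (measurableSet_singleton 0).compl
  refine hm.nullMeasurableSet.congr ?_
  filter_upwards [X.ae_isRegularPath] with ω hω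
  apply propext
  change totalReward X.c (fun _ => 1) u (X.seq ω) ≠ 0 ↔ ω ∈ X.ruinEvent u
  rcases hω.ruin_cases hu with ⟨h1, h2⟩ | ⟨h1, _, h2⟩
  · simp [h1, h2]
  · simp [h1, h2]

theorem setLIntegral_ruinEvent (w : ℝ → ENNReal) :
    ∫⁻ ω in X.ruinEvent u, w (X.surplusBeforeRuin u ω) ∂P = X.expectedReward w u := by
  rw [← lintegral_indicator₀ (X.nullMeasurableSet_ruinEvent hu), expectedReward]
  refine lintegral_congr_ae ?_
  filter_upwards [X.ae_isRegularPath] with ω hω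
  rcases hω.ruin_cases hu with ⟨h1, h2⟩ | ⟨h1, _, h2⟩
  · simp [h1, h2]
  · simp [h1, h2]

theorem measure_ruinEvent : P (X.ruinEvent u) = X.expectedReward (fun _ => 1) u := by
  rw [← X.setLIntegral_ruinEvent hu, setLIntegral_one]

theorem ruinProb_eq : X.ruinProb u = (X.expectedReward (fun _ => 1) u).toReal := by
  rw [ruinProb, measureReal_def, X.measure_ruinEvent hu]

theorem ae_surplusBeforeRuin_pos : ∀ᵐ ω ∂P.restrict (X.ruinEvent u), 0 < X.surplusBeforeRuin u ω := by
  rw [ae_restrict_iff'₀ (X.nullMeasurableSet_ruinEvent hu)]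
  filter_upwards [X.ae_isRegularPath] with ω hω hmem
  rcases hω.ruin_cases hu with ⟨h1, _⟩ | ⟨_, h, _⟩
  · exact absurd hmem h1
  · exact h

/-- On the ruin event the reward with w the identity recovers the surplus, which provides a
measurable version. -/
theorem aemeasurable_surplusBeforeRuin :
    AEMeasurable (X.surplusBeforeRuin u) (P.restrict (X.ruinEvent u)) := by
  refine ⟨fun ω => (totalReward X.c ENNReal.ofReal u (X.seq ω)).toReal,
    (X.measurable_totalReward_seq ENNReal.measurable_ofReal u).ennreal_toReal, ?_⟩
  refine (ae_restrict_iff'₀ (X.nullMeasurableSet_ruinEvent hu)).2 ?_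
  filter_upwards [X.ae_isRegularPath] with ω hω hmem
  rcases hω.ruin_cases hu with ⟨h1, _⟩ | ⟨_, h, h2⟩
  · exact absurd hmem h1
  · rw [h2, ENNReal.toReal_ofReal h.le]

theorem lintegral_surplusBeforeRuin_pow (j : ℕ) :
    ∫⁻ ω in X.ruinEvent u, ENNReal.ofReal (X.surplusBeforeRuin u ω ^ j) ∂P =
      X.expectedReward (fun y => ENNReal.ofReal (max y 0 ^ j)) u := by
  rw [← X.setLIntegral_ruinEvent hu]
  refine lintegral_congr_ae ?_
  filter_upwards [X.ae_surplusBeforeRuin_pos hu] with ω hω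
  rw [max_eq_left hω.le]

theorem integrable_surplusBeforeRuin_pow (j : ℕ)
    (hfin : X.expectedReward (fun y => ENNReal.ofReal (max y 0 ^ j)) u ≠ ⊤)
    (hpos : 0 < X.expectedReward (fun _ => 1) u) :
    Integrable (fun ω => X.surplusBeforeRuin u ω ^ j) (X.ruinLaw u) := by
  refine Integrable.smul_measure ⟨((X.aemeasurable_surplusBeforeRuin hu).pow_const j).aestronglyMeasurable, ?_⟩ ?_
  · rw [hasFiniteIntegral_iff_ofReal ((X.ae_surplusBeforeRuin_pos hu).mono fun ω hω => pow_nonneg hω.le j),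
      X.lintegral_surplusBeforeRuin_pow hu]
    exact lt_top_iff_ne_top.2 hfin
  · rw [X.measure_ruinEvent hu]
    exact ENNReal.inv_ne_top.2 hpos.ne'

theorem surplusMoment_eq (j : ℕ) : X.surplusMoment j u =
    (X.expectedReward (fun y => ENNReal.ofReal (max y 0 ^ j)) u).toReal /
      (X.expectedReward (fun _ => 1) u).toReal := by
  rw [surplusMoment, ruinLaw, ProbabilityTheory.cond, integral_smul_measure, X.measure_ruinEvent hu,
    integral_eq_lintegral_of_nonneg_ae
      ((X.ae_surplusBeforeRuin_pos hu).mono fun ω hω => pow_nonneg hω.le j)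
      ((X.aemeasurable_surplusBeforeRuin hu).pow_const j).aestronglyMeasurable,
    X.lintegral_surplusBeforeRuin_pow hu, ENNReal.toReal_inv, smul_eq_mul, inv_mul_eq_div]

end RiskModel

/-! ### Bounds for the conditional moments and comparison of the two models. -/

namespace RiskModel

/-- The conditional moments of the surplus before ruin are bounded, and bounded away from zero,
uniformly in the initial reserve and in safety loadings from a bounded interval. -/
theorem exists_surplusMoment_bounds {k j : ℕ} (hk : 2 ≤ k) (hjk : j + 1 ≤ k) {m₁ m₂ θ₀ : ℝ} (K : ℝ)
    (hm₁ : 0 < m₁) (hm₂ : 0 < m₂) (hθ₀ : 0 < θ₀) :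
    ∃ b B : ℝ, 0 < b ∧ 0 ≤ B ∧ ∀ (Ω : Type*) [MeasurableSpace Ω] (P : Measure Ω) [IsProbabilityMeasure P]
      (X : RiskModel Ω P) (R : ℝ), X.LightTailed k R → X.moment 1 = m₁ → X.moment 2 = m₂ →
      X.expMoment k R ≤ K → 0 < X.loading → X.loading ≤ θ₀ → ∀ u : ℝ, 0 ≤ u →
        0 < X.ruinProb u ∧ Integrable (fun ω => X.surplusBeforeRuin u ω ^ j) (X.ruinLaw u) ∧
        b ≤ X.surplusMoment j u ∧ X.surplusMoment j u ≤ B := by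
  -- The smallest rate compatible with a loading of at most θ₀, by `rate_mul_moment`.
  have hr : 0 < ((1 + θ₀) * m₁)⁻¹ := by positivity
  obtain ⟨b, B, hb, hB, h⟩ := exists_uniform_bounds hk hjk K hm₁ hm₂ hr
  refine ⟨b, B, hb, hB, fun Ω _ P _ X R hX h1 h2 hK hl hl' u hu => ?_⟩
  have hrate : ((1 + θ₀) * m₁)⁻¹ ≤ X.rate := by
    have h3 := hX.rate_mul_moment
    rw [h1] at h3
    rw [mul_inv, ← div_eq_mul_inv, div_le_iff₀ hm₁, h3]
    gcongr
  obtain ⟨hpos, hfin, hlow, hupp⟩ := h Ω P X R hX h1 h2 hK hrate u hu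
  have hfin' : X.expectedReward (fun y => ENNReal.ofReal (max y 0 ^ j)) u ≠ ⊤ :=
    ne_top_of_le_ne_top (ENNReal.mul_ne_top ENNReal.ofReal_ne_top hfin) hupp
  have hpos' := ENNReal.toReal_pos hpos.ne' hfin
  refine ⟨?_, X.integrable_surplusBeforeRuin_pow hu j hfin' hpos, ?_, ?_⟩
  · rwa [X.ruinProb_eq hu]
  · have := ENNReal.toReal_mono hfin' hlow
    rw [ENNReal.toReal_mul, ENNReal.toReal_ofReal hb.le] at this
    rwa [X.surplusMoment_eq hu, le_div_iff₀ hpos']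
  · have := ENNReal.toReal_mono (ENNReal.mul_ne_top ENNReal.ofReal_ne_top hfin) hupp
    rw [ENNReal.toReal_mul, ENNReal.toReal_ofReal hB] at this
    rwa [X.surplusMoment_eq hu, div_le_iff₀ hpos']

end RiskModel

theorem theorem4 (k j : ℕ) (hk : 2 ≤ k) (hj : 1 ≤ j) (hjk : j ≤ k - 1)
    (θ₀ : ℝ) (m m' : ℕ → ℝ) (K K' H H' : ℝ) :
    ∃ C : ℝ, 0 ≤ C ∧
      ∀ (Ω : Type*) [MeasurableSpace Ω] (P : Measure Ω) [IsProbabilityMeasure P]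
        (Ω' : Type*) [MeasurableSpace Ω'] (P' : Measure Ω') [IsProbabilityMeasure P']
        (X : RiskModel Ω P) (Y : RiskModel Ω' P') (R R' : ℝ),
        X.LightTailed k R → Y.LightTailed k R' →
        RiskModel.IsDeVylderApprox k X Y →
        (∀ i, 1 ≤ i → i ≤ k → X.moment i = m i) →
        (∀ i, 1 ≤ i → i ≤ k → Y.moment i = m' i) →
        X.expMoment k R ≤ K → Y.expMoment k R' ≤ K' →
        X.hI ≤ H → Y.hI ≤ H' →
        0 < X.loading → X.loading ≤ θ₀ →
        ∀ u : ℝ, 0 ≤ u →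
          0 < X.ruinProb u ∧ 0 < Y.ruinProb u ∧
          Integrable (fun ω => X.surplusBeforeRuin u ω ^ j) (X.ruinLaw u) ∧
          Integrable (fun ω => Y.surplusBeforeRuin u ω ^ j) (Y.ruinLaw u) ∧
          0 < X.surplusMoment j u ∧
          |X.surplusMoment j u - Y.surplusMoment j u| ≤ C ∧
          |(X.surplusMoment j u - Y.surplusMoment j u) / X.surplusMoment j u| ≤ C := by
  have hk1 : 1 ≤ k := by omega
  have hjk' : j + 1 ≤ k := by omega
  -- If any of these signs fails, no pair of models has the prescribed data and any constant will
  -- do.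
  by_cases hpos : (0 < m 1 ∧ 0 < m 2) ∧ (0 < m' 1 ∧ 0 < m' 2) ∧ 0 < θ₀
  swap
  · refine ⟨0, le_rfl, fun Ω _ P _ Ω' _ P' _ X Y R R' hX hY _ hm hm' _ _ _ _ hl hl' => ?_⟩
    refine absurd ⟨⟨?_, ?_⟩, ⟨?_, ?_⟩, hl.trans_le hl'⟩ hpos
    · exact hm 1 le_rfl hk1 ▸ hX.moment_one_pos
    · exact hm 2 one_le_two hk ▸ hX.moment_two_pos
    · exact hm' 1 le_rfl hk1 ▸ hY.moment_one_pos
    · exact hm' 2 one_le_two hk ▸ hY.moment_two_pos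
  obtain ⟨⟨h1, h2⟩, ⟨h1', h2'⟩, hθ₀⟩ := hpos
  have hq : 0 < m 1 * m' 2 / (m 2 * m' 1) := by positivity
  obtain ⟨b, B, hb, hB, hbB⟩ :=
    RiskModel.exists_surplusMoment_bounds hk hjk' K h1 h2 hθ₀
  -- The loading of the approximation is that of the original times a ratio of prescribed moments,
  -- so it is at most θ₀ times this ratio.
  obtain ⟨b', B', hb', hB', hbB'⟩ :=
    RiskModel.exists_surplusMoment_bounds hk hjk' K' h1' h2' (mul_pos hθ₀ hq)
  refine ⟨max (B + B') ((B + B') / b), le_max_of_le_left (by positivity), ?_⟩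
  intro Ω _ P _ Ω' _ P' _ X Y R R' hX hY hXY hm hm' hK hK' _ _ hl hl' u hu
  have hY_loading : Y.loading = X.loading * (m 1 * m' 2 / (m 2 * m' 1)) := by
    rw [hXY.loading_eq hk hX hY, hm 1 le_rfl hk1, hm 2 one_le_two hk, hm' 1 le_rfl hk1,
      hm' 2 one_le_two hk]
  obtain ⟨hψ, hint, hlow, hupp⟩ := hbB Ω P X R hX (hm 1 le_rfl hk1) (hm 2 one_le_two hk) hK hl hl' u hu
  obtain ⟨hψ', hint', hlow', hupp'⟩ := hbB' Ω' P' Y R' hY (hm' 1 le_rfl hk1) (hm' 2 one_le_two hk) hK'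
    (hY_loading ▸ mul_pos hl hq) (hY_loading ▸ mul_le_mul_of_nonneg_right hl' hq.le) u hu
  have hdiff : |X.surplusMoment j u - Y.surplusMoment j u| ≤ B + B' := by
    rw [abs_le]; constructor <;> linarith
  have hs : 0 < X.surplusMoment j u := hb.trans_le hlow
  refine ⟨hψ, hψ', hint, hint', hs, hdiff.trans (le_max_left _ _), le_max_of_le_right ?_⟩
  rw [abs_div, abs_of_pos hs]
  gcongr
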